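/- Let $F$ be a non-archimedean local field of odd residue characteristic $p$, $E/F$ the unramified quadratic extension with non-trivial automorphism $x\mapsto\bar x$, rings of integers $\mathfrak o_F,\mathfrak o_E$, maximal ideal $\mathfrak p_E$ of $\mathfrak o_E$, and let $\varpi\in F$ be a uniformizer of $E$. Let $\beta$ be the antidiagonal $3\times3$ permutation matrix, $h(v,w)=v^{T}\beta\bar w$ on $E^3$, let $G=U(2,1)(E/F)=\{g\in GL_3(E): h(gv,gw)=h(v,w)\ \forall v,w\}$ and $\alpha=\mathrm{diag}(\varpi^{-1},1,\varpi)\in G$. Let $K$ be one of the two maximal compact open subgroups $$K_0=G\cap M_3(\mathfrak o_E),\qquad K_1=G\cap\begin{pmatrix}\mathfrak o_E&\mathfrak o_E&\mathfrak p_E^{-1}\\ \mathfrak p_E&\mathfrak o_E&\mathfrak o_E\\ \mathfrak p_E&\mathfrak p_E&\mathfrak o_E\end{pmatrix}.$$ Let $K^1$ be the maximal normal pro-$p$ subgroup of $K$, and let $I_{1,K}$ (resp. $I'_{1,K}$) be the inverse image in $K$ of the group of upper (resp. lower) triangular unipotent elements of $K/K^1$, i.e. of $U(2,1)$ (if $K=K_0$)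 or $U(1,1)\times U(1)$ (if $K=K_1$) over the residue field. Let $(\sigma,W)$ be an irreducible smooth representation of $K$ over $\overline{\mathbf F}_p$. (0) The invariants $\sigma^{I_{1,K}}$ are one-dimensional and the natural map $\sigma^{I_{1,K}}\to\sigma_{I'_{1,K}}$ to the coinvariants is an isomorphism. Let $j_\sigma\in\mathrm{End}(W)$ be the composite of the projection $W\to\sigma_{I'_{1,K}}$, the inverse of this isomorphism, and the inclusion $\sigma^{I_{1,K}}\subset W$. Let $\mathrm{ind}_K^G\sigma$ be the space of locally constant compactly supported $f:G\to W$ with $f(kg)=\sigma(k)f(g)$ for $k\in K$, $g\in G$, on which $G$ acts by right translation, and let $\mathcal H(K,\sigma)=\mathrm{End}_G(\mathrm{ind}_K^G\sigma)$. Let $\mathcal H_K(\sigma)$ be the space of locally constant compactly supported $\varphi:G\to\mathrm{End}(W)$ with $\varphi(kgk')=\sigma(k)\varphi(g)\sigma(k')$ for $k,k'\in K$, $g\in G$, with the convolution $(\varphi*\psi)(g)=\sum_{x\in G/K}\varphi(x)\psi(x^{-1}g)$. (1) The map sending $\varphi$ to the operator $f\mapsto\varphi*f$, $(\varphi*f)(g)=\sum_{x\in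 G/K}\varphi(x)f(x^{-1}g)$, is a multiplicative linear bijection $\mathcal H_K(\sigma)\to\mathcal H(K,\sigma)$. (2) For each $n\ge0$ there is exactly one $\varphi_n\in\mathcal H_K(\sigma)$ supported on $K\alpha^nK$ with $\varphi_0(1)=\mathrm{Id}$, respectively $\varphi_n(\alpha^n)=j_\sigma$ if $n>0$; its support is all of $K\alpha^nK$. The family $(\varphi_n)_{n\ge0}$ is a basis of $\mathcal H_K(\sigma)$. (3) There is a constant $c\in\overline{\mathbf F}_p$ (depending on $\sigma$ but not on $n$) such that for all $n\ge1$ and $l\ge0$, $(\varphi_1*\varphi_n)(\alpha^l)$ equals $c\,j_\sigma$ if $l=n$, equals $j_\sigma$ if $l=n+1$, and is $0$ otherwise; and $\varphi_1*\varphi_n=c\,\varphi_n+\varphi_{n+1}$. (4) Let $T\in\mathcal H(K,\sigma)$ be the operator $f\mapsto\varphi_1*f$. Then evaluation at $T$ is an isomorphism of algebras from the polynomial ring $\overline{\mathbf F}_p[X]$ onto $\mathcal H(K,\sigma)$. -/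

import Mathlib

open scoped ValuativeRel

noncomputable section

namespace Hecke

/-! ### Compact induction and Hecke algebras for an open subgroup `K` of a topological group `G` -/

section Generic

variable {k : Type*} [Field k] {G : Type*} [Group G] [TopologicalSpace G]
  {K : Subgroup G} {W : Type*} [AddCommGroup W] [Module k W]

/-- A representation is smooth if the stabilizer of every vector is open. -/
def IsSmooth {H : Type*} [Group H] [TopologicalSpace H] (σ : Representation k H W) : Prop :=
  ∀ w : W, IsOpen {h : H | σ h w = w}

/-- The space `S(G, σ)` of locally constant functions `f : G → W` with compact support such that
`f (κ g) = σ(κ) f(g)` for `κ ∈ K`. -/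
def compactInd (σ : Representation k K W) : Submodule k (G → W) where
  carrier := {f | (∀ (κ : K) (g : G), f (κ * g) = σ κ (f g)) ∧
    IsLocallyConstant f ∧ HasCompactSupport f}
  zero_mem' := ⟨fun κ g => by simp, IsLocallyConstant.const 0, HasCompactSupport.zero⟩
  add_mem' {f f'} hf hf' := ⟨fun κ g => by simp [hf.1, hf'.1], hf.2.1.add hf'.2.1,
    hf.2.2.add hf'.2.2⟩
  smul_mem' c f hf := ⟨fun κ g => by simp [hf.1], hf.2.1.comp (fun w => c • w),
    hf.2.2.comp_left (g := fun w => c • w) (smul_zero c)⟩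

/-- The compactly induced representation `ind_K^G σ`: the group `G` acts on `S(G, σ)` by right
translation. -/
def indRep [IsTopologicalGroup G] (σ : Representation k K W) :
    Representation k G (compactInd σ) where
  toFun x :=
    { toFun := fun f => ⟨fun g => f.1 (g * x), fun κ g => by simp [mul_assoc, f.2.1],
        f.2.2.1.comp_continuous (continuous_mul_const x),
        f.2.2.2.comp_homeomorph (Homeomorph.mulRight x)⟩
      map_add' := fun _ _ => rfl
      map_smul' := fun _ _ => rfl }
  map_one' := by ext f g; simp
  map_mul' x y := by ext f g; simp [mul_assoc]

/-- The space `H_K(σ)` of locally constant functions `φ : G → End(W)` with compact support such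
that `φ (κ g κ') = σ(κ) φ(g) σ(κ')` for `κ, κ' ∈ K`. -/
def heckeFun (σ : Representation k K W) : Submodule k (G → Module.End k W) where
  carrier := {φ | (∀ (κ κ' : K) (g : G), φ (κ * g * κ') = σ κ * φ g * σ κ') ∧
    IsLocallyConstant φ ∧ HasCompactSupport φ}
  zero_mem' := ⟨fun κ κ' g => by simp, IsLocallyConstant.const 0, HasCompactSupport.zero⟩
  add_mem' {f f'} hf hf' := ⟨fun κ κ' g => by simp [hf.1, hf'.1, mul_add, add_mul],
    hf.2.1.add hf'.2.1, hf.2.2.add hf'.2.2⟩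
  smul_mem' c f hf := ⟨fun κ κ' g => by simp [hf.1], hf.2.1.comp (fun w => c • w),
    hf.2.2.comp_left (g := fun w => c • w) (smul_zero c)⟩

variable {σ : Representation k K W}

lemma heckeFun_left (φ : heckeFun σ) (κ : K) (g : G) : φ.1 (κ * g) = σ κ * φ.1 g := by
  simpa using φ.2.1 κ 1 g

lemma heckeFun_right (φ : heckeFun σ) (κ : K) (g : G) : φ.1 (g * κ) = φ.1 g * σ κ := by
  simpa using φ.2.1 1 κ g

/-- A Hecke function is supported on finitely many cosets `xK`. -/
lemma heckeFun_finite [IsTopologicalGroup G] (hK : IsOpen (K : Set G)) (φ : heckeFun σ) :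
    {x : G ⧸ K | φ.1 x.out ≠ 0}.Finite := by
  have hd : DiscreteTopology (G ⧸ K) := QuotientGroup.discreteTopology hK
  have hc : IsCompact ((fun g : G => (g : G ⧸ K)) '' tsupport φ.1) :=
    φ.2.2.2.isCompact.image continuous_quot_mk
  refine hc.finite_of_discrete.subset fun x hx => ⟨x.out, subset_tsupport _ hx, ?_⟩
  exact Quotient.out_eq' x

/-- The summands `φ(x) ψ(x⁻¹ g)` only depend on the coset `xK`. -/
lemma summand_out {M : Type*} {F : G → M} (hF : ∀ (κ : K) (x : G), F (x * κ) = F x) (x : G) :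
    F ((x : G ⧸ K).out) = F x := by
  obtain ⟨κ, hκ⟩ := QuotientGroup.mk_out_eq_mul K x
  rw [hκ, hF]

lemma isLocallyConstant_sum {ι X M : Type*} [TopologicalSpace X] [AddCommMonoid M]
    (s : Finset ι) (F : ι → X → M) (hF : ∀ i ∈ s, IsLocallyConstant (F i)) :
    IsLocallyConstant (fun x => ∑ i ∈ s, F i x) := by
  classical
  induction s using Finset.induction_on with
  | empty => exact IsLocallyConstant.const 0
  | insert a s ha ih =>
    simp only [Finset.sum_insert ha]
    exact (hF a (by simp)).add (ih fun i hi => hF i (by simp [hi]))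

lemma hasCompactSupport_sum {ι X M : Type*} [TopologicalSpace X] [AddCommMonoid M]
    (s : Finset ι) (F : ι → X → M) (hF : ∀ i ∈ s, HasCompactSupport (F i)) :
    HasCompactSupport (fun x => ∑ i ∈ s, F i x) := by
  classical
  induction s using Finset.induction_on with
  | empty => exact (HasCompactSupport.zero : HasCompactSupport (0 : X → M))
  | insert a s ha ih =>
    simp only [Finset.sum_insert ha]
    exact (hF a (by simp)).add (ih fun i hi => hF i (by simp [hi]))

/-- The action `(φ * f)(g) = ∑_{x ∈ G/K} φ(x) f(x⁻¹ g)` of a Hecke function on a function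
`f : G → W`. -/
def heckeAct (φ : heckeFun σ) (f : G → W) (g : G) : W :=
  ∑ᶠ x : G ⧸ K, φ.1 x.out (f (x.out⁻¹ * g))

/-- The convolution `(φ * ψ)(g) = ∑_{x ∈ G/K} φ(x) ψ(x⁻¹ g)`. -/
def convFun (φ ψ : heckeFun σ) (g : G) : Module.End k W :=
  ∑ᶠ x : G ⧸ K, φ.1 x.out * ψ.1 (x.out⁻¹ * g)

lemma heckeAct_eq_sum [IsTopologicalGroup G] (hK : IsOpen (K : Set G)) (φ : heckeFun σ)
    (f : G → W) (g : G) :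
    heckeAct φ f g = ∑ x ∈ (heckeFun_finite hK φ).toFinset, φ.1 x.out (f (x.out⁻¹ * g)) := by
  refine finsum_eq_sum_of_support_subset _ fun x hx => ?_
  simp only [Set.Finite.coe_toFinset, Set.mem_ofPred_eq]
  rintro h0
  exact hx (by simp [h0])

lemma convFun_eq_sum [IsTopologicalGroup G] (hK : IsOpen (K : Set G)) (φ ψ : heckeFun σ)
    (g : G) :
    convFun φ ψ g = ∑ x ∈ (heckeFun_finite hK φ).toFinset, φ.1 x.out * ψ.1 (x.out⁻¹ * g) := by
  refine finsum_eq_sum_of_support_subset _ fun x hx => ?_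
  simp only [Set.Finite.coe_toFinset, Set.mem_ofPred_eq]
  rintro h0
  exact hx (by simp [h0])

lemma heckeAct_mem [IsTopologicalGroup G] (hK : IsOpen (K : Set G)) (φ : heckeFun σ)
    (f : compactInd σ) : heckeAct φ f.1 ∈ compactInd σ := by
  refine ⟨fun κ g => ?_, ?_, ?_⟩
  · have hF : ∀ h : G, ∀ (κ : K) (x : G),
        φ.1 (x * κ) (f.1 ((x * κ)⁻¹ * h)) = φ.1 x (f.1 (x⁻¹ * h)) := by
      intro h κ x
      have := f.2.1 κ⁻¹ (x⁻¹ * h)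
      simp only [Subgroup.coe_inv] at this
      rw [mul_inv_rev, mul_assoc, this, heckeFun_right, Module.End.mul_apply,
        ← Module.End.mul_apply (σ κ), ← map_mul, mul_inv_cancel, map_one, Module.End.one_apply]
    have hfin : (Function.support fun x : G ⧸ K => φ.1 x.out (f.1 (x.out⁻¹ * g))).Finite :=
      (heckeFun_finite hK φ).subset fun x hx h0 => hx (by simp [h0])
    unfold heckeAct
    rw [← finsum_comp_equiv (MulAction.toPerm (κ : G) : Equiv.Perm (G ⧸ K)),
      show σ κ (∑ᶠ x : G ⧸ K, φ.1 x.out (f.1 (x.out⁻¹ * g))) = _ from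
        (σ κ).toAddMonoidHom.map_finsum hfin]
    refine finsum_congr fun x => ?_
    induction x using QuotientGroup.induction_on with
    | H x =>
      rw [summand_out (F := fun y => φ.1 y (f.1 (y⁻¹ * g))) (hF g)]
      change φ.1 ((((κ : G) * x : G) : G ⧸ K).out)
        (f.1 ((((κ : G) * x : G) : G ⧸ K).out⁻¹ * (κ * g))) = σ κ (φ.1 x (f.1 (x⁻¹ * g)))
      rw [summand_out (F := fun y => φ.1 y (f.1 (y⁻¹ * (κ * g)))) (hF _), heckeFun_left]
      simp [mul_assoc]
  · simp only [funext (heckeAct_eq_sum hK φ f.1)]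
    exact isLocallyConstant_sum _ _ fun x _ =>
      (f.2.2.1.comp_continuous (continuous_const_mul x.out⁻¹)).comp (φ.1 x.out)
  · simp only [funext (heckeAct_eq_sum hK φ f.1)]
    exact hasCompactSupport_sum _ _ fun x _ =>
      (f.2.2.2.comp_homeomorph (Homeomorph.mulLeft x.out⁻¹)).comp_left
        (g := φ.1 x.out) (map_zero _)

lemma convFun_mem [IsTopologicalGroup G] (hK : IsOpen (K : Set G)) (φ ψ : heckeFun σ) :
    convFun φ ψ ∈ heckeFun σ := by
  refine ⟨fun κ κ' g => ?_, ?_, ?_⟩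
  · have hF : ∀ h : G, ∀ (κ : K) (x : G),
        φ.1 (x * κ) * ψ.1 ((x * κ)⁻¹ * h) = φ.1 x * ψ.1 (x⁻¹ * h) := by
      intro h κ x
      have := heckeFun_left ψ κ⁻¹ (x⁻¹ * h)
      simp only [Subgroup.coe_inv] at this
      rw [mul_inv_rev, mul_assoc, this, heckeFun_right, mul_assoc, ← mul_assoc (σ κ), ← map_mul,
        mul_inv_cancel, map_one, one_mul]
    have hfin : (Function.support fun x : G ⧸ K => φ.1 x.out * ψ.1 (x.out⁻¹ * g)).Finite :=
      (heckeFun_finite hK φ).subset fun x hx h0 => hx (by simp [h0])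
    unfold convFun
    rw [← finsum_comp_equiv (MulAction.toPerm (κ : G) : Equiv.Perm (G ⧸ K)),
      show σ κ * (∑ᶠ x : G ⧸ K, φ.1 x.out * ψ.1 (x.out⁻¹ * g)) * σ κ' = _ from
        ((AddMonoidHom.mulRight (σ κ')).comp (AddMonoidHom.mulLeft (σ κ))).map_finsum hfin]
    refine finsum_congr fun x => ?_
    induction x using QuotientGroup.induction_on with
    | H x =>
      rw [summand_out (F := fun y => φ.1 y * ψ.1 (y⁻¹ * g)) (hF g)]
      change φ.1 ((((κ : G) * x : G) : G ⧸ K).out) *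
        ψ.1 ((((κ : G) * x : G) : G ⧸ K).out⁻¹ * (κ * g * κ')) =
          σ κ * (φ.1 x * ψ.1 (x⁻¹ * g)) * σ κ'
      rw [summand_out (F := fun y => φ.1 y * ψ.1 (y⁻¹ * (κ * g * κ'))) (hF _), heckeFun_left,
        show ((κ : G) * x)⁻¹ * (κ * g * κ') = (x⁻¹ * g) * κ' by group, heckeFun_right]
      simp only [mul_assoc]
  · simp only [funext (convFun_eq_sum hK φ ψ)]
    exact isLocallyConstant_sum _ _ fun x _ =>
      (ψ.2.2.1.comp_continuous (continuous_const_mul x.out⁻¹)).comp (fun a => φ.1 x.out * a)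
  · simp only [funext (convFun_eq_sum hK φ ψ)]
    exact hasCompactSupport_sum _ _ fun x _ =>
      (ψ.2.2.2.comp_homeomorph (Homeomorph.mulLeft x.out⁻¹)).comp_left
        (g := fun a => φ.1 x.out * a) (mul_zero _)

/-- Convolution on `H_K(σ)`. -/
def conv [IsTopologicalGroup G] (hK : IsOpen (K : Set G)) (φ ψ : heckeFun σ) : heckeFun σ :=
  ⟨convFun φ ψ, convFun_mem hK φ ψ⟩

/-- The Hecke operator `f ↦ φ * f` in `End_G(ind_K^G σ)` attached to `φ ∈ H_K(σ)`. -/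
def heckeOp [IsTopologicalGroup G] (hK : IsOpen (K : Set G)) :
    heckeFun σ →ₗ[k] (indRep σ).IntertwiningMap (indRep σ) where
  toFun φ :=
    { toFun := fun f => ⟨heckeAct φ f.1, heckeAct_mem hK φ f⟩
      map_add' := fun f f' => Subtype.ext <| funext fun g => by
        simp [heckeAct_eq_sum hK, Finset.sum_add_distrib]
      map_smul' := fun c f => Subtype.ext <| funext fun g => by
        simp [heckeAct_eq_sum hK, Finset.smul_sum]
      isIntertwining' := fun x => LinearMap.ext fun f => Subtype.ext <| funext fun g => by
        simp [heckeAct, indRep, mul_assoc] }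
  map_add' φ ψ := Representation.IntertwiningMap.ext <| LinearMap.ext fun f =>
    Subtype.ext <| funext fun g =>
      (finsum_congr fun x => by simp).trans <| finsum_add_distrib
        ((heckeFun_finite hK φ).subset fun x hx h0 => hx (by simp [h0]))
        ((heckeFun_finite hK ψ).subset fun x hx h0 => hx (by simp [h0]))
  map_smul' c φ := Representation.IntertwiningMap.ext <| LinearMap.ext fun f =>
    Subtype.ext <| funext fun g =>
      (finsum_congr fun x => by simp).trans <| (smul_finsum' c
        ((heckeFun_finite hK φ).subset fun x hx h0 => hx (by simp [h0]))).symm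

/-- The natural map `σ^A → σ_B` from the `A`-invariants to the `B`-coinvariants of a
representation `σ` of `H`, for subgroups `A`, `B` of `H`. -/
def invToCoinv {H : Type*} [Group H] (A B : Subgroup H) (σ : Representation k H W) :
    (Representation.invariants (σ.comp A.subtype)) →ₗ[k] Representation.Coinvariants (σ.comp B.subtype) :=
  Representation.Coinvariants.mk (σ.comp B.subtype) ∘ₗ (Representation.invariants (σ.comp A.subtype)).subtype

open Classical in
/-- The endomorphism `σ ↠ σ_B ≅ σ^A ↪ σ` obtained from the inverse of the natural map
`σ^A → σ_B` (it is meaningful only if that map is an isomorphism, and is `0` otherwise). -/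
def jMap {H : Type*} [Group H] (A B : Subgroup H) (σ : Representation k H W) :
    Module.End k W :=
  if h : Function.Bijective (invToCoinv A B σ) then
    (Representation.invariants (σ.comp A.subtype)).subtype ∘ₗ
      (LinearEquiv.ofBijective (invToCoinv A B σ) h).symm.toLinearMap ∘ₗ
        Representation.Coinvariants.mk (σ.comp B.subtype)
  else 0

end Generic

/-! ### The unramified unitary group in three variables -/

section Unitary

/-- The Hermitian form `h(v, w) = vᵀ β w̄` on `E³`, with `β` the antidiagonal permutation matrix. -/
def hermForm {F E : Type*} [Field F] [Field E] [Algebra F E] (conj : E ≃ₐ[F] E)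
    (v w : Fin 3 → E) : E :=
  v ⬝ᵥ (!![0, 0, 1; 0, 1, 0; 1, 0, 0] : Matrix (Fin 3) (Fin 3) E).mulVec (fun a => conj (w a))

/-- The unitary group `G = U(2,1)(E/F)`: the elements of `GL₃(E)` preserving the form. -/
def U21 {F E : Type*} [Field F] [Field E] [Algebra F E] (conj : E ≃ₐ[F] E) :
    Subgroup (GL (Fin 3) E) where
  carrier := {g | ∀ v w, hermForm conj (g.1.mulVec v) (g.1.mulVec w) = hermForm conj v w}
  one_mem' := by simp
  mul_mem' {g g'} hg hg' v w := by
    simp only [Units.val_mul, ← Matrix.mulVec_mulVec]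
    rw [hg, hg']
  inv_mem' {g} hg v w := by
    have h : ∀ u, g.1.mulVec ((g⁻¹).1.mulVec u) = u := fun u => by
      rw [Matrix.mulVec_mulVec, Units.mul_inv, Matrix.one_mulVec]
    rw [← hg, h, h]

/-- The element `α = diag(ϖ⁻¹, 1, ϖ)` of `G`, for `ϖ ∈ Fˣ`. -/
def alpha {F E : Type*} [Field F] [Field E] [Algebra F E] (conj : E ≃ₐ[F] E) (ϖ : Fˣ) :
    U21 conj :=
  ⟨⟨Matrix.diagonal ![algebraMap F E (ϖ⁻¹ : Fˣ), 1, algebraMap F E ϖ],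
    Matrix.diagonal ![algebraMap F E ϖ, 1, algebraMap F E (ϖ⁻¹ : Fˣ)],
    by
      rw [Matrix.diagonal_mul_diagonal, ← Matrix.diagonal_one]
      congr 1; ext a; fin_cases a <;> simp,
    by
      rw [Matrix.diagonal_mul_diagonal, ← Matrix.diagonal_one]
      congr 1; ext a; fin_cases a <;> simp⟩,
   by
    have h : algebraMap F E ϖ ≠ 0 := by simp
    intro v w
    simp [hermForm, dotProduct, Matrix.mulVec, Fin.sum_univ_three, Matrix.diagonal_apply]
    field_simp⟩

variable {F E : Type*} [Field F] [Field E] [Algebra F E]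
  [ValuativeRel E] [TopologicalSpace E] [IsNonarchimedeanLocalField E]

/-- The fractional ideal `𝔭_E^n`, `n ∈ ℤ`: here `uniformizer E` is the value of a uniformizer. -/
def primePow (E : Type*) [Field E] [ValuativeRel E] [TopologicalSpace E]
    [IsNonarchimedeanLocalField E] (n : ℤ) : AddSubgroup E where
  carrier := {x | ValuativeRel.valuation E x ≤ ValuativeRel.uniformizer E ^ n}
  zero_mem' := by simp
  add_mem' {x y} (hx : _ ≤ _) (hy : _ ≤ _) := show _ ≤ _ from ((ValuativeRel.valuation E).map_add x y).trans (max_le hx hy)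
  neg_mem' {x} hx := by simpa using hx

lemma primePow_mul {m n r : ℤ} (h : r ≤ m + n) {x y : E} (hx : x ∈ primePow E m)
    (hy : y ∈ primePow E n) : x * y ∈ primePow E r := by
  change ValuativeRel.valuation E (x * y) ≤ ValuativeRel.uniformizer E ^ r
  rw [map_mul]
  refine (mul_le_mul' hx hy).trans ?_
  rw [← zpow_add₀ ValuativeRel.uniformizer_ne_zero]
  exact zpow_le_zpow_right_of_le_one₀ ValuativeRel.uniformizer_pos
    ValuativeRel.uniformizer_lt_one.le h

lemma isOpen_primePow (n : ℤ) : IsOpen (primePow E n : Set E) := by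
  refine AddSubgroup.isOpen_of_mem_nhds _ (g := 0) ?_
  have hne : ValuativeRel.uniformizer E ^ n ≠ 0 := zpow_ne_zero _ ValuativeRel.uniformizer_ne_zero
  refine (IsValuativeTopology.mem_nhds_zero_iff _).mpr ⟨Units.mk0 _ hne, fun x hx => ?_⟩
  exact le_of_lt (show ValuativeRel.valuation E x < _ from hx)

/-- For a matrix `e` of exponents with `e a c ≤ e a b + e b c`, the monoid of all matrices
`g ∈ M₃(E)` such that the `(a, b)` entry of `g - 1` lies in `𝔭_E^(e a b)`. -/
def congrMonoid (e : Fin 3 → Fin 3 → ℤ) (he : ∀ a b c, e a c ≤ e a b + e b c) :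
    Submonoid (Matrix (Fin 3) (Fin 3) E) where
  carrier := {g | ∀ a b, (g - 1) a b ∈ primePow E (e a b)}
  one_mem' a b := by simp
  mul_mem' {g g'} hg hg' a b := by
    have : g * g' - 1 = (g - 1) * (g' - 1) + (g - 1) + (g' - 1) := by noncomm_ring
    rw [this]
    refine add_mem (add_mem ?_ (hg a b)) (hg' a b)
    rw [Matrix.mul_apply]
    exact sum_mem fun c _ => primePow_mul (he a c b) (hg a c) (hg' c b)

/-- The subgroup of all `g ∈ G` such that `g` and `g⁻¹` lie in `congrMonoid e`. (For the matrices
`e` used below the condition on `g⁻¹` follows from that on `g`, as `g⁻¹ = β ḡᵀ β`.) -/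
def congrSubgroup (conj : E ≃ₐ[F] E) (e : Fin 3 → Fin 3 → ℤ)
    (he : ∀ a b c, e a c ≤ e a b + e b c) : Subgroup (U21 conj) :=
  (congrMonoid e he).units.comap (U21 conj).subtype

lemma isOpen_congrSubgroup (conj : E ≃ₐ[F] E) (e : Fin 3 → Fin 3 → ℤ)
    (he : ∀ a b c, e a c ≤ e a b + e b c) :
    IsOpen (congrSubgroup conj e he : Set (U21 conj)) := by
  have h1 : IsOpen {g : Matrix (Fin 3) (Fin 3) E | ∀ a b, (g - 1) a b ∈ primePow E (e a b)} := by
    simp only [Set.ofPred_forall]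
    refine isOpen_iInter_of_finite fun a => isOpen_iInter_of_finite fun b => ?_
    exact (isOpen_primePow (e a b)).preimage (by fun_prop)
  exact (h1.preimage (Units.continuous_val.comp continuous_subtype_val)).inter
    (h1.preimage (Units.continuous_coe_inv.comp continuous_subtype_val))

/-- Exponents for the two maximal compact open subgroups `K₀` and `K₁`. -/
def expK : Fin 2 → Fin 3 → Fin 3 → ℤ :=
  ![![![0, 0, 0], ![0, 0, 0], ![0, 0, 0]],
    ![![0, 0, -1], ![1, 0, 0], ![1, 1, 0]]]

/-- Exponents for the pro-`p` Iwahori subgroups `I_{1,K}` (upper triangular unipotent modulo the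
pro-`p` radical of `K`). -/
def expI : Fin 2 → Fin 3 → Fin 3 → ℤ :=
  ![![![1, 0, 0], ![1, 1, 0], ![1, 1, 1]],
    ![![1, 0, -1], ![1, 1, 0], ![2, 1, 1]]]

/-- Exponents for the opposite pro-`p` Iwahori subgroups `I'_{1,K}` (lower triangular unipotent
modulo the pro-`p` radical of `K`). -/
def expI' : Fin 2 → Fin 3 → Fin 3 → ℤ :=
  ![![![1, 1, 1], ![0, 1, 1], ![0, 0, 1]],
    ![![1, 0, 0], ![1, 1, 0], ![1, 1, 1]]]

/-- The maximal compact open subgroups `K₀` (`i = 0`) and `K₁` (`i = 1`) of `G`. -/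
def maxK (conj : E ≃ₐ[F] E) (i : Fin 2) : Subgroup (U21 conj) :=
  congrSubgroup conj (expK i) (by revert i; decide)

/-- The pro-`p` Iwahori subgroup `I_{1,K}`, as a subgroup of `K`. -/
def proIwahori (conj : E ≃ₐ[F] E) (i : Fin 2) : Subgroup (maxK conj i) :=
  (congrSubgroup conj (expI i) (by revert i; decide)).subgroupOf (maxK conj i)

/-- The opposite pro-`p` Iwahori subgroup `I'_{1,K}`, as a subgroup of `K`. -/
def proIwahori' (conj : E ≃ₐ[F] E) (i : Fin 2) : Subgroup (maxK conj i) :=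
  (congrSubgroup conj (expI' i) (by revert i; decide)).subgroupOf (maxK conj i)

lemma isOpen_maxK (conj : E ≃ₐ[F] E) (i : Fin 2) : IsOpen (maxK conj i : Set (U21 conj)) :=
  isOpen_congrSubgroup conj _ _

/-- The double coset `K αⁿ K`. -/
def cell (conj : E ≃ₐ[F] E) (ϖ : Fˣ) (i : Fin 2) (n : ℕ) : Set (U21 conj) :=
  {g | ∃ κ κ' : maxK conj i, g = κ * alpha conj ϖ ^ n * κ'}

/-- The endomorphism `j_σ` of `σ`. -/
def jSigma {k W : Type*} [Field k] [AddCommGroup W] [Module k W] (conj : E ≃ₐ[F] E) (i : Fin 2)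
    (σ : Representation k (maxK conj i) W) : Module.End k W :=
  jMap (proIwahori conj i) (proIwahori' conj i) σ

/-- `φ ∈ H_K(σ)` is supported on `K αⁿ K`, and its value at `αⁿ` is `j_σ` if `n > 0` and the
identity if `n = 0`. -/
def IsPhi {k W : Type*} [Field k] [AddCommGroup W] [Module k W] (conj : E ≃ₐ[F] E) (ϖ : Fˣ)
    (i : Fin 2) (σ : Representation k (maxK conj i) W) (n : ℕ) (φ : heckeFun σ) : Prop :=
  Function.support φ.1 ⊆ cell conj ϖ i n ∧
    φ.1 (alpha conj ϖ ^ n) = if n = 0 then 1 else jSigma conj i σ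

/-- `E/F` is unramified: a uniformizer of `F` is a uniformizer of `E` (residue field extensions of
local fields are separable). -/
def IsUnramified (F E : Type*) [Field F] [Field E] [Algebra F E]
    [ValuativeRel F] [TopologicalSpace F] [IsNonarchimedeanLocalField F]
    [ValuativeRel E] [TopologicalSpace E] [IsNonarchimedeanLocalField E] : Prop :=
  ∀ x : F, ValuativeRel.valuation F x = ValuativeRel.uniformizer F →
    ValuativeRel.valuation E (algebraMap F E x) = ValuativeRel.uniformizer E

end Unitary

end Hecke

end

/-!
Write `T` for the diagonal torus and `w ∈ K` for the antidiagonal Weyl element `weyl`, and let `K¹`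
be the pro-`p` radical `radK` of `K`. A unitary matrix with nonzero upper left entry is a product of
a lower unipotent, a diagonal and an upper unipotent matrix with explicit parameters
(`exists_bigCell`). All the group theory below consists in comparing the valuations of these
parameters with the exponents that define the congruence subgroups. The arithmetic input is that
the conjugation preserves the valuation (`valuation_conj`), that there is a unit of trace zero, and
that `p` is odd; it is collected in `IsUnramifiedDatum`.

**The line of invariants.** The `p`-power iterates of an element of `K¹` tend to `1`
(`IsUnramifiedDatum.tendsto_pow`), and a group acting through a finite `p`-group in characteristic
`p` has a nonzero fixed vector. As `K¹` is normal and `σ` irreducible, `K¹` acts trivially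
(`apply_eq_one_of_normal`), so that `σ` is a representation of a finite group with a split
`BN`-pair of rank one. For such a group let `e` be the sum over the unipotent radical `A`. A common
eigenvector `v` of `T` and `e w` among the `A`-invariants generates `σ` under the opposite radical
`B`, so the `B`-invariant functionals form a line; a `B`-invariant functional and an `A`-invariant
vector, both nonzero, cannot be orthogonal, because the vanishing would propagate to the orbit of
the vector by the Bruhat decomposition (`IsRankOneDatum.eq_zero_of_invariant_of_apply_eq_zero`).
This gives `IsRankOneDatum.finrank_invariants_and_bijective`. It also shows that an endomorphism
which is left invariant under `A` and right invariant under `B` is a multiple of `j`, and that `j`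
is an idempotent commuting with `T`.

**Hecke functions and endomorphisms.** The compactly induced representation is generated by the
functions `[1, v]` supported on `K` with value `v` at `1`, and the operator attached to `φ` sends
`[1, v]` to `g ↦ φ(g) v`. Hence an endomorphism is the same as a Hecke function
(`heckeOp_bijective`), and convolution is composition (`heckeOp_conv`).

**The basis.** By the Cartan decomposition (`IsUnramifiedDatum.exists_mem_cell`,
`IsUnramifiedDatum.eq_of_mem_cell`) a Hecke function is determined by its values at the `αⁿ`,
`n ≥ 0`. If `n > 0` and `κ αⁿ = αⁿ κ'` with `κ, κ' ∈ K`, then `κ ∈ K¹ t I_{1,K}` and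
`κ' ∈ I'_{1,K} t K¹` for one and the same `t ∈ T`; hence `j` is an admissible value at `αⁿ`
(`IsUnramifiedDatum.exists_isPhi`). Conversely the upper unipotents of `K` are contracted into `K¹`
by `α⁻ⁿ` and the lower ones by `αⁿ`, so every value at `αⁿ` is left invariant under `I_{1,K}` and
right invariant under `I'_{1,K}`, that is, a multiple of `j`
(`IsUnramifiedDatum.exists_apply_alpha_pow`); for `n = 0` it is a scalar by Schur's lemma.

**The recursion.** The cosets in `KαK / K` are the `uwαK` with `u` an upper unipotent of `K`, and
the `aαK` with `a ∈ K¹`. The summand of `(φ₁ * φₙ)(αˡ)` at a coset is unchanged under left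
translation of the coset by the pro-`p` group `K¹ ∩ αˡ K¹ α⁻ˡ`. This group has no fixed point among
the cosets of the first kind, so its orbits there have length divisible by `p` and these cosets
contribute zero (`IsUnramifiedDatum.sum_conv_eq_zero`). For `l = 0` the same holds for the cosets
of the second kind. For `l > 0` the coset `αK` contributes `j φₙ(αˡ⁻¹)`, which is `j` if `l = n + 1`
and zero otherwise, while for each of the other cosets `(aα)⁻¹ αˡ` lies in `K¹ w αˡ t K¹` with
`t ∈ T` independent of `l`, so that its contribution is `j σ(w) φₙ(αˡ) σ(t)`: zero unless `l = n`,
and then a multiple of `j` by a factor that does not involve `n`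
(`IsUnramifiedDatum.exists_conv_summand_eq`).

**The polynomial algebra.** From `φ₁ * φₙ = c φₙ + φₙ₊₁` for `n ≥ 1` and `φ₀ = 1` it follows that
`φₙ₊₁ = (φ₁ - c)ⁿ φ₁`. The polynomials `1` and `(X - c)ⁿ X` form a basis of the polynomial ring,
having one member in each degree, and evaluation at `φ₁` carries it to the basis of the `φₙ`
(`bijective_aeval_of_recursion`).
-/

noncomputable section

namespace Hecke

/-! ### Groups acting through `p`-groups -/

section PGroupActions

variable {P X : Type*} [Group P] [MulAction P X] {p : ℕ} [Fact p.Prime]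

/-- If every element of `P` acts on the finite set `X` with local `p`-power order, then the
permutation group of `X` induced by `P` is a `p`-group. -/
lemma isPGroup_range_toPermHom [Finite X] (hP : ∀ (g : P) (x : X), ∃ n : ℕ, g ^ p ^ n • x = x) :
    IsPGroup p (MulAction.toPermHom P X).range := by
  rintro ⟨_, g, rfl⟩
  cases nonempty_fintype X
  choose n hn using hP g
  refine ⟨∑ x, n x, Subtype.ext (Equiv.ext fun x => ?_)⟩
  have hx : g ^ p ^ n x ∈ MulAction.stabilizer P x := hn x
  have hdvd : p ^ n x ∣ p ^ ∑ y, n y :=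
    pow_dvd_pow p (Finset.single_le_sum (fun _ _ => Nat.zero_le _) (Finset.mem_univ x))
  obtain ⟨m, hm⟩ := hdvd
  have : g ^ p ^ (∑ y, n y) ∈ MulAction.stabilizer P x := by
    rw [hm, pow_mul]; exact pow_mem hx m
  change (MulAction.toPermHom P X g ^ p ^ ∑ y, n y) x = x
  rw [← map_pow]
  exact this

/-- An invariant function on a finite set on which a group acts through a `p`-group without fixed
points sums to zero in characteristic `p`, as all orbits have size divisible by `p`. -/
lemma sum_eq_zero_of_smul_invariant [Fintype X] {k M : Type*} [Field k] [CharP k p]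
    [AddCommGroup M] [Module k M] (hP : ∀ (g : P) (x : X), ∃ n : ℕ, g ^ p ^ n • x = x)
    (hfix : ∀ x : X, ∃ g : P, g • x ≠ x) {f : X → M} (hf : ∀ (g : P) (x : X), f (g • x) = f x) :
    ∑ x, f x = 0 := by
  classical
  set Q := (MulAction.toPermHom P X).range
  have hQ : IsPGroup p Q := isPGroup_range_toPermHom hP
  have hfQ : ∀ (q : Q) (x : X), f (q • x) = f x := by
    rintro ⟨_, g, rfl⟩ x
    exact hf g x
  rw [← (MulAction.selfEquivSigmaOrbits Q X).symm.sum_comp, Fintype.sum_sigma]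
  refine Finset.sum_eq_zero fun ω _ => ?_
  have hconst : ∀ y : MulAction.orbit Q ω.out,
      f ((MulAction.selfEquivSigmaOrbits Q X).symm ⟨ω, y⟩) = f ω.out := by
    rintro ⟨_, q, rfl⟩
    exact hfQ q _
  rw [Finset.sum_congr rfl fun y _ => hconst y, Finset.sum_const, Finset.card_univ,
    ← Nat.card_eq_fintype_card]
  obtain ⟨n, hn⟩ := hQ.card_orbit (ω.out)
  have hn0 : n ≠ 0 := by
    rintro rfl
    obtain ⟨g, hg⟩ := hfix ω.out
    rw [pow_zero, Nat.card_eq_one_iff_unique] at hn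
    have := hn.1
    have h := Subsingleton.elim (α := MulAction.orbit Q ω.out)
      ⟨_, (⟨_, g, rfl⟩ : Q), rfl⟩ ⟨ω.out, MulAction.mem_orbit_self _⟩
    exact hg (congrArg Subtype.val h)
  rw [hn, ← Nat.cast_smul_eq_nsmul k, Nat.cast_pow, CharP.cast_eq_zero, zero_pow hn0, zero_smul]

lemma finset_sum_eq_zero_of_smul_invariant {k M : Type*} [Field k] [CharP k p]
    [AddCommGroup M] [Module k M] (s : Finset X) (hs : ∀ (g : P), ∀ x ∈ s, g • x ∈ s)
    (hP : ∀ (g : P), ∀ x ∈ s, ∃ n : ℕ, g ^ p ^ n • x = x)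
    (hfix : ∀ x ∈ s, ∃ g : P, g • x ≠ x) {f : X → M} (hf : ∀ (g : P), ∀ x ∈ s, f (g • x) = f x) :
    ∑ x ∈ s, f x = 0 := by
  let _ : MulAction P s :=
    { smul := fun g x => ⟨g • x.1, hs g x.1 x.2⟩
      one_smul := fun x => Subtype.ext (one_smul P x.1)
      mul_smul := fun g h x => Subtype.ext (mul_smul g h x.1) }
  rw [← Finset.sum_coe_sort]
  refine sum_eq_zero_of_smul_invariant (P := P) (p := p) (k := k) (f := fun x : s => f x.1)
    (fun g x => ?_) (fun x => ?_) (fun g x => hf g x.1 x.2)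
  · obtain ⟨n, hn⟩ := hP g x.1 x.2
    exact ⟨n, Subtype.ext hn⟩
  · obtain ⟨g, hg⟩ := hfix x.1 x.2
    exact ⟨g, fun h => hg (congrArg Subtype.val h)⟩

/-- A group acting through a finite `p`-group on a nonzero vector space of characteristic `p` fixes
a nonzero vector: count the fixed points in the finite `𝔽_p`-span of an orbit. -/
lemma exists_ne_zero_fixed {k W : Type*} [Field k] [CharP k p] [AddCommGroup W] [Module k W]
    [Nontrivial W] (σ : Representation k P W) (hfin : (Set.range σ).Finite)
    (hP : ∀ g : P, ∃ n : ℕ, σ (g ^ p ^ n) = 1) : ∃ v : W, v ≠ 0 ∧ ∀ g, σ g v = v := by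
  obtain ⟨v, hv⟩ := exists_ne (0 : W)
  have hpW : ∀ x : W, p • x = 0 := fun x => by
    rw [← Nat.cast_smul_eq_nsmul k, CharP.cast_eq_zero, zero_smul]
  have := AddCommGroup.zmodModule hpW
  set A := Submodule.span (ZMod p) (Set.range fun g => σ g v) with hA
  have hAfin : Finite A := by
    have : (Set.range fun g => σ g v).Finite :=
      (hfin.image fun f => f v).subset (by rintro _ ⟨g, rfl⟩; exact ⟨σ g, ⟨g, rfl⟩, rfl⟩)
    have := Module.Finite.span_of_finite (ZMod p) this
    exact Module.finite_of_finite (ZMod p)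
  have hst : ∀ (g : P), ∀ x ∈ A, σ g x ∈ A := by
    intro g x hx
    induction hx using Submodule.span_induction with
    | mem x hx =>
      obtain ⟨h, rfl⟩ := hx
      refine Submodule.subset_span ⟨g * h, ?_⟩
      simp
    | zero => simp
    | add x y _ _ hx hy => rw [map_add]; exact add_mem hx hy
    | smul c x _ hx =>
      have : σ g (c • x) = c • σ g x := ((σ g).toAddMonoidHom.toZModLinearMap p).map_smul c x
      rw [this]; exact A.smul_mem c hx
  let _ : MulAction P A :=
    { smul := fun g x => ⟨σ g x.1, hst g x.1 x.2⟩
      one_smul := fun x => Subtype.ext (by change σ 1 x.1 = x.1; simp)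
      mul_smul := fun g h x => Subtype.ext (by change σ (g * h) x.1 = σ g (σ h x.1); simp) }
  have hG := isPGroup_range_toPermHom (P := P) (X := A) (p := p) fun g x => by
    obtain ⟨n, hn⟩ := hP g
    exact ⟨n, Subtype.ext (by change σ (g ^ p ^ n) x.1 = x.1; simp [hn])⟩
  have hvA : v ∈ A := Submodule.subset_span ⟨1, by simp⟩
  have hcard : p ∣ Nat.card A := by
    have h1 : addOrderOf (⟨v, hvA⟩ : A) = p :=
      addOrderOf_eq_prime (Subtype.ext (hpW v)) fun h => hv (congrArg Subtype.val h)
    exact (dvd_of_eq h1.symm).trans (addOrderOf_dvd_natCard _)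
  obtain ⟨b, hb, hb0⟩ := hG.exists_fixed_point_of_prime_dvd_card_of_fixed_point A hcard (a := 0)
    (by rintro ⟨_, g, rfl⟩; exact Subtype.ext (map_zero (σ g)))
  refine ⟨b.1, fun h => hb0 (Subtype.ext h.symm), fun g => ?_⟩
  exact congrArg Subtype.val (hb ⟨_, g, rfl⟩)

end PGroupActions

/-! ### Irreducible representations: elementary facts -/

section Irreducible

variable {k H W : Type*} [Field k] [Group H] [AddCommGroup W] [Module k W]
  {σ : Representation k H W}

lemma nontrivial_of_isIrreducible (hirr : σ.IsIrreducible) : Nontrivial W := by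
  have : Nontrivial (Subrepresentation σ) := hirr.toNontrivial
  by_contra h
  rw [not_nontrivial_iff_subsingleton] at h
  obtain ⟨a, b, hab⟩ := exists_pair_ne (Subrepresentation σ)
  exact hab (Subrepresentation.toSubmodule_injective (Subsingleton.elim _ _))

/-- A nonzero stable subspace of an irreducible representation is everything. -/
lemma eq_top_of_isIrreducible (hirr : σ.IsIrreducible) (U : Submodule k W)
    (hU : ∀ g, ∀ v ∈ U, σ g v ∈ U) {v : W} (hv : v ∈ U) (hv0 : v ≠ 0) : U = ⊤ := by
  have := hirr
  rcases eq_bot_or_eq_top (⟨U, fun g v hv => hU g v hv⟩ : Subrepresentation σ) with h | h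
  · have h' : U = ⊥ := congrArg Subrepresentation.toSubmodule h
    rw [h'] at hv
    exact absurd ((Submodule.mem_bot k).1 hv) hv0
  · exact congrArg Subrepresentation.toSubmodule h

/-- A linear map vanishing on the orbit of a nonzero vector is zero. -/
lemma eq_zero_of_forall_orbit (hirr : σ.IsIrreducible) {v : W} {M : Type*} [AddCommGroup M]
    [Module k M] (f : W →ₗ[k] M) (hf : ∀ g, f (σ g v) = 0) (hf0 : f ≠ 0) : v = 0 := by
  by_contra hv0
  have h : Submodule.span k (Set.range fun g => σ g v) = ⊤ := by
    refine eq_top_of_isIrreducible hirr _ (fun g x hx => ?_)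
      (Submodule.subset_span ⟨1, by simp⟩) hv0
    induction hx using Submodule.span_induction with
    | mem x hx =>
      obtain ⟨h, rfl⟩ := hx
      exact Submodule.subset_span ⟨g * h, by simp⟩
    | zero => simp
    | add x y _ _ hx hy => rw [map_add]; exact add_mem hx hy
    | smul c x _ hx => rw [map_smul]; exact Submodule.smul_mem _ c hx
  refine hf0 (LinearMap.ext_on_range (v := fun g => σ g v) h fun g => ?_)
  simpa using hf g

/-- Schur's lemma for an endomorphism commuting with the group. -/
lemma exists_eq_smul_one_of_commute [IsAlgClosed k] [FiniteDimensional k W]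
    (hirr : σ.IsIrreducible) (f : Module.End k W) (hf : ∀ g, σ g * f = f * σ g) :
    ∃ c : k, f = c • 1 := by
  have := nontrivial_of_isIrreducible hirr
  obtain ⟨c, hc⟩ := Module.End.exists_eigenvalue f
  obtain ⟨v, hv⟩ := hc.exists_hasEigenvector
  refine ⟨c, ?_⟩
  by_contra hne
  refine hv.2 (eq_zero_of_forall_orbit hirr (f - c • 1) (fun g => ?_) (sub_ne_zero.2 hne))
  have h1 : f (σ g v) = σ g (f v) := (LinearMap.congr_fun (hf g) v).symm
  simp [h1, hv.apply_eq_smul]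

/-- Commuting endomorphisms of a finite-dimensional space over an algebraically closed field have a
common eigenvector in every nonzero stable subspace. -/
lemma exists_common_eigenvector {ι : Type*} [IsAlgClosed k] [FiniteDimensional k W]
    (f : ι → Module.End k W) (hcomm : ∀ i j, f i * f j = f j * f i) (U : Submodule k W)
    (hU : U ≠ ⊥) (hst : ∀ i, ∀ v ∈ U, f i v ∈ U) :
    ∃ v ∈ U, v ≠ 0 ∧ ∃ χ : ι → k, ∀ i, f i v = χ i • v := by
  obtain ⟨M, ⟨hMU, hM0, hMst⟩, hmin⟩ := (wellFounded_lt (α := Submodule k W)).has_min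
    {M | M ≤ U ∧ M ≠ ⊥ ∧ ∀ i, ∀ v ∈ M, f i v ∈ M} ⟨U, le_rfl, hU, hst⟩
  have key : ∀ i, ∃ c : k, ∀ v ∈ M, f i v = c • v := by
    intro i
    have : Nontrivial M := Submodule.nontrivial_iff_ne_bot.2 hM0
    obtain ⟨c, hc⟩ := Module.End.exists_eigenvalue ((f i).restrict (hMst i))
    obtain ⟨v, hv⟩ := hc.exists_hasEigenvector
    have hfv : f i v.1 = c • v.1 := congrArg Subtype.val hv.apply_eq_smul
    have hle : M ⊓ LinearMap.ker (f i - c • 1) = M := by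
      by_contra hne
      refine hmin (M ⊓ LinearMap.ker (f i - c • 1)) ⟨inf_le_left.trans hMU, ?_, ?_⟩
        (lt_of_le_of_ne inf_le_left hne)
      · rw [Submodule.ne_bot_iff]
        exact ⟨v.1, ⟨v.2, by simp [hfv]⟩, fun h => hv.2 (Subtype.ext h)⟩
      · rintro j x ⟨hx, hx'⟩
        refine ⟨hMst j x hx, ?_⟩
        have h1 : f i (f j x) = f j (f i x) := LinearMap.congr_fun (hcomm i j) x
        have h2 : f i x = c • x := by simpa [sub_eq_zero] using hx'
        simp [h1, h2]
    refine ⟨c, fun x hx => ?_⟩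
    rw [← hle] at hx
    simpa [sub_eq_zero] using hx.2
  choose χ hχ using key
  obtain ⟨v, hv, hv0⟩ := Submodule.exists_mem_ne_zero_of_ne_bot hM0
  exact ⟨v, hMU hv, hv0, χ, fun i => hχ i v hv⟩

end Irreducible

/-! ### Irreducible representations of groups with a rank one `BN`-pair -/

section RankOne

/-- A group `H` which, modulo a normal subgroup `N`, has a split `BN`-pair of rank one in
characteristic `p`: `A / N` and `B / N` are opposite unipotent radicals, `T` is a torus
normalizing both and `w` is an involution exchanging them. The fields `big` and `gen` are the two
forms of the Bruhat decomposition that are used. -/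
structure IsRankOneDatum (p : ℕ) {H : Type*} [Group H] (A B T N : Subgroup H) (w : H) :
    Prop where
  normal : N.Normal
  finite : Finite (H ⧸ N)
  pow_mem : ∀ a ∈ A, ∃ n : ℕ, a ^ p ^ n ∈ N
  exists_notMem : ∃ a ∈ A, a ∉ N
  w_mul_w : w * w = 1
  conj_A : ∀ a ∈ A, w * a * w ∈ B
  conj_B : ∀ b ∈ B, w * b * w ∈ A
  conj_T : ∀ t ∈ T, w * t * w ∈ T
  comm_T : ∀ t ∈ T, ∀ s ∈ T, t * s = s * t
  normalize_A : ∀ t ∈ T, ∀ a ∈ A, t * a * t⁻¹ ∈ A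
  normalize_B : ∀ t ∈ T, ∀ b ∈ B, t * b * t⁻¹ ∈ B
  big : ∀ a ∈ A, a ∉ N → ∃ b ∈ B, ∃ t ∈ T, ∃ a' ∈ A, a * w = b * t * a'
  gen : ∀ h, (∃ b ∈ B, ∃ t ∈ T, ∃ a ∈ A, h = b * t * a) ∨
    (∃ n ∈ N, ∃ t ∈ T, ∃ a ∈ A, h = w * n * t * a)

variable {p : ℕ} {k H W : Type*} [Field k] [Group H] [AddCommGroup W]
  [Module k W] {σ : Representation k H W} {A B T N : Subgroup H} {w : H}

open Classical in
/-- The sum of the operators `σ(a)` for `a` in `A` modulo `N`, where `N` acts trivially. -/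
def unipSum (σ : Representation k H W) (A N : Subgroup H) [Fintype (H ⧸ N)] : Module.End k W :=
  ∑ x : H ⧸ N with ∃ a ∈ A, (a : H ⧸ N) = x, σ x.out

open Classical in
lemma unipSum_apply (σ : Representation k H W) (A N : Subgroup H) [Fintype (H ⧸ N)] (x : W) :
    unipSum σ A N x = ∑ q : H ⧸ N with ∃ a ∈ A, (a : H ⧸ N) = q, σ q.out x := by
  rw [unipSum, LinearMap.sum_apply]

lemma apply_out (hN : ∀ n ∈ N, σ n = 1) (h : H) : σ ((h : H ⧸ N).out) = σ h := by
  obtain ⟨n, hn⟩ := QuotientGroup.mk_out_eq_mul N h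
  rw [hn, map_mul, hN n n.2, mul_one]

lemma apply_mul_out (hN : ∀ n ∈ N, σ n = 1) [N.Normal] (h : H) (x : H ⧸ N) :
    σ h * σ x.out = σ ((h : H ⧸ N) * x).out := by
  rw [← map_mul, ← apply_out hN (h * x.out), QuotientGroup.mk_mul, QuotientGroup.out_eq']

lemma out_mul_apply (hN : ∀ n ∈ N, σ n = 1) [N.Normal] (h : H) (x : H ⧸ N) :
    σ x.out * σ h = σ (x * (h : H ⧸ N)).out := by
  rw [← map_mul, ← apply_out hN (x.out * h), QuotientGroup.mk_mul, QuotientGroup.out_eq']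

section UnipSum

variable [Fintype (H ⧸ N)] [N.Normal]

lemma apply_mul_unipSum (hN : ∀ n ∈ N, σ n = 1) {a : H} (ha : a ∈ A) :
    σ a * unipSum σ A N = unipSum σ A N := by
  classical
  rw [unipSum, Finset.mul_sum]
  refine Finset.sum_equiv (Equiv.mulLeft (a : H ⧸ N)) (fun x => ?_)
    (fun x _ => apply_mul_out hN a x)
  simp only [Finset.mem_filter, Finset.mem_univ, true_and, Equiv.coe_mulLeft]
  constructor
  · rintro ⟨b, hb, rfl⟩
    exact ⟨a * b, mul_mem ha hb, rfl⟩
  · rintro ⟨b, hb, h⟩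
    exact ⟨a⁻¹ * b, mul_mem (inv_mem ha) hb, by
      rw [QuotientGroup.mk_mul, h, QuotientGroup.mk_inv, inv_mul_cancel_left]⟩

lemma unipSum_mul_apply (hN : ∀ n ∈ N, σ n = 1) {a : H} (ha : a ∈ A) :
    unipSum σ A N * σ a = unipSum σ A N := by
  classical
  rw [unipSum, Finset.sum_mul]
  refine Finset.sum_equiv (Equiv.mulRight (a : H ⧸ N)) (fun x => ?_)
    (fun x _ => out_mul_apply hN a x)
  simp only [Finset.mem_filter, Finset.mem_univ, true_and, Equiv.coe_mulRight]
  constructor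
  · rintro ⟨b, hb, rfl⟩
    exact ⟨b * a, mul_mem hb ha, rfl⟩
  · rintro ⟨b, hb, h⟩
    exact ⟨b * a⁻¹, mul_mem hb (inv_mem ha), by
      rw [QuotientGroup.mk_mul, h, QuotientGroup.mk_inv, mul_inv_cancel_right]⟩

lemma commute_unipSum (hN : ∀ n ∈ N, σ n = 1) {t : H} (ht : ∀ a ∈ A, t * a * t⁻¹ ∈ A)
    (ht' : ∀ a ∈ A, t⁻¹ * a * t ∈ A) : σ t * unipSum σ A N = unipSum σ A N * σ t := by
  classical
  rw [unipSum, Finset.sum_mul, Finset.mul_sum]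
  refine Finset.sum_equiv (MulAut.conj (t : H ⧸ N)).toEquiv (fun x => ?_) (fun x _ => ?_)
  · simp only [Finset.mem_filter, Finset.mem_univ, true_and, MulEquiv.toEquiv_eq_coe,
      EquivLike.coe_coe, MulAut.conj_apply]
    constructor
    · rintro ⟨b, hb, rfl⟩
      exact ⟨t * b * t⁻¹, ht b hb, rfl⟩
    · rintro ⟨b, hb, h⟩
      refine ⟨t⁻¹ * b * t, ht' b hb, ?_⟩
      rw [QuotientGroup.mk_mul, QuotientGroup.mk_mul, h, QuotientGroup.mk_inv]
      group
  · rw [apply_mul_out hN, out_mul_apply hN]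
    simp [MulAut.conj_apply]

/-- On `A`-invariants, the sum over `A / N` is multiplication by the order of this nontrivial
`p`-group, hence zero. -/
lemma unipSum_apply_eq_zero [Fact p.Prime] [CharP k p] (hN : ∀ n ∈ N, σ n = 1)
    (hp : ∀ a ∈ A, ∃ n : ℕ, a ^ p ^ n ∈ N) (hA : ∃ a ∈ A, a ∉ N) {v : W}
    (hv : ∀ a ∈ A, σ a v = v) : unipSum σ A N v = 0 := by
  classical
  rw [unipSum, LinearMap.sum_apply]
  have h1 : ∀ x ∈ ({x | ∃ a ∈ A, (a : H ⧸ N) = x} : Finset (H ⧸ N)), σ x.out v = v := by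
    intro x hx
    obtain ⟨a, ha, rfl⟩ := (Finset.mem_filter.1 hx).2
    rw [apply_out hN, hv a ha]
  rw [Finset.sum_congr rfl h1]
  obtain ⟨u, hu, huN⟩ := hA
  refine finset_sum_eq_zero_of_smul_invariant (P := A) (p := p) (k := k) _ ?_ ?_ ?_
    (fun _ _ _ => rfl)
  · intro g x hx
    obtain ⟨a, ha, rfl⟩ := (Finset.mem_filter.1 hx).2
    exact Finset.mem_filter.2 ⟨Finset.mem_univ _, g * a, mul_mem g.2 ha, rfl⟩
  · intro g x hx
    obtain ⟨a, ha, rfl⟩ := (Finset.mem_filter.1 hx).2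
    obtain ⟨n, hn⟩ := hp g g.2
    refine ⟨n, ?_⟩
    change (((g : H) ^ p ^ n * a : H) : H ⧸ N) = a
    rw [QuotientGroup.mk_mul, (QuotientGroup.eq_one_iff _).2 hn, one_mul]
  · intro x hx
    obtain ⟨a, ha, rfl⟩ := (Finset.mem_filter.1 hx).2
    refine ⟨⟨u, hu⟩, fun h => huN ?_⟩
    have h' : ((u * a : H) : H ⧸ N) = a := h
    rw [QuotientGroup.mk_mul, mul_eq_right] at h'
    exact (QuotientGroup.eq_one_iff _).1 h'

end UnipSum

namespace IsRankOneDatum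

variable (D : IsRankOneDatum p A B T N w)
include D

lemma finite_range (hN : ∀ n ∈ N, σ n = 1) : (Set.range σ).Finite := by
  have := D.finite
  refine (Set.finite_range fun x : H ⧸ N => σ x.out).subset ?_
  rintro _ ⟨h, rfl⟩
  exact ⟨h, apply_out hN h⟩

lemma apply_w_w (v : W) : σ w (σ w v) = v := by
  rw [← Module.End.mul_apply, ← map_mul, D.w_mul_w, map_one, Module.End.one_apply]

lemma pow_mem_B {b : H} (hb : b ∈ B) : ∃ n : ℕ, b ^ p ^ n ∈ N := by
  have hw : w⁻¹ = w := inv_eq_of_mul_eq_one_left D.w_mul_w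
  obtain ⟨n, hn⟩ := D.pow_mem _ (D.conj_B b hb)
  refine ⟨n, ?_⟩
  have h1 : w * b * w = w * b * w⁻¹ := by rw [hw]
  rw [h1, conj_pow] at hn
  have h2 := D.normal.conj_mem _ hn w
  rwa [← mul_assoc, ← mul_assoc, D.w_mul_w, hw, one_mul, mul_assoc, D.w_mul_w, mul_one] at h2

/-- The space of `A`-invariants contains a `T`-eigenvector which is also an eigenvector of
`σ(e) σ(w)`, where `e` is the sum over `A / N`: as `(e w)² = c (e w)` on the `T`-eigenvector `v`,
either `e w v = 0` or `e w v` is an eigenvector. -/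
lemma exists_eigenvector [Fact p.Prime] [CharP k p] [IsAlgClosed k] [FiniteDimensional k W]
    [Nontrivial W] (hN : ∀ n ∈ N, σ n = 1) [Fintype (H ⧸ N)] [N.Normal] :
    ∃ v : W, v ≠ 0 ∧ (∀ a ∈ A, σ a v = v) ∧ (∀ t ∈ T, ∃ c : k, σ t v = c • v) ∧
      ∃ c : k, unipSum σ A N (σ w v) = c • v := by
  classical
  have hU : Representation.invariants (σ.comp A.subtype) ≠ ⊥ := by
    obtain ⟨v, hv0, hv⟩ := exists_ne_zero_fixed (p := p) (σ.comp A.subtype)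
      ((D.finite_range hN).subset (by rintro _ ⟨g, rfl⟩; exact ⟨g, rfl⟩)) fun g => by
        obtain ⟨n, hn⟩ := D.pow_mem g g.2
        exact ⟨n, hN _ hn⟩
    exact (Submodule.ne_bot_iff _).2 ⟨v, hv, hv0⟩
  have hinv : ∀ t ∈ T, ∀ a ∈ A, t⁻¹ * a * t ∈ A := fun t ht a ha => by
    simpa using D.normalize_A t⁻¹ (inv_mem ht) a ha
  have happ : ∀ (g h : H) (x : W), σ (g * h) x = σ g (σ h x) := fun g h x => by
    rw [map_mul, Module.End.mul_apply]
  obtain ⟨v, hvA, hv0, χ, hχ⟩ := exists_common_eigenvector (fun t : T => σ t)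
    (fun t s => by rw [← map_mul, ← map_mul, D.comm_T t t.2 s s.2])
    (Representation.invariants (σ.comp A.subtype)) hU (by
      intro t x hx a
      change σ a (σ t x) = σ t x
      rw [← happ, show (a : H) * t = t * ((t : H)⁻¹ * a * t) by simp [mul_assoc], happ]
      exact congrArg (σ t) (hx ⟨_, hinv t t.2 a a.2⟩))
  replace hvA : ∀ a ∈ A, σ a v = v := fun a ha => hvA ⟨a, ha⟩
  replace hχ : ∀ t (ht : t ∈ T), σ t v = χ ⟨t, ht⟩ • v := fun t ht => hχ ⟨t, ht⟩
  set e := unipSum σ A N with he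
  by_cases hS : e (σ w v) = 0
  · exact ⟨v, hv0, hvA, fun t ht => ⟨_, hχ t ht⟩, 0, by rw [hS, zero_smul]⟩
  have hSA : ∀ x, ∀ a ∈ A, σ a (e x) = e x := fun x a ha =>
    LinearMap.congr_fun (apply_mul_unipSum hN ha) x
  have hAS : ∀ x, ∀ a ∈ A, e (σ a x) = e x := fun x a ha =>
    LinearMap.congr_fun (unipSum_mul_apply hN ha) x
  refine ⟨e (σ w v), hS, hSA _, fun t ht => ⟨χ ⟨w * t * w, D.conj_T t ht⟩, ?_⟩, ?_⟩
  · have h1 : σ t (e (σ w v)) = e (σ t (σ w v)) :=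
      LinearMap.congr_fun (commute_unipSum hN (D.normalize_A t ht) (hinv t ht)) _
    have h2 : t * w = w * (w * t * w) := by
      rw [← mul_assoc, ← mul_assoc, D.w_mul_w, one_mul]
    rw [h1, ← happ, h2, happ, hχ _ (D.conj_T t ht), map_smul, map_smul]
  · have key : ∀ x ∈ ({x | ∃ a ∈ A, (a : H ⧸ N) = x} : Finset (H ⧸ N)), ∃ c : k,
        e (σ w (σ x.out (σ w v))) = c • e (σ w v) := by
      intro x hx
      obtain ⟨a, ha, rfl⟩ := (Finset.mem_filter.1 hx).2
      rw [apply_out hN]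
      by_cases haN : a ∈ N
      -- `e w a w v = e v = 0` for `a ∈ N`; otherwise `a w = b t a'` gives `χ(t) e w v`
      · refine ⟨0, ?_⟩
        rw [hN a haN, Module.End.one_apply, D.apply_w_w, zero_smul]
        exact unipSum_apply_eq_zero (p := p) hN D.pow_mem D.exists_notMem hvA
      · obtain ⟨b, hb, t, ht, a', ha', h⟩ := D.big a ha haN
        refine ⟨χ ⟨t, ht⟩, ?_⟩
        have h3 : w * (b * t * a') = (w * b * w) * (w * (t * a')) := by
          rw [mul_assoc (w * b), ← mul_assoc w w, D.w_mul_w, one_mul]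
          simp only [mul_assoc]
        rw [← happ a w, h, ← happ, h3, happ, hAS _ _ (D.conj_B b hb), happ, happ, hvA a' ha',
          hχ t ht, map_smul, map_smul]
    choose! c hc using key
    refine ⟨∑ x : H ⧸ N with ∃ a ∈ A, (a : H ⧸ N) = x, c x, ?_⟩
    refine (congrArg (fun y => e (σ w y)) (unipSum_apply σ A N (σ w v))).trans ?_
    rw [map_sum, map_sum, Finset.sum_smul]
    exact Finset.sum_congr rfl hc

/-- A `B`-invariant functional on an irreducible `σ` vanishes on no nonzero `A`-invariant vector. -/
lemma eq_zero_of_invariant_of_apply_eq_zero (hN : ∀ n ∈ N, σ n = 1) [Fintype (H ⧸ N)]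
    [N.Normal] (hirr : σ.IsIrreducible) {v : W}
    (hv : Submodule.span k (Set.range fun b : B => σ b v) = ⊤)
    {l : W →ₗ[k] k} (hl : ∀ b ∈ B, ∀ x, l (σ b x) = l x) (hl0 : l ≠ 0)
    {y : W} (hy : ∀ a ∈ A, σ a y = y) (hly : l y = 0) : y = 0 := by
  classical
  have happ : ∀ (g h : H) (x : W), σ (g * h) x = σ g (σ h x) := fun g h x => by
    rw [map_mul, Module.End.mul_apply]
  have heq : ∀ m : W →ₗ[k] k, (∀ b ∈ B, ∀ x, m (σ b x) = m x) → m v = 0 → m = 0 :=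
    fun m hm hmv => LinearMap.ext_on_range (v := fun b : B => σ b v) hv fun b => by
      rw [hm b b.2, hmv, LinearMap.zero_apply]
  have hlv : l v ≠ 0 := fun h => hl0 (heq l hl h)
  -- the `B`-invariant functionals form a line
  have hline : ∀ m : W →ₗ[k] k, (∀ b ∈ B, ∀ x, m (σ b x) = m x) → ∀ x, l x = 0 → m x = 0 := by
    intro m hm x hx
    have h := heq (l v • m - m v • l) (fun b hb x => by simp [hm b hb, hl b hb])
      (by simp [mul_comm])
    have h' := LinearMap.congr_fun h x
    simpa [hx, hlv] using h'
  have hT : ∀ t ∈ T, ∀ x, l x = 0 → l (σ t x) = 0 := by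
    intro t ht
    refine hline (l ∘ₗ σ t) fun b hb x => ?_
    change l (σ t (σ b x)) = l (σ t x)
    rw [← happ, show t * b = (t * b * t⁻¹) * t by simp, happ, hl _ (D.normalize_B t ht b hb)]
  -- the functional `l ∘ e ∘ σ(w)` is a multiple of `l`, and on an `A`-invariant `x` in the kernel of `l`
  -- the big cell kills all summands of `l (e (σ(w) x))` but `l (σ(w) x)`
  have hw : ∀ x, (∀ a ∈ A, σ a x = x) → l x = 0 → l (σ w x) = 0 := by
    intro x hx hlx
    have h := hline (l ∘ₗ unipSum σ A N ∘ₗ σ w) (fun b hb x => by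
      change l (unipSum σ A N (σ w (σ b x))) = l (unipSum σ A N (σ w x))
      have h2 : w * b = (w * b * w) * w := by rw [mul_assoc (w * b), D.w_mul_w, mul_one]
      rw [← happ, h2, happ, ← Module.End.mul_apply, unipSum_mul_apply hN (D.conj_B b hb)]) x hlx
    change l (unipSum σ A N (σ w x)) = 0 at h
    have h1 : (1 : H ⧸ N) ∈ ({x | ∃ a ∈ A, (a : H ⧸ N) = x} : Finset (H ⧸ N)) :=
      Finset.mem_filter.2 ⟨Finset.mem_univ _, 1, one_mem _, rfl⟩
    rw [unipSum_apply, map_sum, ← Finset.add_sum_erase _ _ h1, ← QuotientGroup.mk_one,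
      apply_out hN, map_one, Module.End.one_apply, Finset.sum_eq_zero, add_zero] at h
    · exact h
    · intro q hq
      obtain ⟨hq1, hq⟩ := Finset.mem_erase.1 hq
      obtain ⟨a, ha, rfl⟩ := (Finset.mem_filter.1 hq).2
      have haN : a ∉ N := fun h => hq1 ((QuotientGroup.eq_one_iff a).2 h)
      obtain ⟨b, hb, t, ht, a', ha', h⟩ := D.big a ha haN
      rw [apply_out hN, ← happ, h, happ, happ, hl b hb, hx a' ha']
      exact hT t ht x hlx
  refine eq_zero_of_forall_orbit hirr l (fun g => ?_) hl0
  rcases D.gen g with ⟨b, hb, t, ht, a, ha, rfl⟩ | ⟨n, hn, t, ht, a, ha, rfl⟩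
  · rw [happ, happ, hy a ha, hl b hb]
    exact hT t ht y hly
  · rw [happ, hy a ha, happ, happ, hN n hn, Module.End.one_apply]
    refine hw _ (fun a ha => ?_) (hT t ht y hly)
    have h2 : t⁻¹ * a * t ∈ A := by simpa using D.normalize_A t⁻¹ (inv_mem ht) a ha
    rw [← happ, show a * t = t * (t⁻¹ * a * t) by simp [mul_assoc], happ, hy _ h2]

/-- The `A`-invariants of an irreducible representation form a line, which maps isomorphically to
the `B`-coinvariants. -/
theorem finrank_invariants_and_bijective [Fact p.Prime] [CharP k p] [IsAlgClosed k]
    [FiniteDimensional k W] (hN : ∀ n ∈ N, σ n = 1) (hirr : σ.IsIrreducible) :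
    Module.finrank k (Representation.invariants (σ.comp A.subtype)) = 1 ∧
      Function.Bijective (invToCoinv A B σ) := by
  classical
  have := D.normal
  have := D.finite
  cases nonempty_fintype (H ⧸ N)
  have := nontrivial_of_isIrreducible hirr
  have happ : ∀ (g h : H) (x : W), σ (g * h) x = σ g (σ h x) := fun g h x => by
    rw [map_mul, Module.End.mul_apply]
  obtain ⟨v, hv0, hvA, hvT, c, hc⟩ := D.exists_eigenvector hN
  -- the vector `v` generates `W` under `B`
  have hspan : Submodule.span k (Set.range fun b : B => σ b v) = ⊤ := by
    set U := Submodule.span k (Set.range fun b : B => σ b v) with hU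
    have hbU : ∀ b ∈ B, ∀ t ∈ T, ∀ a ∈ A, σ (b * t * a) v ∈ U := by
      intro b hb t ht a ha
      obtain ⟨d, hd⟩ := hvT t ht
      rw [happ, happ, hvA a ha, hd, map_smul]
      exact U.smul_mem d (Submodule.subset_span ⟨⟨b, hb⟩, rfl⟩)
    have hwU : σ w v ∈ U := by
      have h1 : (1 : H ⧸ N) ∈ ({x | ∃ a ∈ A, (a : H ⧸ N) = x} : Finset (H ⧸ N)) :=
        Finset.mem_filter.2 ⟨Finset.mem_univ _, 1, one_mem _, rfl⟩
      rw [unipSum_apply, ← Finset.add_sum_erase _ _ h1, ← QuotientGroup.mk_one,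
        apply_out hN, map_one, Module.End.one_apply, ← eq_sub_iff_add_eq] at hc
      rw [hc]
      refine U.sub_mem (U.smul_mem c (Submodule.subset_span ⟨1, by simp⟩))
        (U.sum_mem fun q hq => ?_)
      obtain ⟨hq1, hq⟩ := Finset.mem_erase.1 hq
      obtain ⟨a, ha, rfl⟩ := (Finset.mem_filter.1 hq).2
      have haN : a ∉ N := fun h => hq1 ((QuotientGroup.eq_one_iff a).2 h)
      obtain ⟨b, hb, t, ht, a', ha', h⟩ := D.big a ha haN
      rw [apply_out hN, ← happ, h]
      exact hbU b hb t ht a' ha'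
    have hall : ∀ h, σ h v ∈ U := by
      intro h
      rcases D.gen h with ⟨b, hb, t, ht, a, ha, rfl⟩ | ⟨n, hn, t, ht, a, ha, rfl⟩
      · exact hbU b hb t ht a ha
      · obtain ⟨d, hd⟩ := hvT t ht
        rw [happ, hvA a ha, happ, happ, hN n hn, hd]
        simpa using U.smul_mem d hwU
    by_contra hne
    refine hv0 (eq_zero_of_forall_orbit hirr U.mkQ (fun g => ?_) fun h => hne ?_)
    · simpa using hall g
    · rw [← Submodule.ker_mkQ U, h, LinearMap.ker_zero]
  -- a nonzero `B`-invariant functional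
  obtain ⟨l, hl0, hl⟩ : ∃ l : W →ₗ[k] k, l ≠ 0 ∧ ∀ b ∈ B, ∀ x, l (σ b x) = l x := by
    obtain ⟨l, hl0, hl⟩ := exists_ne_zero_fixed (p := p) (σ.dual.comp B.subtype)
      (((D.finite_range hN).image fun f => Module.Dual.transpose (R := k) f).subset (by
        rintro _ ⟨g, rfl⟩
        exact ⟨σ (g⁻¹ : B), ⟨_, rfl⟩, rfl⟩)) fun g => by
        obtain ⟨n, hn⟩ := D.pow_mem_B g.2
        refine ⟨n, LinearMap.ext fun m => LinearMap.ext fun x => ?_⟩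
        have h2 : σ (((g : H) ^ p ^ n)⁻¹) = 1 := hN _ (inv_mem hn)
        change m (σ (((g : H) ^ p ^ n)⁻¹) x) = m x
        rw [h2, Module.End.one_apply]
    refine ⟨l, hl0, fun b hb x => ?_⟩
    have h := LinearMap.congr_fun (hl ⟨b, hb⟩⁻¹) x
    change l (σ (b⁻¹)⁻¹ x) = l x at h
    rwa [inv_inv] at h
  have hinj : Function.Injective (invToCoinv A B σ) := by
    rw [← LinearMap.ker_eq_bot, LinearMap.ker_eq_bot']
    intro y hy
    refine Subtype.ext (D.eq_zero_of_invariant_of_apply_eq_zero hN hirr hspan hl hl0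
      (fun a ha => y.2 ⟨a, ha⟩) ?_)
    have h := congrArg (Representation.Coinvariants.lift (σ.comp B.subtype) l
      fun b => LinearMap.ext fun x => hl b b.2 x) hy
    rwa [map_zero] at h
  set v' : Representation.invariants (σ.comp A.subtype) := ⟨v, fun a => hvA a a.2⟩ with hv'
  have hgen : ∀ z, ∃ d : k, z = d • invToCoinv A B σ v' := by
    intro z
    obtain ⟨x, rfl⟩ := Representation.Coinvariants.mk_surjective _ z
    have hx : x ∈ Submodule.span k (Set.range fun b : B => σ b v) := hspan ▸ Submodule.mem_top
    induction hx using Submodule.span_induction with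
    | mem x hx =>
      obtain ⟨b, rfl⟩ := hx
      exact ⟨1, by
        rw [one_smul]; exact Representation.Coinvariants.mk_self_apply (σ.comp B.subtype) b v⟩
    | zero => exact ⟨0, by simp⟩
    | add x y _ _ hx hy =>
      obtain ⟨d, hd⟩ := hx
      obtain ⟨d', hd'⟩ := hy
      exact ⟨d + d', by rw [map_add, hd, hd', add_smul]⟩
    | smul a x _ hx =>
      obtain ⟨d, hd⟩ := hx
      exact ⟨a * d, by rw [map_smul, hd, mul_smul]⟩
  refine ⟨finrank_eq_one v' (fun h => hv0 (congrArg Subtype.val h)) fun y => ?_, hinj, fun z => ?_⟩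
  · obtain ⟨d, hd⟩ := hgen (invToCoinv A B σ y)
    exact ⟨d, hinj (by rw [map_smul, hd])⟩
  · obtain ⟨d, hd⟩ := hgen z
    exact ⟨d • v', by rw [map_smul, hd]⟩

end IsRankOneDatum

end RankOne

/-! ### The projector `j` -/

section JMap

variable {k H W : Type*} [Field k] [Group H] [AddCommGroup W]
  [Module k W] {σ : Representation k H W} {A B : Subgroup H}
  (hb : Function.Bijective (invToCoinv A B σ))
include hb

lemma mk_jMap (x : W) : Representation.Coinvariants.mk (σ.comp B.subtype) (jMap A B σ x) =
    Representation.Coinvariants.mk (σ.comp B.subtype) x := by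
  rw [jMap, dif_pos hb]
  exact (LinearEquiv.ofBijective (invToCoinv A B σ) hb).apply_symm_apply _

lemma apply_jMap {a : H} (ha : a ∈ A) (x : W) : σ a (jMap A B σ x) = jMap A B σ x := by
  rw [jMap, dif_pos hb]
  exact ((LinearEquiv.ofBijective (invToCoinv A B σ) hb).symm _).2 ⟨a, ha⟩

lemma apply_mul_jMap {a : H} (ha : a ∈ A) : σ a * jMap A B σ = jMap A B σ :=
  LinearMap.ext fun x => apply_jMap hb ha x

lemma jMap_mul_apply {b : H} (hb' : b ∈ B) : jMap A B σ * σ b = jMap A B σ := by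
  rw [jMap, dif_pos hb]
  refine LinearMap.ext fun x => ?_
  have : Representation.Coinvariants.mk (σ.comp B.subtype) (σ b x) =
      Representation.Coinvariants.mk (σ.comp B.subtype) x :=
    Representation.Coinvariants.mk_self_apply (σ.comp B.subtype) ⟨b, hb'⟩ x
  simp [this]

lemma jMap_eq_self {x : W} (hx : ∀ a ∈ A, σ a x = x) : jMap A B σ x = x := by
  rw [jMap, dif_pos hb]
  exact congrArg Subtype.val ((LinearEquiv.ofBijective (invToCoinv A B σ) hb).symm_apply_apply
    ⟨x, fun a => hx a a.2⟩)

lemma jMap_mul_self : jMap A B σ * jMap A B σ = jMap A B σ :=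
  LinearMap.ext fun x => jMap_eq_self hb fun _ ha => apply_jMap hb ha x

variable (h1 : Module.finrank k (Representation.invariants (σ.comp A.subtype)) = 1)
include h1

lemma jMap_ne_zero : jMap A B σ ≠ 0 := by
  intro h
  obtain ⟨v, hv, -⟩ := finrank_eq_one_iff'.1 h1
  have := jMap_eq_self hb (x := v.1) fun a ha => v.2 ⟨a, ha⟩
  rw [h, LinearMap.zero_apply] at this
  exact hv (Subtype.ext this.symm)

/-- The endomorphisms with `A`-invariant image which factor through the `B`-coinvariants are the
multiples of `j`. -/
lemma exists_eq_smul_jMap {f : Module.End k W} (hA : ∀ a ∈ A, σ a * f = f)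
    (hB : ∀ b ∈ B, f * σ b = f) : ∃ c : k, f = c • jMap A B σ := by
  obtain ⟨v, hv, hgen⟩ := finrank_eq_one_iff'.1 h1
  have hfA : ∀ x, ∀ a : A, σ a (f x) = f x := fun x a => LinearMap.congr_fun (hA a a.2) x
  obtain ⟨c, hc⟩ := hgen ⟨f v, hfA v⟩
  replace hc : c • v.1 = f v := congrArg Subtype.val hc
  refine ⟨c, LinearMap.ext fun x => ?_⟩
  have h2 : f x = f (jMap A B σ x) :=
    congrArg (Representation.Coinvariants.lift (σ.comp B.subtype) f fun b => hB b b.2)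
      (mk_jMap hb x).symm
  obtain ⟨d, hd⟩ := hgen ⟨jMap A B σ x, fun a => apply_jMap hb a.2 x⟩
  replace hd : d • v.1 = jMap A B σ x := congrArg Subtype.val hd
  rw [h2, LinearMap.smul_apply, ← hd, map_smul, ← hc, smul_comm]

/-- The projector `j` commutes with the elements normalizing both `A` and `B`. -/
lemma commute_jMap {t : H} (hA : ∀ a ∈ A, t⁻¹ * a * t ∈ A) (hA' : ∀ a ∈ A, t * a * t⁻¹ ∈ A)
    (hB : ∀ b ∈ B, t * b * t⁻¹ ∈ B) : σ t * jMap A B σ = jMap A B σ * σ t := by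
  set j := jMap A B σ with hj
  have htt : σ t * σ t⁻¹ = 1 := by rw [← map_mul, mul_inv_cancel, map_one]
  have htt' : σ t⁻¹ * σ t = 1 := by rw [← map_mul, inv_mul_cancel, map_one]
  obtain ⟨c, hc⟩ := exists_eq_smul_jMap hb h1 (f := σ t⁻¹ * j * σ t)
    (fun a ha => by
      have h : a * t⁻¹ = t⁻¹ * (t * a * t⁻¹) := by simp [mul_assoc]
      rw [← mul_assoc, ← mul_assoc, ← map_mul, h, map_mul, mul_assoc (σ t⁻¹),
        apply_mul_jMap hb (hA' a ha)])
    (fun b hb' => by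
      have h : t * b = t * b * t⁻¹ * t := by simp
      rw [mul_assoc _ (σ t), ← map_mul, h, map_mul, ← mul_assoc, mul_assoc (σ t⁻¹),
        jMap_mul_apply hb (hB b hb')])
  rw [← hj] at hc
  have h2 : j * σ t = c • (σ t * j) := by
    rw [← mul_smul_comm, ← hc, ← mul_assoc, ← mul_assoc, htt, one_mul]
  obtain ⟨v, hv, -⟩ := finrank_eq_one_iff'.1 h1
  have hjv : j v.1 = v.1 := jMap_eq_self hb fun a ha => v.2 ⟨a, ha⟩
  have hjtv : j (σ t v.1) = σ t v.1 := jMap_eq_self hb fun a ha => by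
    have h : a * t = t * (t⁻¹ * a * t) := by simp [mul_assoc]
    rw [← Module.End.mul_apply, ← map_mul, h, map_mul, Module.End.mul_apply]
    exact congrArg (σ t) (v.2 ⟨_, hA a ha⟩)
  have h3 := LinearMap.congr_fun h2 v.1
  rw [LinearMap.smul_apply, Module.End.mul_apply, Module.End.mul_apply, hjtv, hjv] at h3
  have hne : σ t v.1 ≠ 0 := fun h => hv (Subtype.ext (by
    have := congrArg (σ t⁻¹) h
    rwa [← Module.End.mul_apply, htt', Module.End.one_apply, map_zero] at this))
  have hc1 : c = 1 := by
    have h4 : (1 - c) • σ t v.1 = 0 := by rw [sub_smul, one_smul, ← h3, sub_self]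
    rcases smul_eq_zero.1 h4 with h | h
    · exact (sub_eq_zero.1 h).symm
    · exact absurd h hne
  rw [h2, hc1, one_smul]

end JMap

/-! ### Hecke algebras of compact open subgroups -/

section CompactOpen

open Topology

variable {k : Type*} [Field k] {G : Type*} [Group G] [TopologicalSpace G]
  {K : Subgroup G} {W : Type*} [AddCommGroup W] [Module k W] {σ : Representation k K W}

/-- A neighbourhood of `1` in an open subgroup gives one in the group. -/
lemma eventually_nhds_one (hK : IsOpen (K : Set G)) {s : Set K} (hs : IsOpen s) (h1 : 1 ∈ s) :
    ∀ᶠ u in 𝓝 (1 : G), ∃ κ ∈ s, (κ : G) = u :=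
  (hK.isOpenMap_subtype_val s hs).mem_nhds ⟨1, h1, rfl⟩

lemma isLocallyConstant_of_eventually [IsTopologicalGroup G] {M : Type*} {f : G → M}
    (h : ∀ g, ∀ᶠ u in 𝓝 (1 : G), f (u * g) = f g) : IsLocallyConstant f := by
  refine (IsLocallyConstant.iff_eventually_eq f).2 fun g => ?_
  have ht : Filter.Tendsto (fun y : G => y * g⁻¹) (𝓝 g) (𝓝 1) := by
    have := (continuous_mul_const g⁻¹).tendsto g
    rwa [mul_inv_cancel] at this
  filter_upwards [ht.eventually (h g)] with y hy
  simpa using hy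

/-- Equivariant functions with values in a smooth representation are locally constant. -/
lemma isLocallyConstant_of_equivariant [IsTopologicalGroup G] (hK : IsOpen (K : Set G))
    (hσ : IsSmooth σ) {f : G → W} (hf : ∀ (κ : K) (g : G), f (κ * g) = σ κ (f g)) :
    IsLocallyConstant f := by
  refine isLocallyConstant_of_eventually fun g => ?_
  filter_upwards [eventually_nhds_one hK (hσ (f g)) (by simp)] with u hu
  obtain ⟨κ, hκ, rfl⟩ := hu
  rw [hf, hκ]

/-- The kernel of a smooth finite-dimensional representation is open. -/
lemma isOpen_setOf_apply_eq_one {H : Type*} [Group H] [TopologicalSpace H]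
    {τ : Representation k H W} [FiniteDimensional k W] (hτ : IsSmooth τ) :
    IsOpen {h : H | τ h = 1} := by
  have : {h : H | τ h = 1} =
      ⋂ i, {h | τ h (Module.finBasis k W i) = Module.finBasis k W i} := by
    ext h
    simp only [Set.mem_ofPred_eq, Set.mem_iInter]
    exact ⟨fun hh i => by rw [hh, Module.End.one_apply],
      fun hh => (Module.finBasis k W).ext fun i => by rw [hh i, Module.End.one_apply]⟩
  rw [this]
  exact isOpen_iInter_of_finite fun i => hτ _

lemma isLocallyConstant_end_of_equivariant [IsTopologicalGroup G] (hK : IsOpen (K : Set G))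
    [FiniteDimensional k W] (hσ : IsSmooth σ) {φ : G → Module.End k W}
    (hφ : ∀ (κ : K) (g : G), φ (κ * g) = σ κ * φ g) : IsLocallyConstant φ := by
  refine isLocallyConstant_of_eventually fun g => ?_
  filter_upwards [eventually_nhds_one hK (isOpen_setOf_apply_eq_one hσ) (map_one σ)] with u hu
  obtain ⟨κ, hκ, rfl⟩ := hu
  rw [hφ, show σ κ = 1 from hκ, one_mul]

variable [IsTopologicalGroup G] [T2Space G]

open Classical in
/-- The function `[1, w] ∈ ind_K^G σ` supported on `K` with value `w` at `1`, as a linear function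
of `w`. -/
def testFun (hK : IsOpen (K : Set G)) (hKc : IsCompact (K : Set G)) (hσ : IsSmooth σ) :
    W →ₗ[k] compactInd σ where
  toFun w := ⟨fun g => if h : g ∈ K then σ ⟨g, h⟩ w else 0, by
    have heq : ∀ (κ : K) (g : G), (if h : (κ : G) * g ∈ K then σ ⟨κ * g, h⟩ w else 0) =
        σ κ (if h : g ∈ K then σ ⟨g, h⟩ w else 0) := by
      intro κ g
      by_cases h : g ∈ K
      · rw [dif_pos h, dif_pos (mul_mem κ.2 h), ← Module.End.mul_apply, ← map_mul]
        rfl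
      · rw [dif_neg h, dif_neg (fun h' => h ((K.mul_mem_cancel_left κ.2).1 h')), map_zero]
    exact ⟨heq, isLocallyConstant_of_equivariant hK hσ heq,
      HasCompactSupport.intro hKc fun g hg => dif_neg hg⟩⟩
  map_add' w w' := Subtype.ext <| funext fun g => by
    by_cases h : g ∈ K <;> simp [h]
  map_smul' c w := Subtype.ext <| funext fun g => by
    by_cases h : g ∈ K <;> simp [h]

section TestFun

variable (hK : IsOpen (K : Set G)) (hKc : IsCompact (K : Set G)) (hσ : IsSmooth σ)

lemma testFun_of_mem (w : W) {g : G} (hg : g ∈ K) :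
    (testFun hK hKc hσ w).1 g = σ ⟨g, hg⟩ w := dif_pos hg

lemma testFun_of_notMem (w : W) {g : G} (hg : g ∉ K) : (testFun hK hKc hσ w).1 g = 0 :=
  dif_neg hg

lemma indRep_testFun (κ : K) (w : W) :
    indRep σ κ (testFun hK hKc hσ w) = testFun hK hKc hσ (σ κ w) := by
  refine Subtype.ext <| funext fun g => ?_
  change (testFun hK hKc hσ w).1 (g * κ) = _
  by_cases h : g ∈ K
  · rw [testFun_of_mem hK hKc hσ _ h, testFun_of_mem hK hKc hσ _ (mul_mem h κ.2),
      ← Module.End.mul_apply, ← map_mul]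
    rfl
  · rw [testFun_of_notMem hK hKc hσ _ h,
      testFun_of_notMem hK hKc hσ _ fun h' => h ((K.mul_mem_cancel_right κ.2).1 h')]

/-- The operator attached to `φ` sends `[1, w]` to `g ↦ φ(g) w`. -/
lemma heckeAct_testFun (φ : heckeFun σ) (w : W) (g : G) :
    heckeAct φ (testFun hK hKc hσ w).1 g = φ.1 g w := by
  unfold heckeAct
  have hmem : ((g : G ⧸ K).out)⁻¹ * g ∈ K := by
    rw [← QuotientGroup.eq, QuotientGroup.out_eq']
  rw [finsum_eq_single _ (g : G ⧸ K)]
  · rw [testFun_of_mem hK hKc hσ _ hmem, ← Module.End.mul_apply, ← heckeFun_right]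
    simp
  · intro x hx
    rw [testFun_of_notMem hK hKc hσ, map_zero]
    intro h
    refine hx ?_
    rw [← QuotientGroup.out_eq' x]
    exact QuotientGroup.eq.2 h

/-- The representation `ind_K^G σ` is generated by the functions `[1, w]`. -/
lemma eq_sum_testFun (f : compactInd σ) :
    ∃ s : Finset (G ⧸ K), f = ∑ x ∈ s, indRep σ x.out (testFun hK hKc hσ (f.1 x.out⁻¹)) := by
  have hfin : {x : G ⧸ K | f.1 x.out⁻¹ ≠ 0}.Finite := by
    have hd : DiscreteTopology (G ⧸ K) := QuotientGroup.discreteTopology hK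
    have hc : IsCompact ((fun g : G => ((g⁻¹ : G) : G ⧸ K)) '' tsupport f.1) :=
      f.2.2.2.isCompact.image (continuous_quot_mk.comp continuous_inv)
    refine hc.finite_of_discrete.subset fun x hx => ⟨x.out⁻¹, subset_tsupport _ hx, ?_⟩
    simp only [inv_inv]
    exact QuotientGroup.out_eq' x
  refine ⟨hfin.toFinset, Subtype.ext <| funext fun g => ?_⟩
  rw [Submodule.coe_sum, Finset.sum_apply]
  have hmem : g * ((g⁻¹ : G) : G ⧸ K).out ∈ K := by
    have h : ((g⁻¹ : G) : G ⧸ K) = (((g⁻¹ : G) : G ⧸ K).out : G ⧸ K) :=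
      (QuotientGroup.out_eq' _).symm
    simpa using QuotientGroup.eq.1 h
  have hval : ∀ x : G ⧸ K, (indRep σ x.out (testFun hK hKc hσ (f.1 x.out⁻¹))).1 g =
      (testFun hK hKc hσ (f.1 x.out⁻¹)).1 (g * x.out) := fun x => rfl
  rw [Finset.sum_eq_single ((g⁻¹ : G) : G ⧸ K)]
  · rw [hval, testFun_of_mem hK hKc hσ _ hmem, ← f.2.1]
    simp
  · intro x _ hx
    rw [hval]
    refine testFun_of_notMem hK hKc hσ _ fun h => hx ?_
    rw [← QuotientGroup.out_eq' x, eq_comm, QuotientGroup.eq, inv_inv]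
    exact h
  · intro h
    rw [Set.Finite.mem_toFinset, Set.mem_ofPred_eq, not_not] at h
    rw [hval, h, map_zero]
    rfl

lemma intertwiningMap_ext {S T : (indRep σ).IntertwiningMap (indRep σ)}
    (h : ∀ w, S (testFun hK hKc hσ w) = T (testFun hK hKc hσ w)) : S = T := by
  refine Representation.IntertwiningMap.ext (LinearMap.ext fun f => ?_)
  obtain ⟨s, hs⟩ := eq_sum_testFun hK hKc hσ f
  change S f = T f
  rw [hs, map_sum, map_sum]
  refine Finset.sum_congr rfl fun x _ => ?_
  rw [S.isIntertwining, T.isIntertwining, h]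

end TestFun

lemma heckeOp_apply (hK : IsOpen (K : Set G)) (φ : heckeFun σ) (f : compactInd σ) (g : G) :
    (heckeOp hK φ f).1 g = heckeAct φ f.1 g := rfl

/-- The isomorphism `H_K(σ) ≅ End_G(ind_K^G σ)`: an endomorphism `T` comes from the Hecke function
`g ↦ (w ↦ T [1, w] (g))`. -/
theorem heckeOp_bijective (hK : IsOpen (K : Set G)) (hKc : IsCompact (K : Set G))
    (hσ : IsSmooth σ) [FiniteDimensional k W] : Function.Bijective (heckeOp (σ := σ) hK) := by
  constructor
  · intro φ ψ h
    refine Subtype.ext <| funext fun g => LinearMap.ext fun w => ?_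
    rw [← heckeAct_testFun hK hKc hσ, ← heckeAct_testFun hK hKc hσ, ← heckeOp_apply hK,
      ← heckeOp_apply hK, h]
  · intro T
    let φ : G → Module.End k W := fun g =>
      LinearMap.proj (R := k) (φ := fun _ : G => W) g ∘ₗ (compactInd σ).subtype ∘ₗ
        T.toLinearMap ∘ₗ testFun hK hKc hσ
    have hφ : ∀ g w, φ g w = (T (testFun hK hKc hσ w)).1 g := fun _ _ => rfl
    have hleft : ∀ (κ : K) (g : G), φ (κ * g) = σ κ * φ g := fun κ g => LinearMap.ext fun w => by
      rw [hφ, (T (testFun hK hKc hσ w)).2.1, Module.End.mul_apply, hφ]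
    have hright : ∀ (κ : K) (g : G), φ (g * κ) = φ g * σ κ := fun κ g => LinearMap.ext fun w => by
      rw [Module.End.mul_apply, hφ, hφ, ← indRep_testFun, T.isIntertwining]
      rfl
    have hmem : φ ∈ heckeFun σ := by
      refine ⟨fun κ κ' g => by rw [hright, hleft],
        isLocallyConstant_end_of_equivariant hK hσ hleft, ?_⟩
      refine HasCompactSupport.intro (K := ⋃ i, tsupport
        (T (testFun hK hKc hσ (Module.finBasis k W i))).1)
        (isCompact_iUnion fun i => (T _).2.2.2.isCompact) fun g hg => ?_
      refine (Module.finBasis k W).ext fun i => ?_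
      rw [hφ, LinearMap.zero_apply]
      exact image_eq_zero_of_notMem_tsupport fun h => hg (Set.mem_iUnion.2 ⟨i, h⟩)
    refine ⟨⟨φ, hmem⟩, intertwiningMap_ext hK hKc hσ fun w => Subtype.ext <| funext fun g => ?_⟩
    rw [heckeOp_apply, heckeAct_testFun]
    exact hφ g w

/-- Convolution corresponds to composition of operators. -/
theorem heckeOp_conv (hK : IsOpen (K : Set G)) (hKc : IsCompact (K : Set G))
    (hσ : IsSmooth σ) (φ ψ : heckeFun σ) :
    heckeOp hK (conv hK φ ψ) = heckeOp hK φ * heckeOp hK ψ := by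
  refine intertwiningMap_ext hK hKc hσ fun w => Subtype.ext <| funext fun g => ?_
  change heckeAct (conv hK φ ψ) (testFun hK hKc hσ w).1 g =
    heckeAct φ (heckeAct ψ (testFun hK hKc hσ w).1) g
  rw [heckeAct_testFun, heckeAct_eq_sum hK]
  change convFun φ ψ g w = _
  rw [convFun_eq_sum hK, LinearMap.sum_apply]
  exact Finset.sum_congr rfl fun x _ => by rw [heckeAct_testFun, Module.End.mul_apply]

/-- The Hecke function supported on `K` with value the identity at `1` acts as the identity. -/
lemma heckeOp_eq_one (hK : IsOpen (K : Set G)) (hKc : IsCompact (K : Set G))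
    (hσ : IsSmooth σ) (φ : heckeFun σ) (hφ : ∀ g, g ∉ K → φ.1 g = 0) (h1 : φ.1 1 = 1) :
    heckeOp hK φ = 1 := by
  refine intertwiningMap_ext hK hKc hσ fun w => Subtype.ext <| funext fun g => ?_
  rw [heckeOp_apply, heckeAct_testFun]
  change _ = (testFun hK hKc hσ w).1 g
  by_cases hg : g ∈ K
  · have h := heckeFun_right φ ⟨g, hg⟩ 1
    rw [h1, one_mul, one_mul] at h
    rw [testFun_of_mem hK hKc hσ _ hg, h]
  · rw [testFun_of_notMem hK hKc hσ _ hg, hφ g hg, LinearMap.zero_apply]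

end CompactOpen

/-! ### Hecke functions supported on one double coset -/

section DoubleCoset

variable {k : Type*} [Field k] {G : Type*} [Group G] [TopologicalSpace G]
  {K : Subgroup G} {W : Type*} [AddCommGroup W] [Module k W] {σ : Representation k K W}

lemma heckeFun_bi (φ : heckeFun σ) (κ κ' : K) (g : G) :
    φ.1 (κ * g * κ') = σ κ * φ.1 g * σ κ' := φ.2.1 κ κ' g

/-- There is a Hecke function supported on `K g K` with value `f` at `g`, provided that `f`
intertwines the two actions of `K ∩ g K g⁻¹`. -/
lemma exists_heckeFun_supported [IsTopologicalGroup G] [T2Space G] (hK : IsOpen (K : Set G))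
    (hKc : IsCompact (K : Set G)) (hσ : IsSmooth σ) [FiniteDimensional k W] (g : G)
    (f : Module.End k W) (hf : ∀ κ κ' : K, κ * g = g * κ' → σ κ * f = f * σ κ') :
    ∃ φ : heckeFun σ, (Function.support φ.1 ⊆ {x | ∃ κ κ' : K, x = κ * g * κ'}) ∧ φ.1 g = f := by
  classical
  have hinv : ∀ κ : K, σ κ⁻¹ * σ κ = 1 := fun κ => by rw [← map_mul, inv_mul_cancel, map_one]
  have hinv' : ∀ κ : K, σ κ * σ κ⁻¹ = 1 := fun κ => by rw [← map_mul, mul_inv_cancel, map_one]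
  set c : G → Prop := fun x => ∃ κ κ' : K, x = κ * g * κ' with hc
  let φ : G → Module.End k W := fun x =>
    if h : c x then σ h.choose * f * σ h.choose_spec.choose else 0
  have hφ : ∀ κ κ' : K, φ (κ * g * κ') = σ κ * f * σ κ' := by
    intro κ κ'
    have h : c (κ * g * κ') := ⟨κ, κ', rfl⟩
    have hs := h.choose_spec.choose_spec
    simp only [φ]
    rw [dif_pos h]
    set μ := h.choose
    set μ' := h.choose_spec.choose
    have h1 : ((κ⁻¹ * μ : K) : G) * g = g * ((κ' * μ'⁻¹ : K) : G) := by
      have : (κ : G)⁻¹ * (κ * g * κ') * (μ' : G)⁻¹ = (κ : G)⁻¹ * (μ * g * μ') * (μ' : G)⁻¹ := by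
        rw [← hs]
      simp only [mul_assoc, inv_mul_cancel_left, mul_inv_cancel, mul_one] at this
      simp [mul_assoc, this]
    have h2 := hf _ _ h1
    rw [map_mul, map_mul] at h2
    calc σ μ * f * σ μ' = σ κ * (σ κ⁻¹ * σ μ * f) * σ μ' := by
          rw [← mul_assoc, ← mul_assoc, hinv', one_mul]
      _ = σ κ * f * (σ κ' * (σ μ'⁻¹ * σ μ')) := by rw [h2]; simp only [mul_assoc]
      _ = σ κ * f * σ κ' := by rw [hinv, mul_one]
  have hcl : ∀ (κ κ' : K) (x : G), ¬ c x → ¬ c (κ * x * κ') := by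
    rintro κ κ' x hx ⟨μ, μ', h⟩
    refine hx ⟨κ⁻¹ * μ, μ' * κ'⁻¹, ?_⟩
    have : x = (κ : G)⁻¹ * (κ * x * κ') * (κ' : G)⁻¹ := by group
    rw [this, h]
    simp [mul_assoc]
  have hbi : ∀ (κ κ' : K) (x : G), φ (κ * x * κ') = σ κ * φ x * σ κ' := by
    intro κ κ' x
    by_cases hx : c x
    · obtain ⟨μ, μ', rfl⟩ := hx
      have h1 : (κ : G) * (μ * g * μ') * κ' = ((κ * μ : K) : G) * g * ((μ' * κ' : K) : G) := by
        simp [mul_assoc]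
      rw [h1, hφ, hφ, map_mul, map_mul]
      simp only [mul_assoc]
    · simp only [φ]
      rw [dif_neg hx, dif_neg (hcl κ κ' x hx), mul_zero, zero_mul]
  refine ⟨⟨φ, hbi, isLocallyConstant_end_of_equivariant hK hσ fun κ x => by
    simpa using hbi κ 1 x, ?_⟩, ?_, ?_⟩
  · refine HasCompactSupport.intro (K := (fun q : G × G => q.1 * g * q.2) '' (K ×ˢ K))
      ((hKc.prod hKc).image (by fun_prop)) fun x hx => dif_neg ?_
    rintro ⟨κ, κ', rfl⟩
    exact hx ⟨(κ, κ'), ⟨κ.2, κ'.2⟩, rfl⟩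
  · intro x hx
    by_contra h
    exact hx (dif_neg h)
  · simpa using hφ 1 1

end DoubleCoset

/-! ### Valuations and fractional ideals of a local field -/

section LocalField

open ValuativeRel Topology

variable {E : Type*} [Field E] [ValuativeRel E] [TopologicalSpace E] [IsNonarchimedeanLocalField E]

lemma mem_primePow {n : ℤ} {x : E} :
    x ∈ primePow E n ↔ valuation E x ≤ uniformizer E ^ n := Iff.rfl

lemma uniformizer_zpow_le_iff {m n : ℤ} :
    uniformizer E ^ m ≤ uniformizer E ^ n ↔ n ≤ m :=
  zpow_le_zpow_iff_right_of_lt_one₀ uniformizer_pos uniformizer_lt_one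

lemma primePow_anti {m n : ℤ} (h : m ≤ n) {x : E} (hx : x ∈ primePow E n) : x ∈ primePow E m :=
  (mem_primePow.1 hx).trans (uniformizer_zpow_le_iff.2 h)

/-- The value group is generated by the value of a uniformizer. -/
lemma exists_valuation_eq_zpow {x : E} (hx : x ≠ 0) :
    ∃ n : ℤ, valuation E x = uniformizer E ^ n := by
  have hu : uniformizer E ≠ 0 := uniformizer_ne_zero
  have hx0 : valuation E x ≠ 0 := by simpa using hx
  obtain ⟨k, hk⟩ := exists_pow_lt₀ (uniformizer_lt_one (R := E)) (Units.mk0 _ hx0)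
  obtain ⟨l, hl⟩ := exists_pow_lt₀ (uniformizer_lt_one (R := E)) (Units.mk0 _ (inv_ne_zero hx0))
  rw [Units.val_mk0] at hk hl
  -- the largest exponent `n` with `v(x) ≤ v(ϖ)ⁿ`
  obtain ⟨n, hn, hmax⟩ := Int.exists_greatest_of_bdd
    (P := fun n : ℤ => valuation E x ≤ uniformizer E ^ n)
    ⟨k, fun z hz => by
      have h := hk.le.trans hz
      rw [← zpow_natCast] at h
      exact uniformizer_zpow_le_iff.1 h⟩
    ⟨-l, by
      rw [zpow_neg, zpow_natCast, ← inv_inv (valuation E x)]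
      exact (inv_le_inv₀ (zero_lt_iff.2 (inv_ne_zero hx0)) (pow_pos uniformizer_pos l)).2 hl.le⟩
  refine ⟨n, le_antisymm hn ?_⟩
  by_contra hlt
  have hlt' : valuation E x * (uniformizer E ^ n)⁻¹ < 1 := by
    rw [← div_eq_mul_inv, div_lt_one₀ (zpow_pos uniformizer_pos n)]
    exact not_le.1 hlt
  have h2 := le_uniformizer_iff.2 hlt'
  rw [← div_eq_mul_inv, div_le_iff₀ (zpow_pos uniformizer_pos n), ← zpow_one_add₀ hu] at h2
  have := hmax _ h2
  omega

lemma mem_primePow_iff_of_valuation_eq {x : E} {n m : ℤ}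
    (h : valuation E x = uniformizer E ^ n) : x ∈ primePow E m ↔ m ≤ n := by
  rw [mem_primePow, h, uniformizer_zpow_le_iff]

lemma valuation_eq_of_mem_of_notMem {x : E} {n : ℤ} (h : x ∈ primePow E n)
    (h' : x ∉ primePow E (n + 1)) : valuation E x = uniformizer E ^ n := by
  have hx : x ≠ 0 := by rintro rfl; exact h' (zero_mem _)
  obtain ⟨m, hm⟩ := exists_valuation_eq_zpow hx
  rw [mem_primePow_iff_of_valuation_eq hm] at h h'
  rw [hm]; congr 1; omega

lemma isCompact_primePow (n : ℤ) : IsCompact (primePow E n : Set E) :=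
  IsNonarchimedeanLocalField.isCompact_closedBall E _

/-- Criterion for convergence to `0`: eventually in every fractional ideal. -/
lemma tendsto_zero_of_eventually_mem {ι : Type*} {l : Filter ι} {f : ι → E}
    (h : ∀ n : ℕ, ∀ᶠ x in l, f x ∈ primePow E n) : Filter.Tendsto f l (𝓝 0) := by
  refine ((IsValuativeTopology.hasBasis_nhds_zero' E).tendsto_right_iff).2 fun γ hγ => ?_
  obtain ⟨n, hn⟩ := exists_pow_lt₀ (uniformizer_lt_one (R := E)) (Units.mk0 γ hγ)
  filter_upwards [h n] with x hx
  rw [mem_primePow, zpow_natCast] at hx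
  exact hx.trans_lt hn

instance t2Space_of_isNonarchimedeanLocalField : T2Space E := by
  let := IsTopologicalAddGroup.rightUniformSpace E
  have := isUniformAddGroup_of_addCommGroup (G := E)
  infer_instance

end LocalField

/-! ### The involution of an unramified quadratic extension -/

section Quadratic

open ValuativeRel Topology

variable {F E : Type*} [Field F] [Field E] [Algebra F E]

lemma conj_conj_of_finrank_eq_two (hquad : Module.finrank F E = 2) (conj : E ≃ₐ[F] E)
    (hconj : conj ≠ AlgEquiv.refl) (x : E) : conj (conj x) = x := by
  have : FiniteDimensional F E := Module.finite_of_finrank_eq_succ hquad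
  classical
  have hcard : Fintype.card (E ≃ₐ[F] E) ≤ 2 := hquad ▸ AlgEquiv.card_le
  by_contra hne
  have h1 : conj * conj ≠ 1 := fun h => hne (congrArg (fun f : E ≃ₐ[F] E => f x) h)
  have h2 : conj * conj ≠ conj := fun h => hconj (mul_eq_left.1 h)
  have h3 : ({1, conj, conj * conj} : Finset (E ≃ₐ[F] E)).card = 3 :=
    Finset.card_eq_three.2 ⟨_, _, _, fun h => hconj h.symm, h1.symm, h2.symm, rfl⟩
  have := Finset.card_le_univ ({1, conj, conj * conj} : Finset (E ≃ₐ[F] E))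
  omega

lemma mem_range_algebraMap_of_conj_eq (hquad : Module.finrank F E = 2) (conj : E ≃ₐ[F] E)
    (hconj : conj ≠ AlgEquiv.refl) {x : E} (hx : conj x = x) : x ∈ Set.range (algebraMap F E) := by
  have : FiniteDimensional F E := Module.finite_of_finrank_eq_succ hquad
  classical
  have hcard : Fintype.card (E ≃ₐ[F] E) ≤ 2 := hquad ▸ AlgEquiv.card_le
  have h2 : ({1, conj} : Finset (E ≃ₐ[F] E)).card = 2 :=
    Finset.card_eq_two.2 ⟨_, _, fun h => hconj h.symm, rfl⟩
  have huniv : ({1, conj} : Finset (E ≃ₐ[F] E)) = Finset.univ :=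
    Finset.eq_univ_of_card _ (le_antisymm (Finset.card_le_univ _) (h2 ▸ hcard))
  have hgal : IsGalois F E := IsGalois.of_card_aut_eq_finrank F E (by
    rw [hquad, Nat.card_eq_fintype_card, ← Finset.card_univ, ← huniv, h2])
  refine (IsGalois.mem_range_algebraMap_iff_fixed x).2 fun f => ?_
  have hf : f ∈ ({1, conj} : Finset (E ≃ₐ[F] E)) := huniv ▸ Finset.mem_univ f
  rcases Finset.mem_insert.1 hf with rfl | hf
  · rfl
  · rw [Finset.mem_singleton.1 hf, hx]

variable [ValuativeRel F] [TopologicalSpace F] [IsNonarchimedeanLocalField F]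
  [ValuativeRel E] [TopologicalSpace E] [IsNonarchimedeanLocalField E] [ValuativeExtension F E]

lemma valuation_algebraMap_le_iff {a b : F} :
    valuation E (algebraMap F E a) ≤ valuation E (algebraMap F E b) ↔
      valuation F a ≤ valuation F b := by
  rw [← (valuation E).vle_iff_le, ← (valuation F).vle_iff_le, ValuativeExtension.vle_iff_vle]

lemma valuation_algebraMap_lt_iff {a b : F} :
    valuation E (algebraMap F E a) < valuation E (algebraMap F E b) ↔
      valuation F a < valuation F b := by
  rw [← not_le, valuation_algebraMap_le_iff, not_le]

lemma continuous_algebraMap_of_valuativeExtension {ϖ : Fˣ}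
    (hϖ : valuation E (algebraMap F E ϖ) = uniformizer E) : Continuous (algebraMap F E) := by
  refine continuous_of_continuousAt_zero (algebraMap F E) ?_
  rw [ContinuousAt, map_zero]
  refine tendsto_zero_of_eventually_mem fun n => ?_
  have hn : valuation F ((ϖ : F) ^ n) ≠ 0 := by simp
  refine (IsValuativeTopology.hasBasis_nhds_zero' F).eventually_iff.2 ⟨_, hn, fun x hx => ?_⟩
  rw [mem_primePow, zpow_natCast, ← hϖ, ← map_pow, ← map_pow, valuation_algebraMap_le_iff]
  exact le_of_lt hx

/-- The conjugate of an element of the maximal ideal is integral. Otherwise the traces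
`tₖ = yᵏ + ȳᵏ ∈ F` would satisfy `tₖ₊₁ / tₖ → ȳ`, so that `ȳ ∈ F` by completeness of `F`. -/
lemma valuation_conj_le_one (hquad : Module.finrank F E = 2) (conj : E ≃ₐ[F] E)
    (hconj : conj ≠ AlgEquiv.refl) {ϖ : Fˣ}
    (hϖ : valuation E (algebraMap F E ϖ) = uniformizer E) {y : E} (hy : valuation E y < 1) :
    valuation E (conj y) ≤ 1 := by
  by_contra hlt
  rw [not_le] at hlt
  have hcc := conj_conj_of_finrank_eq_two hquad conj hconj
  -- the trace of `yⁿ`, of the same valuation as `ȳⁿ` for `n > 0`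
  have hex : ∀ n : ℕ, ∃ s : F, algebraMap F E s = y ^ n + conj y ^ n := fun n =>
    mem_range_algebraMap_of_conj_eq hquad conj hconj (by
      rw [map_add, map_pow, map_pow, hcc, add_comm])
  choose s hs using hex
  have hyne : conj y ≠ 0 := by
    intro h
    rw [h, map_zero] at hlt
    exact not_lt_zero hlt
  have hvne : valuation E (conj y) ≠ 0 := by simpa using hyne
  have hv : ∀ n : ℕ, valuation E (algebraMap F E (s (n + 1))) = valuation E (conj y) ^ (n + 1) := by
    intro n
    have hlt2 : valuation E (y ^ (n + 1)) < valuation E (conj y ^ (n + 1)) := by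
      rw [map_pow, map_pow]
      exact pow_lt_pow_left₀ (hy.trans hlt) zero_le (Nat.succ_ne_zero n)
    rw [hs, Valuation.map_add_eq_of_lt_right _ hlt2, map_pow]
  have hsne : ∀ n : ℕ, algebraMap F E (s (n + 1)) ≠ 0 := fun n h => by
    have := hv n
    rw [h, map_zero] at this
    exact pow_ne_zero _ hvne this.symm
  set r : ℕ → F := fun n => s (n + 2) / s (n + 1) with hr
  have hvr : ∀ n, valuation E (algebraMap F E (r n)) = valuation E (conj y) := by
    intro n
    rw [hr, map_div₀, map_div₀, hv, hv, pow_succ, mul_div_cancel_left₀ _ (pow_ne_zero _ hvne)]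
  -- the quotients of consecutive traces stay in the compact image of a closed ball of `F`
  set C : Set E := algebraMap F E '' {x | valuation F x ≤ valuation F (r 0)} with hC
  have hCc : IsClosed C := ((IsNonarchimedeanLocalField.isCompact_closedBall F _).image
    (continuous_algebraMap_of_valuativeExtension hϖ)).isClosed
  have hlim : Filter.Tendsto (fun n => algebraMap F E (r n)) Filter.atTop (𝓝 (conj y)) := by
    rw [← tendsto_sub_nhds_zero_iff]
    refine tendsto_zero_of_eventually_mem fun m => ?_
    have hγ : uniformizer E ^ m * (valuation E (conj y))⁻¹ ≠ 0 :=
      mul_ne_zero (pow_ne_zero _ uniformizer_ne_zero) (inv_ne_zero hvne)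
    obtain ⟨N, hN⟩ := exists_pow_lt₀ hy (Units.mk0 _ hγ)
    refine Filter.eventually_atTop.2 ⟨N, fun n hn => ?_⟩
    have h1 : algebraMap F E (r n) - conj y = y ^ (n + 1) * (y - conj y) /
        algebraMap F E (s (n + 1)) := by
      rw [hr, map_div₀, eq_div_iff (hsne n), sub_mul, div_mul_cancel₀ _ (hsne n), hs, hs]
      ring
    have h2 : valuation E (y - conj y) = valuation E (conj y) := by
      rw [Valuation.map_sub_eq_of_lt_right]
      exact hy.trans hlt
    rw [mem_primePow, h1, map_div₀, map_mul, h2, hv, map_pow, zpow_natCast,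
      div_le_iff₀ (zero_lt_iff.2 (pow_ne_zero _ hvne))]
    calc valuation E y ^ (n + 1) * valuation E (conj y)
        ≤ valuation E y ^ N * valuation E (conj y) := by
          exact mul_le_mul' (pow_le_pow_right_of_le_one' hy.le (by omega)) le_rfl
      _ ≤ uniformizer E ^ m * (valuation E (conj y))⁻¹ * valuation E (conj y) := by
          gcongr
          exact hN.le
      _ = uniformizer E ^ m := inv_mul_cancel_right₀ hvne _
      _ ≤ uniformizer E ^ m * valuation E (conj y) ^ (n + 1) :=
          le_mul_of_one_le_right' (one_le_pow_of_one_le' hlt.le _)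
  obtain ⟨x, -, hx⟩ := hCc.mem_of_tendsto hlim (Filter.Eventually.of_forall fun n =>
    ⟨r n, valuation_algebraMap_le_iff.1 ((hvr n).trans (hvr 0).symm).le, rfl⟩)
  have : y = conj y := (hcc y).symm.trans (by rw [← hx, conj.commutes])
  rw [← this] at hlt
  exact lt_asymm hy hlt

lemma valuation_conj (hquad : Module.finrank F E = 2) (conj : E ≃ₐ[F] E)
    (hconj : conj ≠ AlgEquiv.refl) {ϖ : Fˣ}
    (hϖ : valuation E (algebraMap F E ϖ) = uniformizer E) (x : E) :
    valuation E (conj x) = valuation E x := by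
  have hu : uniformizer E ≠ 0 := uniformizer_ne_zero
  -- `e² ϖ` lies in the maximal ideal, so `ē² ϖ` is integral, which excludes `v(ē) ≥ v(ϖ)⁻¹`
  have hle : ∀ e : E, valuation E e = 1 → valuation E (conj e) ≤ 1 := by
    intro e he
    by_contra hlt
    rw [not_le] at hlt
    have h1 := valuation_conj_le_one hquad conj hconj hϖ (y := e ^ 2 * algebraMap F E ϖ)
      (by rw [map_mul, map_pow, he, hϖ, one_pow, one_mul]; exact uniformizer_lt_one)
    rw [map_mul, map_pow, conj.commutes, map_mul, map_pow, hϖ] at h1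
    have h2 := uniformizer_inv_le_iff.2 hlt
    have h3 : 1 < valuation E (conj e) ^ 2 * uniformizer E := by
      calc (1 : ValueGroupWithZero E) < valuation E (conj e) := hlt
        _ = valuation E (conj e) * ((uniformizer E)⁻¹ * uniformizer E) := by
          rw [inv_mul_cancel₀ hu, mul_one]
        _ ≤ valuation E (conj e) * (valuation E (conj e) * uniformizer E) := by gcongr
        _ = _ := by rw [pow_two, mul_assoc]
    exact absurd h1 (not_le.2 h3)
  rcases eq_or_ne x 0 with rfl | hx
  · simp
  obtain ⟨n, hn⟩ := exists_valuation_eq_zpow hx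
  set e : E := x * algebraMap F E ϖ ^ (-n) with he
  have hve : valuation E e = 1 := by
    rw [he, map_mul, map_zpow₀, hn, hϖ, ← zpow_add₀ hu, add_neg_cancel, zpow_zero]
  have hve' : valuation E e⁻¹ = 1 := by rw [map_inv₀, hve, inv_one]
  have hce : valuation E (conj e) = 1 := by
    refine le_antisymm (hle e hve) ?_
    have h := hle _ hve'
    rw [map_inv₀, map_inv₀] at h
    have hne : valuation E (conj e) ≠ 0 := by
      have : e ≠ 0 := by rintro h0; rw [h0, map_zero] at hve; exact zero_ne_one hve
      simpa using this
    rwa [inv_le_one₀ (zero_lt_iff.2 hne)] at h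
  have hπ : algebraMap F E ϖ ≠ 0 := by simp
  have hx : x = e * algebraMap F E ϖ ^ n := by
    rw [he, mul_assoc, ← zpow_add₀ hπ, neg_add_cancel, zpow_zero, mul_one]
  rw [hn, hx, map_mul, map_zpow₀, conj.commutes, map_mul, hce, map_zpow₀, hϖ, one_mul]

/-- The properties of the unramified quadratic extension `E / F` that the structure theory of
`U(2,1)` uses: the conjugation is an isometric involution with an anti-invariant unit, `ϖ ∈ F` is
a uniformizer of `E`, and the residue characteristic `p` is odd. -/
structure IsUnramifiedDatum (p : ℕ) (conj : E ≃ₐ[F] E) (ϖ : Fˣ) : Prop where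
  conj_conj : ∀ x, conj (conj x) = x
  valuation_conj : ∀ x, valuation E (conj x) = valuation E x
  valuation_pi : valuation E (algebraMap F E ϖ) = uniformizer E
  exists_unit : ∃ δ : E, valuation E δ = 1 ∧ δ + conj δ = 0
  prime : p.Prime
  ne_two : p ≠ 2
  mem_p : (p : E) ∈ primePow E 1

lemma isUnramifiedDatum (hquad : Module.finrank F E = 2) (p : ℕ) [hp' : Fact p.Prime]
    (hp : p ≠ 2) [CharP 𝓀[F] p] (conj : E ≃ₐ[F] E) (hconj : conj ≠ AlgEquiv.refl) (ϖ : Fˣ)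
    (hϖ : valuation E (algebraMap F E ϖ) = uniformizer E) : IsUnramifiedDatum p conj ϖ where
  conj_conj := conj_conj_of_finrank_eq_two hquad conj hconj
  valuation_conj := valuation_conj hquad conj hconj hϖ
  valuation_pi := hϖ
  exists_unit := by
    obtain ⟨y, hy⟩ : ∃ y, conj y ≠ y := by
      by_contra! h
      exact hconj (AlgEquiv.ext h)
    have hne : y - conj y ≠ 0 := sub_ne_zero.2 hy.symm
    obtain ⟨n, hn⟩ := exists_valuation_eq_zpow hne
    refine ⟨(y - conj y) * algebraMap F E ϖ ^ (-n), ?_, ?_⟩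
    · rw [map_mul, map_zpow₀, hn, hϖ, ← zpow_add₀ uniformizer_ne_zero, add_neg_cancel, zpow_zero]
    · rw [map_mul, map_sub, map_zpow₀, conj.commutes,
        conj_conj_of_finrank_eq_two hquad conj hconj]
      ring
  prime := hp'.out
  ne_two := hp
  mem_p := by
    have h : IsLocalRing.residue 𝒪[F] (p : 𝒪[F]) = 0 := by
      rw [map_natCast, CharP.cast_eq_zero]
    rw [IsLocalRing.residue_eq_zero_iff, IsLocalRing.mem_maximalIdeal, mem_nonunits_iff,
      (Valuation.integer.integers (valuation F)).isUnit_iff_valuation_eq_one] at h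
    have h1 : valuation F (p : F) < valuation F 1 := by
      rw [map_one]
      exact lt_of_le_of_ne (p : 𝒪[F]).2 h
    rw [← valuation_algebraMap_lt_iff (E := E), map_natCast, map_one, map_one] at h1
    rw [mem_primePow, zpow_one]
    exact le_uniformizer_iff.2 h1

end Quadratic

/-! ### Matrix entries of elements of the unitary group -/

section Entries

open ValuativeRel Topology

variable {F E : Type*} [Field F] [Field E] [Algebra F E] {conj : E ≃ₐ[F] E} {ϖ : Fˣ}

local notation "π" => algebraMap F E ϖ

lemma hermForm_apply (conj : E ≃ₐ[F] E) (v w : Fin 3 → E) :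
    hermForm conj v w = v 0 * conj (w 2) + v 1 * conj (w 1) + v 2 * conj (w 0) := by
  simp [hermForm, dotProduct, Matrix.mulVec, Fin.sum_univ_three]

@[simp] lemma val_mul_apply (g h : U21 conj) : (g * h).1.1 = g.1.1 * h.1.1 := rfl

lemma U21_ext {g h : U21 conj} (H : g.1.1 = h.1.1) : g = h := Subtype.ext (Units.ext H)

/-- The columns of a unitary matrix satisfy the relations of the standard basis. -/
lemma column_relation (g : U21 conj) (a b : Fin 3) :
    g.1.1 0 a * conj (g.1.1 2 b) + g.1.1 1 a * conj (g.1.1 1 b) + g.1.1 2 a * conj (g.1.1 0 b) =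
      if a = b.rev then 1 else 0 := by
  have h := g.2 (Pi.single a 1) (Pi.single b 1)
  rw [hermForm_apply, hermForm_apply] at h
  simp only [Matrix.mulVec_single_one, Matrix.col_apply] at h
  rw [h]
  fin_cases a <;> fin_cases b <;> simp [Fin.rev]

/-- A matrix whose columns satisfy the relations of the standard basis is unitary. -/
lemma exists_U21 (M : Matrix (Fin 3) (Fin 3) E)
    (hM : ∀ a b : Fin 3, M 0 a * conj (M 2 b) + M 1 a * conj (M 1 b) + M 2 a * conj (M 0 b) =
      if a = b.rev then 1 else 0) : ∃ g : U21 conj, g.1.1 = M := by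
  have h1 : (Matrix.of fun a b : Fin 3 => conj (M b.rev a.rev)) * M = 1 := by
    ext a b
    rw [Matrix.mul_apply, Fin.sum_univ_three, Matrix.one_apply]
    have h := hM b a.rev
    rw [Fin.rev_rev] at h
    rw [show (if a = b then (1 : E) else 0) = if b = a then 1 else 0 by simp [eq_comm], ← h]
    simp only [Matrix.of_apply, show (0 : Fin 3).rev = 2 from rfl, show (1 : Fin 3).rev = 1 from rfl,
      show (2 : Fin 3).rev = 0 from rfl]
    ring
  refine ⟨⟨⟨M, _, mul_eq_one_comm.1 h1, h1⟩, fun v w => ?_⟩, rfl⟩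
  rw [hermForm_apply, hermForm_apply]
  have h00 := hM 0 0
  have h01 := hM 0 1
  have h02 := hM 0 2
  have h10 := hM 1 0
  have h11 := hM 1 1
  have h12 := hM 1 2
  have h20 := hM 2 0
  have h21 := hM 2 1
  have h22 := hM 2 2
  simp [Fin.rev] at h00 h01 h02 h10 h11 h12 h20 h21 h22
  simp only [Matrix.mulVec, dotProduct, Fin.sum_univ_three, map_add, map_mul]
  linear_combination v 0 * conj (w 0) * h00 + v 0 * conj (w 1) * h01 + v 0 * conj (w 2) * h02 +
    v 1 * conj (w 0) * h10 + v 1 * conj (w 1) * h11 + v 1 * conj (w 2) * h12 +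
    v 2 * conj (w 0) * h20 + v 2 * conj (w 1) * h21 + v 2 * conj (w 2) * h22

/-- The inverse of a unitary matrix `g` is `β ḡᵀ β`. -/
lemma val_inv_apply (g : U21 conj) (a b : Fin 3) :
    (g⁻¹).1.1 a b = conj (g.1.1 b.rev a.rev) := by
  have h1 : (Matrix.of fun a b : Fin 3 => conj (g.1.1 b.rev a.rev)) * g.1.1 = 1 := by
    ext a b
    rw [Matrix.mul_apply, Fin.sum_univ_three, Matrix.one_apply]
    have h := column_relation g b a.rev
    rw [Fin.rev_rev] at h
    rw [show (if a = b then (1 : E) else 0) = if b = a then 1 else 0 by simp [eq_comm], ← h]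
    simp only [Matrix.of_apply, show (0 : Fin 3).rev = 2 from rfl, show (1 : Fin 3).rev = 1 from rfl,
      show (2 : Fin 3).rev = 0 from rfl]
    ring
  have h2 : g.1.1 * (g⁻¹).1.1 = 1 := g.1.mul_inv
  have h3 := congrArg (fun M => M * (g⁻¹).1.1) h1
  simp only [mul_assoc, h2, mul_one, one_mul] at h3
  rw [← h3, Matrix.of_apply]

lemma row_relation (hc : ∀ x, conj (conj x) = x) (g : U21 conj) (a b : Fin 3) :
    g.1.1 a 0 * conj (g.1.1 b 2) + g.1.1 a 1 * conj (g.1.1 b 1) + g.1.1 a 2 * conj (g.1.1 b 0) =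
      if a = b.rev then 1 else 0 := by
  have h := column_relation g⁻¹ b.rev a.rev
  simp only [val_inv_apply, Fin.rev_rev, hc, show (0 : Fin 3).rev = 2 from rfl,
    show (1 : Fin 3).rev = 1 from rfl, show (2 : Fin 3).rev = 0 from rfl] at h
  rw [show (if a = b.rev then (1 : E) else 0) = if b.rev = a then 1 else 0 by simp [eq_comm], ← h]
  ring

/-- `g` is the lower triangular unipotent matrix with parameters `x`, `y`; being unitary forces
`y + ȳ + x x̄ = 0`. -/
def IsLower (g : U21 conj) (x y : E) : Prop := g.1.1 = !![1, 0, 0; x, 1, 0; y, -conj x, 1]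

/-- `g` is the upper triangular unipotent matrix with parameters `x`, `y`. -/
def IsUpper (g : U21 conj) (x y : E) : Prop := g.1.1 = !![1, x, y; 0, 1, -conj x; 0, 0, 1]

/-- `g` is the diagonal matrix with parameters `a`, `b`. -/
def IsDiag (g : U21 conj) (a b : E) : Prop := g.1.1 = !![a, 0, 0; 0, b, 0; 0, 0, (conj a)⁻¹]

lemma exists_isLower (hc : ∀ x, conj (conj x) = x) {x y : E} (h : y + conj y + x * conj x = 0) :
    ∃ g : U21 conj, IsLower g x y := by
  refine exists_U21 _ fun a b => ?_
  fin_cases a <;> fin_cases b <;> simp [Fin.rev, hc]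
  linear_combination h

lemma exists_isUpper (hc : ∀ x, conj (conj x) = x) {x y : E} (h : y + conj y + x * conj x = 0) :
    ∃ g : U21 conj, IsUpper g x y := by
  refine exists_U21 _ fun a b => ?_
  fin_cases a <;> fin_cases b <;> simp [Fin.rev, hc]
  linear_combination h

lemma IsLower.relation {g : U21 conj} {x y : E} (h : IsLower g x y) :
    y + conj y + x * conj x = 0 := by
  have h0 := column_relation g 0 0
  rw [h] at h0
  simp [Fin.rev] at h0
  linear_combination h0

lemma IsUpper.relation (hc : ∀ x, conj (conj x) = x) {g : U21 conj} {x y : E}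
    (h : IsUpper g x y) : y + conj y + x * conj x = 0 := by
  have h0 := column_relation g 2 2
  rw [h] at h0
  simp [Fin.rev, hc] at h0
  linear_combination h0

lemma exists_weyl (conj : E ≃ₐ[F] E) (ϖ : Fˣ) (m : ℤ) : ∃ g : U21 conj,
    g.1.1 = !![0, 0, (algebraMap F E ϖ ^ m)⁻¹; 0, 1, 0; algebraMap F E ϖ ^ m, 0, 0] :=
  exists_U21 _ fun a b => by
    have h : algebraMap F E ϖ ^ m ≠ 0 := zpow_ne_zero _ (by simp)
    fin_cases a <;> fin_cases b <;> simp [Fin.rev, h]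

/-- The antidiagonal element with entries `ϖ⁻ᵐ, 1, ϖᵐ`. -/
def weyl (conj : E ≃ₐ[F] E) (ϖ : Fˣ) (m : ℤ) : U21 conj := (exists_weyl conj ϖ m).choose

lemma weyl_val (m : ℤ) : (weyl conj ϖ m).1.1 = !![0, 0, (π ^ m)⁻¹; 0, 1, 0; π ^ m, 0, 0] :=
  (exists_weyl conj ϖ m).choose_spec

lemma weyl_mul_weyl (m : ℤ) : weyl conj ϖ m * weyl conj ϖ m = 1 := by
  have h : π ^ m ≠ 0 := zpow_ne_zero _ (by simp)
  refine U21_ext ?_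
  rw [val_mul_apply, weyl_val]
  ext a b
  fin_cases a <;> fin_cases b <;> simp [Matrix.mul_apply, Fin.sum_univ_three, h]

lemma alpha_val : (alpha conj ϖ).1.1 = !![π⁻¹, 0, 0; 0, 1, 0; 0, 0, π] := by
  ext a b
  fin_cases a <;> fin_cases b <;> simp [alpha]

lemma alpha_pow_val (n : ℕ) :
    (alpha conj ϖ ^ n).1.1 = !![(π ^ n)⁻¹, 0, 0; 0, 1, 0; 0, 0, π ^ n] := by
  induction n with
  | zero => ext a b; fin_cases a <;> fin_cases b <;> simp
  | succ n ih =>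
    rw [pow_succ, val_mul_apply, ih, alpha_val]
    ext a b
    fin_cases a <;> fin_cases b <;>
      simp [Matrix.mul_apply, Fin.sum_univ_three, pow_succ, mul_comm]

lemma alpha_zpow_val (m : ℤ) :
    (alpha conj ϖ ^ m).1.1 = !![(π ^ m)⁻¹, 0, 0; 0, 1, 0; 0, 0, π ^ m] := by
  obtain ⟨n, rfl | rfl⟩ := m.eq_nat_or_neg
  · rw [zpow_natCast, alpha_pow_val, zpow_natCast]
  · rw [zpow_neg, zpow_natCast]
    ext a b
    rw [val_inv_apply, alpha_pow_val]
    fin_cases a <;> fin_cases b <;> simp [Fin.rev]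

lemma IsLower.conj_alpha {g : U21 conj} {x y : E} (h : IsLower g x y) (m : ℤ) :
    IsLower (alpha conj ϖ ^ m * g * alpha conj ϖ ^ (-m)) (π ^ m * x) (π ^ (2 * m) * y) := by
  have hπ : π ≠ 0 := by simp
  have hm : π ^ m ≠ 0 := zpow_ne_zero _ hπ
  have h' : g.1.1 = _ := h
  refine Eq.trans (b := _ * g.1.1 * _) rfl ?_
  rw [h', alpha_zpow_val, alpha_zpow_val, two_mul, zpow_add₀ hπ, zpow_neg]
  ext a b
  fin_cases a <;> fin_cases b <;> simp [Matrix.mul_apply, Fin.sum_univ_three, hm]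
  all_goals ring

lemma IsUpper.conj_alpha {g : U21 conj} {x y : E} (h : IsUpper g x y) (m : ℤ) :
    IsUpper (alpha conj ϖ ^ (-m) * g * alpha conj ϖ ^ m) (π ^ m * x) (π ^ (2 * m) * y) := by
  have hπ : π ≠ 0 := by simp
  have hm : π ^ m ≠ 0 := zpow_ne_zero _ hπ
  have h' : g.1.1 = _ := h
  refine Eq.trans (b := _ * g.1.1 * _) rfl ?_
  rw [h', alpha_zpow_val, alpha_zpow_val, two_mul, zpow_add₀ hπ, zpow_neg]
  ext a b
  fin_cases a <;> fin_cases b <;> simp [Matrix.mul_apply, Fin.sum_univ_three, hm]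
  all_goals ring

lemma IsLower.conj_weyl (hc : ∀ x, conj (conj x) = x) {g : U21 conj} {x y : E}
    (h : IsLower g x y) (m : ℤ) :
    IsUpper (weyl conj ϖ m * g * weyl conj ϖ m) (-π ^ (-m) * conj x) (π ^ (-(2 * m)) * y) := by
  have hπ : π ≠ 0 := by simp
  have hm : π ^ m ≠ 0 := zpow_ne_zero _ hπ
  have h' : g.1.1 = _ := h
  refine Eq.trans (b := _ * g.1.1 * _) rfl ?_
  rw [h', weyl_val, zpow_neg, zpow_neg, two_mul, zpow_add₀ hπ]
  ext a b
  fin_cases a <;> fin_cases b <;> simp [Matrix.mul_apply, Fin.sum_univ_three, hm, hc]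
  all_goals ring

lemma IsUpper.conj_weyl (hc : ∀ x, conj (conj x) = x) {g : U21 conj} {x y : E}
    (h : IsUpper g x y) (m : ℤ) :
    IsLower (weyl conj ϖ m * g * weyl conj ϖ m) (-π ^ m * conj x) (π ^ (2 * m) * y) := by
  have hπ : π ≠ 0 := by simp
  have hm : π ^ m ≠ 0 := zpow_ne_zero _ hπ
  have h' : g.1.1 = _ := h
  refine Eq.trans (b := _ * g.1.1 * _) rfl ?_
  rw [h', weyl_val, two_mul, zpow_add₀ hπ]
  ext a b
  fin_cases a <;> fin_cases b <;> simp [Matrix.mul_apply, Fin.sum_univ_three, hm, hc]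
  all_goals ring

lemma weyl_alpha_weyl (m l : ℤ) :
    weyl conj ϖ m * alpha conj ϖ ^ l * weyl conj ϖ m = alpha conj ϖ ^ (-l) := by
  have hπ : π ≠ 0 := by simp
  have hm : π ^ m ≠ 0 := zpow_ne_zero _ hπ
  refine U21_ext ?_
  rw [val_mul_apply, val_mul_apply, weyl_val, alpha_zpow_val, alpha_zpow_val, zpow_neg]
  ext a b
  fin_cases a <;> fin_cases b <;> simp [Matrix.mul_apply, Fin.sum_univ_three]
  all_goals field_simp

lemma alpha_mul_weyl (l m : ℤ) :
    alpha conj ϖ ^ l * weyl conj ϖ m = weyl conj ϖ (l + m) := by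
  have hπ : π ≠ 0 := by simp
  refine U21_ext ?_
  rw [val_mul_apply, weyl_val, weyl_val, alpha_zpow_val, zpow_add₀ hπ]
  ext a b
  fin_cases a <;> fin_cases b <;> simp [Matrix.mul_apply, Fin.sum_univ_three, mul_comm]

lemma IsDiag.conj_weyl (hc : ∀ x, conj (conj x) = x) {g : U21 conj} {a b : E}
    (h : IsDiag g a b) (m : ℤ) :
    IsDiag (weyl conj ϖ m * g * weyl conj ϖ m) (conj a)⁻¹ b := by
  have hm : π ^ m ≠ 0 := zpow_ne_zero _ (by simp)
  have h' : g.1.1 = _ := h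
  refine Eq.trans (b := _ * g.1.1 * _) rfl ?_
  rw [h', weyl_val]
  ext a b
  fin_cases a <;> fin_cases b <;> simp [Matrix.mul_apply, Fin.sum_univ_three, hc]
  all_goals field_simp

lemma IsDiag.commute {g h : U21 conj} {a b a' b' : E} (hg : IsDiag g a b) (hh : IsDiag h a' b') :
    g * h = h * g := by
  refine U21_ext ?_
  rw [val_mul_apply, val_mul_apply, hg, hh]
  ext a b
  fin_cases a <;> fin_cases b <;> simp [Matrix.mul_apply, Fin.sum_univ_three, mul_comm]

lemma isDiag_alpha_zpow (m : ℤ) : IsDiag (alpha conj ϖ ^ m) (π ^ m)⁻¹ 1 := by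
  unfold IsDiag
  rw [alpha_zpow_val]
  simp

lemma IsDiag.mul {g h : U21 conj} {a b a' b' : E} (hg : IsDiag g a b) (hh : IsDiag h a' b') :
    IsDiag (g * h) (a * a') (b * b') := by
  unfold IsDiag at *
  rw [val_mul_apply, hg, hh]
  ext a b
  fin_cases a <;> fin_cases b <;> simp [Matrix.mul_apply, Fin.sum_univ_three, mul_comm]

lemma IsLower.inv (hc : ∀ x, conj (conj x) = x) {g : U21 conj} {x y : E} (h : IsLower g x y) :
    IsLower g⁻¹ (-x) (conj y) := by
  unfold IsLower at *
  ext a b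
  rw [val_inv_apply, h]
  fin_cases a <;> fin_cases b <;> simp [Fin.rev, hc]

lemma IsUpper.inv (hc : ∀ x, conj (conj x) = x) {g : U21 conj} {x y : E} (h : IsUpper g x y) :
    IsUpper g⁻¹ (-x) (conj y) := by
  unfold IsUpper at *
  ext a b
  rw [val_inv_apply, h]
  fin_cases a <;> fin_cases b <;> simp [Fin.rev, hc]

/-- The elements with `x = 0` are central among the lower unipotents. -/
lemma IsLower.commute_of_zero {g h : U21 conj} {x y y' : E} (hg : IsLower g x y)
    (hh : IsLower h 0 y') : h * g = g * h := by
  refine U21_ext ?_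
  rw [val_mul_apply, val_mul_apply, hg, hh]
  ext a b
  fin_cases a <;> fin_cases b <;> simp [Matrix.mul_apply, Fin.sum_univ_three, add_comm]

/-- The elements with `x = 0` are central among the upper unipotents. -/
lemma IsUpper.commute_of_zero {g h : U21 conj} {x y y' : E} (hg : IsUpper g x y)
    (hh : IsUpper h 0 y') : h * g = g * h := by
  refine U21_ext ?_
  rw [val_mul_apply, val_mul_apply, hg, hh]
  ext a b
  fin_cases a <;> fin_cases b <;> simp [Matrix.mul_apply, Fin.sum_univ_three, add_comm]

/-- The big cell: a unitary matrix with nonzero upper left entry is a product of a lower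
unipotent, a diagonal and an upper unipotent one, all with explicit parameters. -/
lemma exists_bigCell (hc : ∀ x, conj (conj x) = x) {g : U21 conj} (hg : g.1.1 0 0 ≠ 0) :
    ∃ l t u : U21 conj, g = l * t * u ∧
      IsLower l (g.1.1 1 0 / g.1.1 0 0) (g.1.1 2 0 / g.1.1 0 0) ∧
      (∃ b, IsDiag t (g.1.1 0 0) b) ∧
      IsUpper u (g.1.1 0 1 / g.1.1 0 0) (g.1.1 0 2 / g.1.1 0 0) := by
  have hg' : conj (g.1.1 0 0) ≠ 0 := by simpa using hg
  obtain ⟨l, hl⟩ := exists_isLower (conj := conj) hc (x := g.1.1 1 0 / g.1.1 0 0)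
    (y := g.1.1 2 0 / g.1.1 0 0) (by
      have h := column_relation g 0 0
      simp [Fin.rev] at h
      rw [map_div₀, map_div₀]
      field_simp
      linear_combination h)
  obtain ⟨u, hu⟩ := exists_isUpper (conj := conj) hc (x := g.1.1 0 1 / g.1.1 0 0)
    (y := g.1.1 0 2 / g.1.1 0 0) (by
      have h := row_relation hc g 0 0
      simp [Fin.rev] at h
      rw [map_div₀, map_div₀]
      field_simp
      linear_combination h)
  have hrel := hl.relation
  have hrel' := hu.relation hc
  rw [map_div₀, map_div₀] at hrel hrel'
  field_simp at hrel hrel'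
  set h := l⁻¹ * g * u⁻¹ with hh
  have hval : h.1.1 = (l⁻¹).1.1 * g.1.1 * (u⁻¹).1.1 := rfl
  have hli := hl.inv hc
  have hui := hu.inv hc
  unfold IsLower at hli
  unfold IsUpper at hui
  rw [hli, hui] at hval
  replace hval : ∀ a b, h.1.1 a b = _ := fun a b => by
    rw [hval]; simp only [Matrix.mul_apply, Fin.sum_univ_three]; rfl
  have h00 : h.1.1 0 0 = g.1.1 0 0 := by
    simp [hval]
  have h10 : h.1.1 1 0 = 0 := by
    simp [hval, hg]
  have h20 : h.1.1 2 0 = 0 := by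
    simp [hval]
    field_simp
    linear_combination hrel
  have h01 : h.1.1 0 1 = 0 := by
    simp [hval]
    field_simp
    ring
  have h02 : h.1.1 0 2 = 0 := by
    simp [hval]
    field_simp
    linear_combination hrel'
  have c12 := column_relation h 0 1
  have c22 := column_relation h 0 2
  have r12 := row_relation hc h 0 1
  simp [Fin.rev, h00, h10, h20, h01, h02, hg] at c12 c22 r12
  refine ⟨l, h, u, by rw [hh]; group, hl, ⟨h.1.1 1 1, ?_⟩, hu⟩
  have h22 : h.1.1 2 2 = (conj (g.1.1 0 0))⁻¹ := by
    have := congrArg conj c22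
    rw [map_mul, hc, map_one] at this
    exact eq_inv_of_mul_eq_one_right this
  unfold IsDiag
  ext a b
  fin_cases a <;> fin_cases b <;> simp [h00, h10, h20, h01, h02, c12, r12, h22]

end Entries

/-! ### Congruence subgroups and the reductive quotient of `K` -/

section Congruence

open ValuativeRel Topology

variable {F E : Type*} [Field F] [Field E] [Algebra F E]
  [ValuativeRel E] [TopologicalSpace E] [IsNonarchimedeanLocalField E]
  {p : ℕ} {conj : E ≃ₐ[F] E} {ϖ : Fˣ} {i : Fin 2}

local notation "π" => algebraMap F E ϖ

lemma IsUnramifiedDatum.valuation_pi_zpow (D : IsUnramifiedDatum p conj ϖ) (m : ℤ) :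
    valuation E (π ^ m) = uniformizer E ^ m := by
  rw [map_zpow₀, D.valuation_pi]

lemma IsUnramifiedDatum.conj_mem (D : IsUnramifiedDatum p conj ϖ) {x : E} {m : ℤ} :
    conj x ∈ primePow E m ↔ x ∈ primePow E m := by
  rw [mem_primePow, mem_primePow, D.valuation_conj]

/-- A bound on the norm `x x̄` bounds `x`, as the conjugation is isometric. -/
lemma IsUnramifiedDatum.mem_of_mul_conj_mem (D : IsUnramifiedDatum p conj ϖ) {x : E} {m n : ℤ}
    (h : x * conj x ∈ primePow E n) (hm : 2 * m - 1 ≤ n) : x ∈ primePow E m := by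
  rcases eq_or_ne x 0 with rfl | hx
  · exact zero_mem _
  obtain ⟨l, hl⟩ := exists_valuation_eq_zpow hx
  have h2 : valuation E (x * conj x) = uniformizer E ^ (l + l) := by
    rw [map_mul, D.valuation_conj, hl, zpow_add₀ uniformizer_ne_zero]
  rw [mem_primePow_iff_of_valuation_eq h2] at h
  rw [mem_primePow_iff_of_valuation_eq hl]
  omega

lemma IsUnramifiedDatum.add_conj_mem (D : IsUnramifiedDatum p conj ϖ) {y x : E} {n : ℤ}
    (h : y + conj y + x * conj x = 0) (hy : y ∈ primePow E n) : x * conj x ∈ primePow E n := by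
  rw [show x * conj x = -(y + conj y) by linear_combination h]
  exact neg_mem (add_mem hy (D.conj_mem.2 hy))

lemma div_mem_of_valuation_eq_one {x y : E} {m : ℤ} (hy : valuation E y = 1) :
    x / y ∈ primePow E m ↔ x ∈ primePow E m := by
  rw [mem_primePow, mem_primePow, map_div₀, hy, div_one]

lemma valuation_eq_one_of_sub_mem {x : E} (h : x - 1 ∈ primePow E 1) : valuation E x = 1 := by
  have h1 : valuation E (x - 1) < 1 :=
    (mem_primePow.1 h).trans_lt (by rw [zpow_one]; exact uniformizer_lt_one)
  have := (valuation E).map_one_add_of_lt h1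
  rwa [add_sub_cancel] at this

lemma valuation_eq_one_of_mem_of_notMem {x : E} (h : x ∈ primePow E 0)
    (h' : x ∉ primePow E 1) : valuation E x = 1 := by
  rw [valuation_eq_of_mem_of_notMem h h', zpow_zero]

lemma mem_primePow_zero_of_valuation_eq_one {x : E} (h : valuation E x = 1) :
    x ∈ primePow E 0 := by
  rw [mem_primePow, h, zpow_zero]

variable {e : Fin 3 → Fin 3 → ℤ} {he : ∀ a b c, e a c ≤ e a b + e b c}

/-- For exponents symmetric about the antidiagonal the condition on `g⁻¹ = β ḡᵀ β` is automatic. -/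
lemma IsUnramifiedDatum.mem_congrSubgroup (D : IsUnramifiedDatum p conj ϖ)
    (hs : ∀ a b, e b.rev a.rev = e a b) {g : U21 conj} :
    g ∈ congrSubgroup conj e he ↔ ∀ a b, (g.1.1 - 1) a b ∈ primePow E (e a b) := by
  refine ⟨fun h => h.1, fun h => ⟨h, fun a b => ?_⟩⟩
  have h1 : ((g⁻¹).1.1 - 1) a b = conj ((g.1.1 - 1) b.rev a.rev) := by
    rw [Matrix.sub_apply, val_inv_apply, Matrix.sub_apply, map_sub]
    congr 1
    fin_cases a <;> fin_cases b <;> simp [Fin.rev]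
  change ((g⁻¹).1.1 - 1) a b ∈ _
  rw [h1, D.conj_mem, ← hs a b]
  exact h _ _

lemma congrSubgroup_le {e' : Fin 3 → Fin 3 → ℤ} {he' : ∀ a b c, e' a c ≤ e' a b + e' b c}
    (h : ∀ a b, e' a b ≤ e a b) : congrSubgroup conj e he ≤ congrSubgroup conj e' he' :=
  fun _ hg => ⟨fun a b => primePow_anti (h a b) (hg.1 a b),
    fun a b => primePow_anti (h a b) (hg.2 a b)⟩

/-- Conjugation by an element whose entries lie in given fractional ideals. -/
lemma mul_mul_mem_congrSubgroup {e' f f' : Fin 3 → Fin 3 → ℤ}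
    {he' : ∀ a b c, e' a c ≤ e' a b + e' b c} {g h n : U21 conj} (hgh : g * h = 1)
    (hg : ∀ a b, g.1.1 a b ∈ primePow E (f a b)) (hh : ∀ a b, h.1.1 a b ∈ primePow E (f' a b))
    (hn : n ∈ congrSubgroup conj e he)
    (hle : ∀ a b c d, e' a d ≤ f a b + e b c + f' c d) :
    g * n * h ∈ congrSubgroup conj e' he' := by
  have key : ∀ m : U21 conj, (∀ a b, (m.1.1 - 1) a b ∈ primePow E (e a b)) → ∀ a d,
      ((g * m * h).1.1 - 1) a d ∈ primePow E (e' a d) := by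
    intro m hm a d
    have h1 : (g * m * h).1.1 - 1 = g.1.1 * (m.1.1 - 1) * h.1.1 := by
      rw [mul_sub, sub_mul, mul_one, ← val_mul_apply g h, hgh]
      rfl
    rw [h1, Matrix.mul_apply]
    refine sum_mem fun c _ => ?_
    rw [Matrix.mul_apply, Finset.sum_mul]
    refine sum_mem fun b _ => ?_
    exact primePow_mul (hle a b c d) (primePow_mul le_rfl (hg a b) (hm b c)) (hh c d)
  refine ⟨key n hn.1, ?_⟩
  have h2 : (g * n * h)⁻¹ = g * n⁻¹ * h := by
    rw [eq_inv_of_mul_eq_one_left hgh]; group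
  have h3 := key n⁻¹ hn.2
  rw [← h2] at h3
  exact h3

lemma IsUnramifiedDatum.isLower_mem (D : IsUnramifiedDatum p conj ϖ)
    (hs : ∀ a b, e b.rev a.rev = e a b) (h2 : 2 * e 1 0 - 1 ≤ e 2 0) {g : U21 conj} {x y : E}
    (hg : IsLower g x y) : g ∈ congrSubgroup conj e he ↔ y ∈ primePow E (e 2 0) := by
  have hg' : g.1.1 = _ := hg
  rw [D.mem_congrSubgroup hs]
  refine ⟨fun h => by simpa [hg'] using h 2 0, fun hy a b => ?_⟩
  have hx : x ∈ primePow E (e 1 0) := D.mem_of_mul_conj_mem (D.add_conj_mem hg.relation hy) h2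
  have hx' : conj x ∈ primePow E (e 2 1) := by
    rw [D.conj_mem, show e 2 1 = e 1 0 from (hs 2 1).symm]; exact hx
  rw [hg']
  fin_cases a <;> fin_cases b <;> simp [hx, hy, hx']

lemma IsUnramifiedDatum.isUpper_mem (D : IsUnramifiedDatum p conj ϖ)
    (hs : ∀ a b, e b.rev a.rev = e a b) (h2 : 2 * e 0 1 - 1 ≤ e 0 2) {g : U21 conj} {x y : E}
    (hg : IsUpper g x y) : g ∈ congrSubgroup conj e he ↔ y ∈ primePow E (e 0 2) := by
  have hg' : g.1.1 = _ := hg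
  rw [D.mem_congrSubgroup hs]
  refine ⟨fun h => by simpa [hg'] using h 0 2, fun hy a b => ?_⟩
  have hx : x ∈ primePow E (e 0 1) :=
    D.mem_of_mul_conj_mem (D.add_conj_mem (hg.relation D.conj_conj) hy) h2
  have hx' : conj x ∈ primePow E (e 1 2) := by
    rw [D.conj_mem, show e 1 2 = e 0 1 from (hs 1 2).symm]; exact hx
  rw [hg']
  fin_cases a <;> fin_cases b <;> simp [hx, hy, hx']

/-! ### The subgroups attached to `K` -/

/-- Exponents for the pro-`p` radical `K¹` of `K`. -/
def expN : Fin 2 → Fin 3 → Fin 3 → ℤ :=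
  ![![![1, 1, 1], ![1, 1, 1], ![1, 1, 1]],
    ![![1, 0, 0], ![1, 1, 0], ![2, 1, 1]]]

/-- The pro-`p` radical `K¹` of `K`, as a subgroup of `G`. -/
def radK (conj : E ≃ₐ[F] E) (i : Fin 2) : Subgroup (U21 conj) :=
  congrSubgroup conj (expN i) (by revert i; decide)

/-- The pro-`p` Iwahori subgroup as a subgroup of `G`. -/
def iwa (conj : E ≃ₐ[F] E) (i : Fin 2) : Subgroup (U21 conj) :=
  congrSubgroup conj (expI i) (by revert i; decide)

/-- The opposite pro-`p` Iwahori subgroup as a subgroup of `G`. -/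
def iwa' (conj : E ≃ₐ[F] E) (i : Fin 2) : Subgroup (U21 conj) :=
  congrSubgroup conj (expI' i) (by revert i; decide)

/-- The diagonal torus of `G`. -/
def torus (conj : E ≃ₐ[F] E) : Subgroup (U21 conj) where
  carrier := {g | ∀ a b, a ≠ b → g.1.1 a b = 0}
  one_mem' a b h := Matrix.one_apply_ne h
  mul_mem' {g h} hg hh a b hab := by
    rw [val_mul_apply, Matrix.mul_apply]
    refine Finset.sum_eq_zero fun c _ => ?_
    rcases eq_or_ne a c with rfl | hac
    · rw [hh _ _ hab, mul_zero]
    · rw [hg _ _ hac, zero_mul]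
  inv_mem' {g} hg a b hab := by
    rw [val_inv_apply, hg _ _ fun h => hab (Fin.rev_injective h).symm, map_zero]

lemma IsDiag.mem_torus {g : U21 conj} {a b : E} (h : IsDiag g a b) : g ∈ torus conj := by
  intro c d hcd
  have h' : g.1.1 = _ := h
  rw [h']
  fin_cases c <;> fin_cases d <;> simp at hcd ⊢

lemma isDiag_of_mem_torus {g : U21 conj} (h : g ∈ torus conj) :
    IsDiag g (g.1.1 0 0) (g.1.1 1 1) := by
  have hg : ∀ a b, a ≠ b → g.1.1 a b = 0 := h
  have h20 := column_relation g 2 0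
  simp [hg 0 2, hg 1 2, hg 1 0, Fin.rev] at h20
  unfold IsDiag
  ext a b
  fin_cases a <;> fin_cases b <;> simp [hg]
  exact eq_inv_of_mul_eq_one_left h20

lemma radK_le_maxK : radK conj i ≤ maxK conj i := congrSubgroup_le (by fin_cases i <;> decide)
lemma iwa_le_maxK : iwa conj i ≤ maxK conj i := congrSubgroup_le (by fin_cases i <;> decide)
lemma iwa'_le_maxK : iwa' conj i ≤ maxK conj i := congrSubgroup_le (by fin_cases i <;> decide)
lemma radK_le_iwa : radK conj i ≤ iwa conj i := congrSubgroup_le (by fin_cases i <;> decide)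
lemma radK_le_iwa' : radK conj i ≤ iwa' conj i := congrSubgroup_le (by fin_cases i <;> decide)

lemma apply_mem_of_mem_maxK {g : U21 conj} (hg : g ∈ maxK conj i) (a b : Fin 3) :
    g.1.1 a b ∈ primePow E (expK i a b) := by
  have h := add_mem (hg.1 a b) (?_ : (1 : Matrix (Fin 3) (Fin 3) E) a b ∈ primePow E (expK i a b))
  · simpa using h
  rw [Matrix.one_apply]
  split_ifs with hab
  · subst hab
    rw [mem_primePow, map_one, show expK i a a = 0 by fin_cases i <;> fin_cases a <;> rfl, zpow_zero]
  · exact zero_mem _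

lemma IsUnramifiedDatum.mem_maxK (D : IsUnramifiedDatum p conj ϖ) {g : U21 conj} :
    g ∈ maxK conj i ↔ ∀ a b, g.1.1 a b ∈ primePow E (expK i a b) := by
  refine ⟨apply_mem_of_mem_maxK, fun h => ?_⟩
  unfold maxK
  rw [D.mem_congrSubgroup (by fin_cases i <;> decide)]
  intro a b
  refine sub_mem (h a b) ?_
  exact (apply_mem_of_mem_maxK (one_mem (maxK conj i)) a b)

lemma valuation_corner_of_iwa {g : U21 conj} (hg : g ∈ iwa conj i) : valuation E (g.1.1 0 0) = 1 := by
  refine valuation_eq_one_of_sub_mem ?_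
  have := hg.1 0 0
  change (g.1.1 - 1) 0 0 ∈ _ at this
  simp only [Matrix.sub_apply, Matrix.one_apply_eq] at this
  revert this; fin_cases i <;> exact id

lemma valuation_corner_of_iwa' {g : U21 conj} (hg : g ∈ iwa' conj i) : valuation E (g.1.1 0 0) = 1 := by
  refine valuation_eq_one_of_sub_mem ?_
  have := hg.1 0 0
  change (g.1.1 - 1) 0 0 ∈ _ at this
  simp only [Matrix.sub_apply, Matrix.one_apply_eq] at this
  revert this; fin_cases i <;> exact id

section Mem

variable (D : IsUnramifiedDatum p conj ϖ) {g : U21 conj} {x y : E}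
include D

lemma IsUnramifiedDatum.isLower_mem_maxK (hg : IsLower g x y) :
    g ∈ maxK conj i ↔ y ∈ primePow E (i : ℕ) := by
  unfold maxK
  rw [D.isLower_mem (by fin_cases i <;> decide) (by fin_cases i <;> decide) hg]
  fin_cases i <;> rfl

lemma IsUnramifiedDatum.isLower_mem_iwa' (hg : IsLower g x y) :
    g ∈ iwa' conj i ↔ y ∈ primePow E (i : ℕ) := by
  unfold iwa'
  rw [D.isLower_mem (by fin_cases i <;> decide) (by fin_cases i <;> decide) hg]
  fin_cases i <;> rfl

lemma IsUnramifiedDatum.isLower_mem_radK (hg : IsLower g x y) :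
    g ∈ radK conj i ↔ y ∈ primePow E (1 + (i : ℕ)) := by
  unfold radK
  rw [D.isLower_mem (by fin_cases i <;> decide) (by fin_cases i <;> decide) hg]
  fin_cases i <;> rfl

lemma IsUnramifiedDatum.isUpper_mem_maxK (hg : IsUpper g x y) :
    g ∈ maxK conj i ↔ y ∈ primePow E (-(i : ℕ)) := by
  unfold maxK
  rw [D.isUpper_mem (by fin_cases i <;> decide) (by fin_cases i <;> decide) hg]
  fin_cases i <;> rfl

lemma IsUnramifiedDatum.isUpper_mem_iwa (hg : IsUpper g x y) :
    g ∈ iwa conj i ↔ y ∈ primePow E (-(i : ℕ)) := by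
  unfold iwa
  rw [D.isUpper_mem (by fin_cases i <;> decide) (by fin_cases i <;> decide) hg]
  fin_cases i <;> rfl

lemma IsUnramifiedDatum.isUpper_mem_radK (hg : IsUpper g x y) :
    g ∈ radK conj i ↔ y ∈ primePow E (1 - (i : ℕ)) := by
  unfold radK
  rw [D.isUpper_mem (by fin_cases i <;> decide) (by fin_cases i <;> decide) hg]
  fin_cases i <;> rfl

lemma IsUnramifiedDatum.torus_inf_iwa_le (hg : g ∈ torus conj) (h : g ∈ iwa conj i) :
    g ∈ radK conj i := by
  have hab := isDiag_of_mem_torus hg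
  have hab' : g.1.1 = _ := hab
  unfold radK
  rw [D.mem_congrSubgroup (by fin_cases i <;> decide)]
  intro c d
  have hcd := h.1 c d
  change (g.1.1 - 1) c d ∈ _ at hcd
  rw [hab'] at hcd ⊢
  revert hcd
  clear hab hab' h
  fin_cases i <;> fin_cases c <;> fin_cases d <;> simp [expI, expN]

lemma IsUnramifiedDatum.torus_inf_iwa'_le (hg : g ∈ torus conj) (h : g ∈ iwa' conj i) :
    g ∈ radK conj i := by
  have hab := isDiag_of_mem_torus hg
  have hab' : g.1.1 = _ := hab
  unfold radK
  rw [D.mem_congrSubgroup (by fin_cases i <;> decide)]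
  intro c d
  have hcd := h.1 c d
  change (g.1.1 - 1) c d ∈ _ at hcd
  rw [hab'] at hcd ⊢
  revert hcd
  clear hab hab' h
  fin_cases i <;> fin_cases c <;> fin_cases d <;> simp [expI', expN]

lemma IsUnramifiedDatum.weyl_apply_mem (a b : Fin 3) :
    (weyl conj ϖ (i : ℕ)).1.1 a b ∈
      primePow E (![![9, 9, -((i : ℕ) : ℤ)], ![9, 0, 9], ![((i : ℕ) : ℤ), 9, 9]] a b) := by
  rw [weyl_val, ← zpow_neg]
  have h1 := (D.valuation_pi_zpow ((i : ℕ) : ℤ)).le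
  have h2 := (D.valuation_pi_zpow (-((i : ℕ) : ℤ))).le
  fin_cases a <;> fin_cases b <;> simp [mem_primePow, h1, h2, -zpow_neg, -zpow_natCast, -map_zpow₀]

lemma IsUnramifiedDatum.weyl_mem_maxK : weyl conj ϖ (i : ℕ) ∈ maxK conj i := by
  rw [D.mem_maxK]
  exact fun a b => primePow_anti (by fin_cases i <;> fin_cases a <;> fin_cases b <;> decide) (D.weyl_apply_mem a b)

lemma IsUnramifiedDatum.diag_apply_mem (hg : g ∈ torus conj) (hK : g ∈ maxK conj i)
    (a b : Fin 3) :
    g.1.1 a b ∈ primePow E (![![0, 9, 9], ![9, 0, 9], ![9, 9, 0]] a b) := by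
  have h' : g.1.1 = _ := isDiag_of_mem_torus hg
  have h2 := apply_mem_of_mem_maxK hK a b
  rw [h'] at h2 ⊢
  revert h2
  fin_cases i <;> fin_cases a <;> fin_cases b <;> simp [expK]

lemma IsUnramifiedDatum.radK_conj (hK : g ∈ maxK conj i) {n : U21 conj} (hn : n ∈ radK conj i) :
    g * n * g⁻¹ ∈ radK conj i :=
  mul_mul_mem_congrSubgroup (mul_inv_cancel g) (apply_mem_of_mem_maxK hK)
    (apply_mem_of_mem_maxK (inv_mem hK)) hn (by fin_cases i <;> decide)

lemma IsUnramifiedDatum.torus_conj_iwa (hg : g ∈ torus conj) (hK : g ∈ maxK conj i)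
    {n : U21 conj} (hn : n ∈ iwa conj i) : g * n * g⁻¹ ∈ iwa conj i :=
  mul_mul_mem_congrSubgroup (mul_inv_cancel g) (D.diag_apply_mem hg hK)
    (D.diag_apply_mem (inv_mem hg) (inv_mem hK)) hn (by fin_cases i <;> decide)

lemma IsUnramifiedDatum.torus_conj_iwa' (hg : g ∈ torus conj) (hK : g ∈ maxK conj i)
    {n : U21 conj} (hn : n ∈ iwa' conj i) : g * n * g⁻¹ ∈ iwa' conj i :=
  mul_mul_mem_congrSubgroup (mul_inv_cancel g) (D.diag_apply_mem hg hK)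
    (D.diag_apply_mem (inv_mem hg) (inv_mem hK)) hn (by fin_cases i <;> decide)

lemma IsUnramifiedDatum.weyl_conj_iwa (hg : g ∈ iwa conj i) :
    weyl conj ϖ (i : ℕ) * g * weyl conj ϖ (i : ℕ) ∈ iwa' conj i :=
  mul_mul_mem_congrSubgroup (weyl_mul_weyl _) D.weyl_apply_mem D.weyl_apply_mem hg
    (by fin_cases i <;> decide)

lemma IsUnramifiedDatum.weyl_conj_iwa' (hg : g ∈ iwa' conj i) :
    weyl conj ϖ (i : ℕ) * g * weyl conj ϖ (i : ℕ) ∈ iwa conj i :=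
  mul_mul_mem_congrSubgroup (weyl_mul_weyl _) D.weyl_apply_mem D.weyl_apply_mem hg
    (by fin_cases i <;> decide)

/-- The big cell in `K`. -/
lemma IsUnramifiedDatum.exists_bigCell_of_unit (hg : g ∈ maxK conj i)
    (h0 : valuation E (g.1.1 0 0) = 1) :
    ∃ l t u : U21 conj, g = l * t * u ∧ l ∈ iwa' conj i ∧ t ∈ torus conj ∧ t ∈ maxK conj i ∧
      u ∈ iwa conj i ∧ IsLower l (g.1.1 1 0 / g.1.1 0 0) (g.1.1 2 0 / g.1.1 0 0) ∧
      IsUpper u (g.1.1 0 1 / g.1.1 0 0) (g.1.1 0 2 / g.1.1 0 0) := by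
  have hne : g.1.1 0 0 ≠ 0 := fun h => by simp [h] at h0
  obtain ⟨l, t, u, rfl, hl, ⟨b, ht⟩, hu⟩ := exists_bigCell D.conj_conj hne
  have hl' : l ∈ iwa' conj i := by
    rw [D.isLower_mem_iwa' hl, div_mem_of_valuation_eq_one h0]
    have := apply_mem_of_mem_maxK hg 2 0
    revert this; fin_cases i <;> exact id
  have hu' : u ∈ iwa conj i := by
    rw [D.isUpper_mem_iwa hu, div_mem_of_valuation_eq_one h0]
    have := apply_mem_of_mem_maxK hg 0 2
    revert this; fin_cases i <;> exact id
  refine ⟨l, t, u, rfl, hl', ht.mem_torus, ?_, hu', hl, hu⟩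
  have : t = l⁻¹ * (l * t * u) * u⁻¹ := by group
  rw [this]
  exact mul_mem (mul_mem (inv_mem (iwa'_le_maxK hl')) hg) (inv_mem (iwa_le_maxK hu'))

lemma IsUnramifiedDatum.corner_dichotomy (hg : g ∈ maxK conj i) :
    valuation E (g.1.1 0 0) = 1 ∨ (g.1.1 0 0 ∈ primePow E 1 ∧
      valuation E (g.1.1 2 0) = uniformizer E ^ ((i : ℕ) : ℤ)) := by
  have hm := apply_mem_of_mem_maxK hg
  by_cases h : g.1.1 0 0 ∈ primePow E 1
  swap
  · refine Or.inl (valuation_eq_one_of_mem_of_notMem ?_ h)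
    have := hm 0 0
    revert this; fin_cases i <;> exact id
  refine Or.inr ⟨h, ?_⟩
  have m20 : g.1.1 2 0 ∈ primePow E ((i : ℕ) : ℤ) := by
    have := hm 2 0
    revert this; fin_cases i <;> exact id
  have m02 : g.1.1 0 2 ∈ primePow E (-((i : ℕ) : ℤ)) := by
    have := hm 0 2
    revert this; fin_cases i <;> exact id
  have m12 : g.1.1 1 2 ∈ primePow E 0 := by
    have := hm 1 2
    revert this; fin_cases i <;> exact id
  have m22 : g.1.1 2 2 ∈ primePow E 0 := by
    have := hm 2 2
    revert this; fin_cases i <;> exact id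
  have h00 := column_relation g 0 0
  have h02 := column_relation g 0 2
  simp only [Fin.rev, Fin.isValue] at h00 h02
  simp at h00 h02
  have m10 : g.1.1 1 0 ∈ primePow E 1 := by
    refine D.mem_of_mul_conj_mem (n := 1 + (i : ℕ)) ?_ (by omega)
    rw [show g.1.1 1 0 * conj (g.1.1 1 0) =
      -(g.1.1 0 0 * conj (g.1.1 2 0) + g.1.1 2 0 * conj (g.1.1 0 0)) by linear_combination h00]
    exact neg_mem (add_mem (primePow_mul le_rfl h (D.conj_mem.2 m20))
      (primePow_mul (by omega) m20 (D.conj_mem.2 h)))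
  refine valuation_eq_of_mem_of_notMem m20 fun hlt => ?_
  have h1 : (1 : E) ∈ primePow E 1 := by
    rw [← h02]
    exact add_mem (add_mem (primePow_mul (by omega) h (D.conj_mem.2 m22))
      (primePow_mul (by omega) m10 (D.conj_mem.2 m12)))
      (primePow_mul (by omega) hlt (D.conj_mem.2 m02))
  rw [mem_primePow, map_one, zpow_one] at h1
  exact absurd uniformizer_lt_one (not_lt.2 h1)

/-- The small cell in `K`. -/
lemma IsUnramifiedDatum.exists_smallCell (hg : g ∈ maxK conj i)
    (h0 : valuation E (g.1.1 0 0) ≠ 1) :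
    ∃ n t u : U21 conj, g = weyl conj ϖ (i : ℕ) * n * t * u ∧ n ∈ radK conj i ∧
      t ∈ torus conj ∧ t ∈ maxK conj i ∧ u ∈ iwa conj i := by
  obtain ⟨h1, h2⟩ := (D.corner_dichotomy hg).resolve_left h0
  have hu : uniformizer E ≠ 0 := uniformizer_ne_zero
  have hi : valuation E (π ^ ((i : ℕ) : ℤ)) = uniformizer E ^ ((i : ℕ) : ℤ) :=
    D.valuation_pi_zpow ((i : ℕ) : ℤ)
  set g' := weyl conj ϖ (i : ℕ) * g with hg'
  have e00 : g'.1.1 0 0 = (π ^ ((i : ℕ) : ℤ))⁻¹ * g.1.1 2 0 := by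
    rw [hg', val_mul_apply, weyl_val, Matrix.mul_apply, Fin.sum_univ_three]
    simp
  have e20 : g'.1.1 2 0 = π ^ ((i : ℕ) : ℤ) * g.1.1 0 0 := by
    rw [hg', val_mul_apply, weyl_val, Matrix.mul_apply, Fin.sum_univ_three]
    simp
  have v00 : valuation E (g'.1.1 0 0) = 1 := by
    rw [e00, map_mul, map_inv₀, hi, h2, inv_mul_cancel₀ (zpow_ne_zero _ hu)]
  obtain ⟨l, t, u, h, -, htT, htK, huA, hl, -⟩ :=
    D.exists_bigCell_of_unit (mul_mem D.weyl_mem_maxK hg) v00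
  refine ⟨l, t, u, ?_, ?_, htT, htK, huA⟩
  · rw [mul_assoc, mul_assoc, ← mul_assoc l, ← h, ← mul_assoc, weyl_mul_weyl, one_mul]
  · rw [D.isLower_mem_radK hl, div_mem_of_valuation_eq_one v00, e20]
    exact primePow_mul (by omega) hi.le h1

/-- An element of the pro-`p` Iwahori subgroup lies in `K¹` as soon as its upper right entry does. -/
lemma IsUnramifiedDatum.mem_radK_of_iwa (hg : g ∈ iwa conj i)
    (h : g.1.1 0 2 ∈ primePow E (1 - (i : ℕ))) : g ∈ radK conj i := by
  have hm := apply_mem_of_mem_maxK (iwa_le_maxK hg)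
  have m00 : g.1.1 0 0 ∈ primePow E 0 := by
    have := hm 0 0
    revert this; fin_cases i <;> exact id
  have m22 : g.1.1 2 2 ∈ primePow E 0 := by
    have := hm 2 2
    revert this; fin_cases i <;> exact id
  have r := row_relation D.conj_conj g 0 0
  have c := column_relation g 2 2
  simp [Fin.rev] at r c
  have m01 : g.1.1 0 1 ∈ primePow E (1 - (i : ℕ)) := by
    refine D.mem_of_mul_conj_mem (n := 1 - (i : ℕ)) ?_ (by omega)
    rw [show g.1.1 0 1 * conj (g.1.1 0 1) =
      -(g.1.1 0 0 * conj (g.1.1 0 2) + g.1.1 0 2 * conj (g.1.1 0 0)) by linear_combination r]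
    exact neg_mem (add_mem (primePow_mul (by omega) m00 (D.conj_mem.2 h))
      (primePow_mul (by omega) h (D.conj_mem.2 m00)))
  have m12 : g.1.1 1 2 ∈ primePow E (1 - (i : ℕ)) := by
    refine D.mem_of_mul_conj_mem (n := 1 - (i : ℕ)) ?_ (by omega)
    rw [show g.1.1 1 2 * conj (g.1.1 1 2) =
      -(g.1.1 0 2 * conj (g.1.1 2 2) + g.1.1 2 2 * conj (g.1.1 0 2)) by linear_combination c]
    exact neg_mem (add_mem (primePow_mul (by omega) h (D.conj_mem.2 m22))
      (primePow_mul (by omega) m22 (D.conj_mem.2 h)))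
  unfold radK
  rw [D.mem_congrSubgroup (by fin_cases i <;> decide)]
  intro a b
  have hab := hg.1 a b
  change (g.1.1 - 1) a b ∈ _ at hab
  rw [Matrix.sub_apply] at hab ⊢
  revert hab h m01 m12
  fin_cases i <;> fin_cases a <;> fin_cases b <;> simp [expI, expN] <;> intros <;> assumption

lemma IsUnramifiedDatum.exists_iwa_notMem :
    ∃ u y, IsUpper (conj := conj) u 0 y ∧ u ∈ iwa conj i ∧ u ∉ radK conj i := by
  obtain ⟨δ, hδ, hδ'⟩ := D.exists_unit
  obtain ⟨u, hu⟩ := exists_isUpper (conj := conj) D.conj_conj (x := 0)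
    (y := δ * π ^ (-(i : ℕ) : ℤ)) (by simp; linear_combination (π ^ (i : ℕ))⁻¹ * hδ')
  have hv : valuation E (δ * π ^ (-(i : ℕ) : ℤ)) = uniformizer E ^ (-(i : ℕ) : ℤ) := by
    rw [map_mul, hδ, one_mul, D.valuation_pi_zpow]
  refine ⟨u, _, hu, ?_, ?_⟩
  · rw [D.isUpper_mem_iwa hu, mem_primePow_iff_of_valuation_eq hv]
  · rw [D.isUpper_mem_radK hu, mem_primePow_iff_of_valuation_eq hv]
    omega

lemma IsUnramifiedDatum.iwa_mul_weyl (hg : g ∈ iwa conj i) (h : g ∉ radK conj i) :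
    ∃ l t u : U21 conj, g * weyl conj ϖ (i : ℕ) = l * t * u ∧ l ∈ iwa' conj i ∧
      t ∈ torus conj ∧ t ∈ maxK conj i ∧ u ∈ iwa conj i := by
  have hu : uniformizer E ≠ 0 := uniformizer_ne_zero
  have h02 : valuation E (g.1.1 0 2) = uniformizer E ^ (-(i : ℕ) : ℤ) := by
    refine valuation_eq_of_mem_of_notMem ?_ fun h' => h (D.mem_radK_of_iwa hg ?_)
    · have := apply_mem_of_mem_maxK (iwa_le_maxK hg) 0 2
      revert this; fin_cases i <;> exact id
    · rwa [show (1 : ℤ) - (i : ℕ) = -(i : ℕ) + 1 by ring]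
  have e00 : (g * weyl conj ϖ (i : ℕ)).1.1 0 0 = g.1.1 0 2 * π ^ ((i : ℕ) : ℤ) := by
    rw [val_mul_apply, weyl_val, Matrix.mul_apply, Fin.sum_univ_three]
    simp
  obtain ⟨l, t, u, h, h1, h2, h3, h4, -⟩ :=
    D.exists_bigCell_of_unit (mul_mem (iwa_le_maxK hg) D.weyl_mem_maxK) (by
      rw [e00, map_mul, h02, D.valuation_pi_zpow, ← zpow_add₀ hu, neg_add_cancel, zpow_zero])
  exact ⟨l, t, u, h, h1, h2, h3, h4⟩

/-- `I_{1,K}` is generated by `K¹` and the upper unipotents of `K`. -/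
lemma IsUnramifiedDatum.iwa_decomp (hg : g ∈ iwa conj i) :
    ∃ n u : U21 conj, g = n * u ∧ n ∈ radK conj i ∧ u ∈ iwa conj i ∧ ∃ x y, IsUpper u x y := by
  have v00 := valuation_corner_of_iwa (i := i) hg
  obtain ⟨l, t, u, rfl, h1, h2, h3, h4, h5, h6⟩ :=
    D.exists_bigCell_of_unit (iwa_le_maxK hg) v00
  have hl : l ∈ radK conj i := by
    rw [D.isLower_mem_radK h5, div_mem_of_valuation_eq_one v00]
    have := hg.1 2 0
    change ((l * t * u).1.1 - 1) 2 0 ∈ _ at this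
    rw [Matrix.sub_apply, Matrix.one_apply_ne (by decide), sub_zero] at this
    revert this; fin_cases i <;> exact id
  refine ⟨l * t, u, rfl, mul_mem hl (D.torus_inf_iwa_le h2 ?_), h4, _, _, h6⟩
  have : t = l⁻¹ * (l * t * u) * u⁻¹ := by group
  rw [this]
  exact mul_mem (mul_mem (inv_mem (radK_le_iwa hl)) hg) (inv_mem h4)

/-- `I'_{1,K}` is generated by `K¹` and the lower unipotents of `K`. -/
lemma IsUnramifiedDatum.iwa'_decomp (hg : g ∈ iwa' conj i) :
    ∃ l n : U21 conj, g = l * n ∧ n ∈ radK conj i ∧ l ∈ iwa' conj i ∧ ∃ x y, IsLower l x y := by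
  have v00 := valuation_corner_of_iwa' (i := i) hg
  obtain ⟨l, t, u, rfl, h1, h2, h3, h4, h5, h6⟩ :=
    D.exists_bigCell_of_unit (iwa'_le_maxK hg) v00
  have hu : u ∈ radK conj i := by
    rw [D.isUpper_mem_radK h6, div_mem_of_valuation_eq_one v00]
    have := hg.1 0 2
    change ((l * t * u).1.1 - 1) 0 2 ∈ _ at this
    rw [Matrix.sub_apply, Matrix.one_apply_ne (by decide), sub_zero] at this
    revert this; fin_cases i <;> exact id
  refine ⟨l, t * u, by group, mul_mem (D.torus_inf_iwa'_le h2 ?_) hu, h1, _, _, h5⟩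
  have : t = l⁻¹ * (l * t * u) * u⁻¹ := by group
  rw [this]
  exact mul_mem (mul_mem (inv_mem h1) hg) (inv_mem (radK_le_iwa' hu))

end Mem

end Congruence

/-! ### Topology of `G`: compactness of `K` and powers in the pro-`p` Iwahori subgroup -/

section RingPower

/-- If `ϖ` is central and divides `p` and `xᵖ`, then `(1 + x)^(p^m)` is `1` modulo `ϖᵐ`. -/
lemma exists_one_add_pow_prime_pow {R : Type*} [Ring R] {p : ℕ} (hp : p.Prime) {ϖ x c z : R}
    (hϖ : ∀ y, Commute ϖ y) (hc : (p : R) = ϖ * c) (hz : x ^ p = ϖ * z) (m : ℕ) :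
    ∃ y, (1 + x) ^ p ^ (m + 1) = 1 + ϖ ^ (m + 1) * y := by
  induction m with
  | zero =>
    obtain ⟨r, hr⟩ := (Commute.one_left x).exists_add_pow_prime_eq hp
    refine ⟨z + c * x * r, ?_⟩
    rw [zero_add, pow_one, hr, hc, hz, pow_one]
    simp only [one_pow, mul_one]
    noncomm_ring
  | succ m ih =>
    obtain ⟨y, hy⟩ := ih
    obtain ⟨r, hr⟩ := (Commute.one_left (ϖ ^ (m + 1) * y)).exists_add_pow_prime_eq hp
    obtain ⟨q, hq⟩ : ∃ q, (m + 1) * p = (m + 1 + 1) + q :=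
      Nat.exists_eq_add_of_le (by nlinarith [hp.two_le])
    have h1 : (ϖ ^ (m + 1) * y) ^ p = ϖ ^ (m + 1 + 1) * (ϖ ^ q * y ^ p) := by
      rw [((hϖ y).pow_left _).mul_pow, ← pow_mul, hq, pow_add, mul_assoc]
    have h2 : (p : R) * 1 * (ϖ ^ (m + 1) * y) * r = ϖ ^ (m + 1 + 1) * (c * y * r) := by
      rw [hc, mul_one, pow_succ' ϖ (m + 1)]
      rw [show ϖ * c * (ϖ ^ (m + 1) * y) = ϖ * (c * ϖ ^ (m + 1)) * y by noncomm_ring,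
        ← ((hϖ c).pow_left (m + 1)).eq]
      simp only [mul_assoc]
    refine ⟨ϖ ^ q * y ^ p + c * y * r, ?_⟩
    rw [pow_succ p, pow_mul, hy, hr, h1, h2, one_pow, mul_add, add_assoc]

end RingPower

section TopGroup

open ValuativeRel Topology

variable {F E : Type*} [Field F] [Field E] [Algebra F E]
  [ValuativeRel E] [TopologicalSpace E] [IsNonarchimedeanLocalField E]
  {p : ℕ} {conj : E ≃ₐ[F] E} {ϖ : Fˣ} {i : Fin 2}

local notation "π" => algebraMap F E ϖ

lemma IsUnramifiedDatum.continuous_conj (D : IsUnramifiedDatum p conj ϖ) : Continuous conj := by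
  refine continuous_of_continuousAt_zero conj ?_
  rw [ContinuousAt, map_zero]
  refine tendsto_zero_of_eventually_mem fun n => ?_
  filter_upwards [(isOpen_primePow (E := E) n).mem_nhds (zero_mem (primePow E n))] with x hx
  exact D.conj_mem.2 hx

lemma IsUnramifiedDatum.tendsto_one (D : IsUnramifiedDatum p conj ϖ) {ι : Type*} {l : Filter ι}
    {f : ι → U21 conj} (h : ∀ n : ℕ, ∀ᶠ x in l, ∀ a b, ((f x).1.1 - 1) a b ∈ primePow E n) :
    Filter.Tendsto f l (𝓝 1) := by
  have key : ∀ f : ι → Matrix (Fin 3) (Fin 3) E,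
      (∀ n : ℕ, ∀ᶠ x in l, ∀ a b, (f x - 1) a b ∈ primePow E n) →
        Filter.Tendsto f l (𝓝 1) := by
    intro f hf
    refine tendsto_pi_nhds.2 fun a => tendsto_pi_nhds.2 fun b => ?_
    have h0 : Filter.Tendsto (fun x => (f x - 1) a b) l (𝓝 0) :=
      tendsto_zero_of_eventually_mem fun n => (hf n).mono fun x hx => hx a b
    have h1 := h0.add_const ((1 : Matrix (Fin 3) (Fin 3) E) a b)
    simpa using h1
  rw [IsEmbedding.subtypeVal.tendsto_nhds_iff, Units.isEmbedding_embedProduct.tendsto_nhds_iff]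
  refine Filter.Tendsto.prodMk_nhds (key _ h) ?_
  refine (MulOpposite.continuous_op.tendsto 1).comp (key (fun x => ((f x)⁻¹).1.1) fun n => ?_)
  filter_upwards [h n] with x hx a b
  have h1 : (((f x)⁻¹).1.1 - 1) a b = conj (((f x).1.1 - 1) b.rev a.rev) := by
    rw [Matrix.sub_apply, val_inv_apply, Matrix.sub_apply, map_sub]
    congr 1
    fin_cases a <;> fin_cases b <;> simp [Fin.rev]
  rw [h1, D.conj_mem]
  exact hx _ _

lemma IsUnramifiedDatum.isClosed_U21 (D : IsUnramifiedDatum p conj ϖ) :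
    IsClosed (U21 conj : Set (GL (Fin 3) E)) := by
  have hcont := D.continuous_conj
  have : (U21 conj : Set (GL (Fin 3) E)) = ⋂ v : Fin 3 → E, ⋂ w : Fin 3 → E,
      {g : GL (Fin 3) E | hermForm conj (g.1.mulVec v) (g.1.mulVec w) = hermForm conj v w} := by
    ext g
    simp only [Set.mem_iInter]
    rfl
  rw [this]
  refine isClosed_iInter fun v => isClosed_iInter fun w => isClosed_eq ?_ continuous_const
  simp only [hermForm_apply, Matrix.mulVec, dotProduct, Fin.sum_univ_three]
  have hval : ∀ a b, Continuous fun g : GL (Fin 3) E => g.1 a b := fun a b =>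
    (Units.continuous_val (M := Matrix (Fin 3) (Fin 3) E)).matrix_elem a b
  fun_prop

lemma IsUnramifiedDatum.isCompact_maxK (D : IsUnramifiedDatum p conj ϖ) :
    IsCompact (maxK conj i : Set (U21 conj)) := by
  have hemb : IsClosedEmbedding fun g : U21 conj =>
      Units.embedProduct (Matrix (Fin 3) (Fin 3) E) g.1 :=
    Units.isClosedEmbedding_embedProduct.comp D.isClosed_U21.isClosedEmbedding_subtypeVal
  set C : Set (Matrix (Fin 3) (Fin 3) E) :=
    Set.univ.pi fun a => Set.univ.pi fun b => primePow E (expK i a b) with hC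
  have hCc : IsCompact C :=
    isCompact_univ_pi fun a => isCompact_univ_pi fun b => isCompact_primePow _
  have hop : IsCompact (MulOpposite.op '' C) := hCc.image MulOpposite.continuous_op
  refine (hemb.isCompact_preimage (hCc.prod hop)).of_isClosed_subset
    (Subgroup.isClosed_of_isOpen _ (isOpen_maxK conj i)) fun g hg => ?_
  exact ⟨fun a _ b _ => apply_mem_of_mem_maxK hg a b,
    ⟨(g⁻¹).1.1, fun a _ b _ => apply_mem_of_mem_maxK (inv_mem hg) a b, rfl⟩⟩

lemma IsUnramifiedDatum.compactSpace_maxK (D : IsUnramifiedDatum p conj ϖ) :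
    CompactSpace (maxK conj i) := isCompact_iff_compactSpace.1 D.isCompact_maxK

/-- Exponents of the order of matrices which are integral and upper triangular modulo the
maximal ideal, up to conjugation by a diagonal matrix. -/
def expD : Fin 2 → Fin 3 → Fin 3 → ℤ :=
  ![![![0, 0, 0], ![1, 0, 0], ![1, 1, 0]],
    ![![0, 0, -1], ![1, 0, 0], ![2, 1, 0]]]

/-- The order of matrices with exponents `expD`. -/
def iwaOrder (E : Type*) [Field E] [ValuativeRel E] [TopologicalSpace E]
    [IsNonarchimedeanLocalField E] (i : Fin 2) : Subring (Matrix (Fin 3) (Fin 3) E) where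
  carrier := {g | ∀ a b, g a b ∈ primePow E (expD i a b)}
  zero_mem' a b := zero_mem _
  one_mem' a b := by
    rw [Matrix.one_apply]
    split_ifs with hab
    · subst hab
      rw [mem_primePow, map_one, show expD i a a = 0 by fin_cases i <;> fin_cases a <;> rfl,
        zpow_zero]
    · exact zero_mem _
  add_mem' hg hh a b := add_mem (hg a b) (hh a b)
  neg_mem' hg a b := neg_mem (hg a b)
  mul_mem' {g h} hg hh a b := by
    rw [Matrix.mul_apply]
    exact sum_mem fun c _ => primePow_mul
      (by fin_cases i <;> fin_cases a <;> fin_cases b <;> fin_cases c <;> decide) (hg a c) (hh c b)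

/-- The `p`-power sequence of an element of the pro-`p` Iwahori subgroup tends to `1`. -/
lemma IsUnramifiedDatum.tendsto_pow (D : IsUnramifiedDatum p conj ϖ) {g : U21 conj}
    (hg : g ∈ iwa conj i) : Filter.Tendsto (fun m : ℕ => g ^ p ^ m) Filter.atTop (𝓝 1) := by
  have hπ : π ≠ 0 := by simp
  have hv : valuation E π = uniformizer E ^ (1 : ℤ) := by rw [D.valuation_pi, zpow_one]
  have hvi : valuation E π⁻¹ = uniformizer E ^ (-1 : ℤ) := by
    rw [map_inv₀, D.valuation_pi, zpow_neg, zpow_one]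
  set X := g.1.1 - 1 with hX
  have hmX : ∀ a b, X a b ∈ primePow E (expI i a b) := hg.1
  -- the elements of `ϖ iwaOrder` are recognized by their entries
  have hdiv : ∀ M : Matrix (Fin 3) (Fin 3) E,
      (∀ a b, M a b ∈ primePow E (expD i a b + 1)) → ∃ Z : iwaOrder E i, M = π • Z.1 := by
    intro M hM
    refine ⟨⟨π⁻¹ • M, fun a b => ?_⟩, by simp [smul_smul, hπ]⟩
    exact primePow_mul (by omega) hvi.le (hM a b)
  have hscalar : ∀ x : E, x ∈ primePow E 0 → x • (1 : Matrix (Fin 3) (Fin 3) E) ∈ iwaOrder E i :=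
    fun x hx a b => primePow_mul (by omega) hx (one_mem (iwaOrder E i) a b)
  set P : iwaOrder E i := ⟨π • 1, hscalar π (primePow_anti (by omega) hv.le)⟩ with hP
  have hPc : ∀ y, Commute P y := fun y => Subtype.ext (by simp [hP])
  have hPmul : ∀ Z : iwaOrder E i, (P * Z).1 = π • Z.1 := fun Z => by simp [hP]
  have hXD : X ∈ iwaOrder E i := fun a b =>
    primePow_anti (by fin_cases i <;> fin_cases a <;> fin_cases b <;> decide) (hmX a b)
  set x : iwaOrder E i := ⟨X, hXD⟩ with hx
  obtain ⟨c, hc⟩ : ∃ c, ((p : ℕ) : iwaOrder E i) = P * c := by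
    refine ⟨⟨(π⁻¹ * p) • 1, hscalar _ (primePow_mul (by omega) hvi.le D.mem_p)⟩,
      Subtype.ext ?_⟩
    rw [hPmul, smul_smul, mul_inv_cancel_left₀ hπ]
    ext a b
    simp [Matrix.natCast_apply, Matrix.one_apply]
  -- `x` is strictly upper triangular modulo the radical, whence `x³ ∈ ϖ iwaOrder`; and `p ≥ 3`
  obtain ⟨z, hz⟩ : ∃ z, x ^ 3 = P * z := by
    obtain ⟨Z, hZ⟩ := hdiv (X ^ 3) fun a d => by
      rw [pow_succ, pow_two, Matrix.mul_apply]
      refine sum_mem fun c _ => ?_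
      rw [Matrix.mul_apply, Finset.sum_mul]
      refine sum_mem fun b _ => ?_
      refine primePow_mul ?_ (primePow_mul le_rfl (hmX a b) (hmX b c)) (hmX c d)
      revert a b c d
      fin_cases i <;> decide
    exact ⟨Z, Subtype.ext (by rw [hPmul, ← hZ]; rfl)⟩
  have hp3 : 3 ≤ p := by
    have := D.prime.two_le
    have := D.ne_two
    omega
  have key := exists_one_add_pow_prime_pow D.prime hPc hc
    (z := z * x ^ (p - 3)) (by rw [← mul_assoc, ← hz, ← pow_add, Nat.add_sub_cancel' hp3])
  refine D.tendsto_one fun n => ?_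
  filter_upwards [Filter.eventually_ge_atTop (n + 2)] with m hm a b
  obtain ⟨m, rfl⟩ : ∃ m', m = m' + 1 := ⟨m - 1, by omega⟩
  obtain ⟨y, hy⟩ := key m
  have h1 : (g ^ p ^ (m + 1)).1.1 = ((1 + x) ^ p ^ (m + 1) : iwaOrder E i).1 := by
    have h2 : ((1 + x : iwaOrder E i)).1 = g.1.1 := by simp [hx, hX]
    exact congrArg (· ^ p ^ (m + 1)) h2.symm
  have h3 : ∀ k : ℕ, (P ^ k * y).1 = π ^ k • y.1 := by
    intro k
    induction k with
    | zero => simp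
    | succ k ih => rw [pow_succ', mul_assoc, hPmul, ih, smul_smul, pow_succ']
  have h4 : (g ^ p ^ (m + 1)).1.1 - 1 = π ^ (m + 1) • y.1 := by
    rw [h1, hy, ← h3]; simp
  rw [h4]
  refine primePow_mul (m := (m + 1 : ℕ)) (n := expD i a b) ?_ ?_ (y.2 a b)
  · have : -1 ≤ expD i a b := by fin_cases i <;> fin_cases a <;> fin_cases b <;> decide
    omega
  · rw [mem_primePow, ← zpow_natCast, D.valuation_pi_zpow]

/-- An open subgroup contains a `p`-power of every element of the pro-`p` Iwahori subgroup. -/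
lemma IsUnramifiedDatum.exists_pow_mem (D : IsUnramifiedDatum p conj ϖ) {g : U21 conj}
    (hg : g ∈ iwa conj i) {O : Set (U21 conj)} (hO : IsOpen O) (h1 : 1 ∈ O) :
    ∃ m : ℕ, g ^ p ^ m ∈ O :=
  ((D.tendsto_pow hg).eventually (hO.mem_nhds h1)).exists

end TopGroup

/-! ### Irreducible smooth representations of `K` -/

section Smooth

variable {k H W : Type*} [Field k] [Group H] [TopologicalSpace H] [IsTopologicalGroup H]
  [AddCommGroup W] [Module k W] {σ : Representation k H W}

/-- An irreducible smooth representation of a compact group is finite-dimensional. -/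
lemma finiteDimensional_of_isSmooth [CompactSpace H] (hirr : σ.IsIrreducible)
    (hσ : IsSmooth σ) : FiniteDimensional k W := by
  have := nontrivial_of_isIrreducible hirr
  obtain ⟨v, hv⟩ := exists_ne (0 : W)
  let S : Subgroup H :=
    { carrier := {h | σ h v = v}
      one_mem' := by simp
      mul_mem' := fun {g h} (hg : _ = _) (hh : _ = _) => show _ = _ by
        rw [map_mul, Module.End.mul_apply, hh, hg]
      inv_mem' := fun {g} (hg : _ = _) => show _ = _ by
        conv_lhs => rw [← hg]
        rw [← Module.End.mul_apply, ← map_mul, inv_mul_cancel, map_one, Module.End.one_apply] }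
  have : Finite (H ⧸ S) := Subgroup.quotient_finite_of_isOpen S (hσ v)
  -- the orbit of `v` is finite, as its stabilizer is open
  have hfin : (Set.range fun h => σ h v).Finite := by
    refine (Set.finite_range fun x : H ⧸ S => σ x.out v).subset ?_
    rintro _ ⟨h, rfl⟩
    obtain ⟨n, hn⟩ := QuotientGroup.mk_out_eq_mul S h
    refine ⟨h, ?_⟩
    change σ (h : H ⧸ S).out v = σ h v
    rw [hn, map_mul, Module.End.mul_apply, show σ n v = v from n.2]
  have htop : Submodule.span k (Set.range fun h => σ h v) = ⊤ := by
    refine eq_top_of_isIrreducible hirr _ (fun g x hx => ?_)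
      (Submodule.subset_span ⟨1, by simp⟩) hv
    induction hx using Submodule.span_induction with
    | mem x hx =>
      obtain ⟨h, rfl⟩ := hx
      exact Submodule.subset_span ⟨g * h, by simp⟩
    | zero => simp
    | add x y _ _ hx hy => rw [map_add]; exact add_mem hx hy
    | smul c x _ hx => rw [map_smul]; exact Submodule.smul_mem _ c hx
  exact ⟨htop ▸ Submodule.fg_span hfin⟩

/-- A normal subgroup all of whose elements have `p`-power order modulo open subgroups acts
trivially in characteristic `p`. -/
lemma apply_eq_one_of_normal [CompactSpace H] {p : ℕ} [Fact p.Prime] [CharP k p]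
    (hirr : σ.IsIrreducible) (hσ : IsSmooth σ) (N : Subgroup H) [N.Normal]
    (hN : ∀ n ∈ N, ∀ O : Set H, IsOpen O → 1 ∈ O → ∃ m : ℕ, n ^ p ^ m ∈ O) :
    ∀ n ∈ N, σ n = 1 := by
  have := nontrivial_of_isIrreducible hirr
  have := finiteDimensional_of_isSmooth hirr hσ
  have hopen := isOpen_setOf_apply_eq_one hσ
  let S : Subgroup H := (MonoidHom.toHomUnits σ).ker
  have hS : ∀ h, h ∈ S ↔ σ h = 1 := fun h => by
    rw [MonoidHom.mem_ker, Units.ext_iff]; rfl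
  have hSo : IsOpen (S : Set H) := by
    convert hopen using 1
    ext h; exact hS h
  have : Finite (H ⧸ S) := Subgroup.quotient_finite_of_isOpen S hSo
  have hfin : (Set.range σ).Finite := by
    refine (Set.finite_range fun x : H ⧸ S => σ x.out).subset ?_
    rintro _ ⟨h, rfl⟩
    exact ⟨h, apply_out (fun n hn => (hS n).1 hn) h⟩
  obtain ⟨v, hv0, hv⟩ := exists_ne_zero_fixed (p := p) (σ.comp N.subtype)
    (hfin.subset (by rintro _ ⟨g, rfl⟩; exact ⟨g, rfl⟩)) fun g => hN g g.2 _ hopen (map_one σ)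
  have htop : Representation.invariants (σ.comp N.subtype) = ⊤ := by
    refine eq_top_of_isIrreducible hirr _ (fun g x hx n => ?_) hv hv0
    change σ n (σ g x) = σ g x
    have h1 : (n : H) * g = g * (g⁻¹ * n * g) := by group
    have h2 : g⁻¹ * n * g ∈ N := by
      simpa using (inferInstance : N.Normal).conj_mem n n.2 g⁻¹
    rw [← Module.End.mul_apply, ← map_mul, h1, map_mul, Module.End.mul_apply]
    exact congrArg (σ g) (hx ⟨_, h2⟩)
  intro n hn
  refine LinearMap.ext fun x => ?_
  have hx : x ∈ Representation.invariants (σ.comp N.subtype) := htop ▸ Submodule.mem_top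
  exact hx ⟨n, hn⟩

end Smooth

section Datum

open ValuativeRel Topology

variable {F E : Type*} [Field F] [Field E] [Algebra F E]
  [ValuativeRel E] [TopologicalSpace E] [IsNonarchimedeanLocalField E]
  {p : ℕ} {conj : E ≃ₐ[F] E} {ϖ : Fˣ} {i : Fin 2}

/-- The group `K` with its pro-`p` Iwahori subgroups is a rank one datum. -/
lemma IsUnramifiedDatum.isRankOneDatum (D : IsUnramifiedDatum p conj ϖ) :
    IsRankOneDatum p (proIwahori conj i) (proIwahori' conj i)
      ((torus conj).subgroupOf (maxK conj i)) ((radK conj i).subgroupOf (maxK conj i))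
      ⟨weyl conj ϖ (i : ℕ), D.weyl_mem_maxK⟩ where
  normal := ⟨fun n hn g => D.radK_conj g.2 hn⟩
  finite := by
    have := D.compactSpace_maxK (i := i)
    exact Subgroup.quotient_finite_of_isOpen _
      ((isOpen_congrSubgroup conj (expN i) _).preimage continuous_subtype_val)
  pow_mem a ha := D.exists_pow_mem (i := i) (g := a) ha (isOpen_congrSubgroup conj (expN i) _)
    (one_mem (radK conj i))
  exists_notMem := by
    obtain ⟨u, y, -, h1, h2⟩ := D.exists_iwa_notMem (i := i)
    exact ⟨⟨u, iwa_le_maxK h1⟩, h1, h2⟩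
  w_mul_w := Subtype.ext (weyl_mul_weyl _)
  conj_A a ha := D.weyl_conj_iwa (g := a) ha
  conj_B b hb := D.weyl_conj_iwa' (g := b) hb
  conj_T t ht := ((isDiag_of_mem_torus (conj := conj) (g := t) ht).conj_weyl D.conj_conj _).mem_torus
  comm_T t ht s hs := Subtype.ext
    ((isDiag_of_mem_torus (conj := conj) (g := t) ht).commute (isDiag_of_mem_torus (conj := conj) (g := s) hs))
  normalize_A t ht a ha := D.torus_conj_iwa (g := t) ht t.2 (n := a) ha
  normalize_B t ht a ha := D.torus_conj_iwa' (g := t) ht t.2 (n := a) ha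
  big a ha haN := by
    obtain ⟨l, t, u, h, hl, ht, htK, hu⟩ := D.iwa_mul_weyl (i := i) (g := a) ha haN
    exact ⟨⟨l, iwa'_le_maxK hl⟩, hl, ⟨t, htK⟩, ht, ⟨u, iwa_le_maxK hu⟩, hu, Subtype.ext h⟩
  gen g := by
    by_cases h0 : valuation E (g.1.1.1 0 0) = 1
    · obtain ⟨l, t, u, h, hl, ht, htK, hu, -⟩ := D.exists_bigCell_of_unit g.2 h0
      exact Or.inl ⟨⟨l, iwa'_le_maxK hl⟩, hl, ⟨t, htK⟩, ht, ⟨u, iwa_le_maxK hu⟩, hu, Subtype.ext h⟩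
    · obtain ⟨l, t, u, h, hl, ht, htK, hu⟩ := D.exists_smallCell g.2 h0
      exact Or.inr ⟨⟨l, radK_le_maxK hl⟩, hl, ⟨t, htK⟩, ht, ⟨u, iwa_le_maxK hu⟩, hu, Subtype.ext h⟩

variable {k W : Type*} [Field k] [AddCommGroup W] [Module k W] [Fact p.Prime] [CharP k p]
  {σ : Representation k (maxK conj i) W}

lemma IsUnramifiedDatum.apply_eq_one_of_radK (D : IsUnramifiedDatum p conj ϖ)
    (hirr : σ.IsIrreducible) (hσ : IsSmooth σ) (n : maxK conj i) (hn : n.1 ∈ radK conj i) :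
    σ n = 1 := by
  have := D.compactSpace_maxK (i := i)
  have := (D.isRankOneDatum (i := i)).normal
  refine apply_eq_one_of_normal (p := p) hirr hσ ((radK conj i).subgroupOf (maxK conj i))
    (fun n hn O hO h1 => ?_) n hn
  obtain ⟨m, hm⟩ := D.exists_pow_mem (radK_le_iwa hn)
    ((isOpen_maxK conj i).isOpenMap_subtype_val O hO) ⟨1, h1, rfl⟩
  obtain ⟨x, hx, hxn⟩ := hm
  exact ⟨m, by rwa [← show x = n ^ p ^ m from Subtype.ext hxn]⟩

end Datum

/-! ### The Cartan decomposition -/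

section Cartan

open ValuativeRel Topology

variable {F E : Type*} [Field F] [Field E] [Algebra F E]
  [ValuativeRel E] [TopologicalSpace E] [IsNonarchimedeanLocalField E]
  {p : ℕ} {conj : E ≃ₐ[F] E} {ϖ : Fˣ} {i : Fin 2}

local notation "π" => algebraMap F E ϖ
local notation "α" => alpha conj ϖ

lemma IsUnramifiedDatum.isDiag_mem_maxK (D : IsUnramifiedDatum p conj ϖ) {g : U21 conj} {a b : E}
    (hg : IsDiag g a b) (ha : valuation E a = 1) : g ∈ maxK conj i := by
  have hg' : g.1.1 = _ := hg
  have hb : b ∈ primePow E 0 := by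
    have h := column_relation g 1 1
    rw [hg'] at h
    simp [Fin.rev] at h
    refine D.mem_of_mul_conj_mem (n := 0) ?_ (by norm_num)
    rw [h, mem_primePow, map_one, zpow_zero]
  have ha0 := mem_primePow_zero_of_valuation_eq_one ha
  have ha' : (conj a)⁻¹ ∈ primePow E 0 := by
    rw [mem_primePow, map_inv₀, D.valuation_conj, ha, inv_one, zpow_zero]
  rw [D.mem_maxK, hg']
  intro c d
  fin_cases i <;> fin_cases c <;> fin_cases d <;> simp [expK, ha0, hb, ha']

lemma weyl_mul_apply_zero (g : U21 conj) (m : ℤ) :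
    (weyl conj ϖ m * g).1.1 0 0 = (π ^ m)⁻¹ * g.1.1 2 0 := by
  rw [val_mul_apply, weyl_val, Matrix.mul_apply, Fin.sum_univ_three]
  simp

lemma mul_weyl_apply_zero (g : U21 conj) (m : ℤ) :
    (g * weyl conj ϖ m).1.1 0 0 = g.1.1 0 2 * π ^ m := by
  rw [val_mul_apply, weyl_val, Matrix.mul_apply, Fin.sum_univ_three]
  simp

/-- If the upper left entry of `g` is largest among the (weighted) entries in its row and column
obtained by multiplication by the Weyl element, then `g` lies in `K αᵐ K` for some `m ∈ ℤ`. -/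
lemma IsUnramifiedDatum.exists_zpow_of_maximal (D : IsUnramifiedDatum p conj ϖ) {g : U21 conj}
    (h1 : valuation E ((weyl conj ϖ (i : ℕ) * g).1.1 0 0) ≤ valuation E (g.1.1 0 0))
    (h2 : valuation E ((g * weyl conj ϖ (i : ℕ)).1.1 0 0) ≤ valuation E (g.1.1 0 0)) :
    ∃ m : ℤ, ∃ κ κ' : maxK conj i, g = κ * α ^ m * κ' := by
  have hu : uniformizer E ≠ 0 := uniformizer_ne_zero
  have hπ : π ^ ((i : ℕ) : ℤ) ≠ 0 := zpow_ne_zero _ (by simp)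
  rw [weyl_mul_apply_zero, map_mul, map_inv₀, D.valuation_pi_zpow] at h1
  rw [mul_weyl_apply_zero, map_mul, D.valuation_pi_zpow] at h2
  have hne : g.1.1 0 0 ≠ 0 := by
    intro h0
    rw [h0, map_zero, le_zero_iff, mul_eq_zero] at h1
    have h20 : g.1.1 2 0 = 0 := by
      rcases h1 with h | h
      · exact absurd h (inv_ne_zero (zpow_ne_zero _ hu))
      · exact (map_eq_zero _).1 h
    have r := column_relation g 0 0
    have r' := column_relation g 0 2
    simp [Fin.rev, h0, h20] at r r'
    simp [r] at r'
  obtain ⟨l, t, u, hg, hl, ⟨b, ht⟩, hu'⟩ := exists_bigCell D.conj_conj hne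
  have hlK : l ∈ maxK conj i := by
    rw [D.isLower_mem_maxK hl, mem_primePow, map_div₀]
    have hv : valuation E (g.1.1 0 0) ≠ 0 := by simpa using hne
    rw [div_le_iff₀ (zero_lt_iff.2 hv)]
    rwa [inv_mul_le_iff₀ (zero_lt_iff.2 (zpow_ne_zero _ hu))] at h1
  have huK : u ∈ maxK conj i := by
    rw [D.isUpper_mem_maxK hu', mem_primePow, map_div₀]
    have hv : valuation E (g.1.1 0 0) ≠ 0 := by simpa using hne
    rw [div_le_iff₀ (zero_lt_iff.2 hv), zpow_neg,
      le_inv_mul_iff₀ (zero_lt_iff.2 (zpow_ne_zero _ hu)), mul_comm]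
    exact h2
  obtain ⟨m, hm⟩ := exists_valuation_eq_zpow hne
  have ht' : IsDiag (α ^ m * t) ((π ^ m)⁻¹ * g.1.1 0 0) (1 * b) := (isDiag_alpha_zpow m).mul ht
  have htK : α ^ m * t ∈ maxK conj i := D.isDiag_mem_maxK ht' (by
    rw [map_mul, map_inv₀, D.valuation_pi_zpow, hm, inv_mul_cancel₀ (zpow_ne_zero _ hu)])
  refine ⟨-m, ⟨l, hlK⟩, ⟨α ^ m * t * u, mul_mem htK huK⟩, ?_⟩
  rw [hg]
  group

/-- The Cartan decomposition `G = ⋃ₙ K αⁿ K`. -/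
lemma IsUnramifiedDatum.exists_mem_cell (D : IsUnramifiedDatum p conj ϖ) (g : U21 conj) :
    ∃ n, g ∈ cell conj ϖ i n := by
  set w := weyl conj ϖ (i : ℕ) with hw
  have hww : w * w = 1 := weyl_mul_weyl _
  have hwK : w ∈ maxK conj i := D.weyl_mem_maxK
  -- choose the one of `g`, `w g`, `g w`, `w g w` with the largest upper left entry
  obtain ⟨⟨a, b⟩, hab⟩ := Finite.exists_max fun q : Fin 2 × Fin 2 =>
    valuation E ((w ^ (q.1 : ℕ) * g * w ^ (q.2 : ℕ)).1.1 0 0)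
  have hl : w * w ^ (a : ℕ) = w ^ ((a + 1 : Fin 2) : ℕ) := by
    fin_cases a <;> simp [hww]
  have hr : w ^ (b : ℕ) * w = w ^ ((b + 1 : Fin 2) : ℕ) := by
    fin_cases b <;> simp [hww]
  obtain ⟨m, κ, κ', h⟩ := D.exists_zpow_of_maximal (i := i) (g := w ^ (a : ℕ) * g * w ^ (b : ℕ))
    (by
      have := hab (a + 1, b)
      simp only [← hl] at this
      simpa only [mul_assoc] using this)
    (by
      have := hab (a, b + 1)
      simp only [← hr] at this
      simpa only [mul_assoc] using this)
  have hcell : ∀ n : ℕ, ∀ κ κ' : maxK conj i, w ^ (a : ℕ) * g * w ^ (b : ℕ) = κ * α ^ n * κ' →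
      g ∈ cell conj ϖ i n := by
    intro n κ κ' h
    refine ⟨⟨(w ^ (a : ℕ))⁻¹, inv_mem (pow_mem hwK _)⟩ * κ,
      κ' * ⟨(w ^ (b : ℕ))⁻¹, inv_mem (pow_mem hwK _)⟩, ?_⟩
    have : g = (w ^ (a : ℕ))⁻¹ * (w ^ (a : ℕ) * g * w ^ (b : ℕ)) * (w ^ (b : ℕ))⁻¹ := by group
    rw [this, h]
    simp only [Subgroup.coe_mul, mul_assoc]
  obtain ⟨n, rfl | rfl⟩ := m.eq_nat_or_neg
  · exact ⟨n, hcell n κ κ' (by rw [h, zpow_natCast])⟩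
  · refine ⟨n, hcell n (κ * ⟨w, hwK⟩) (⟨w, hwK⟩ * κ') ?_⟩
    rw [h, ← weyl_alpha_weyl ((i : ℕ) : ℤ), zpow_natCast]
    simp only [Subgroup.coe_mul, mul_assoc, hw]

lemma IsUnramifiedDatum.le_of_mem_cell (D : IsUnramifiedDatum p conj ϖ) {m n : ℕ}
    (h : α ^ m ∈ cell conj ϖ i n) : m ≤ n := by
  obtain ⟨κ, κ', h⟩ := h
  have h0 := congrArg (fun g : U21 conj => g.1.1 0 0) h
  simp only [val_mul_apply] at h0
  rw [alpha_pow_val, alpha_pow_val, Matrix.mul_apply] at h0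
  have hmem : ((π ^ m)⁻¹ : E) ∈ primePow E (-(n : ℤ)) := by
    have h1 : ((π ^ m)⁻¹ : E) =
        (!![(π ^ m)⁻¹, 0, 0; 0, 1, 0; 0, 0, π ^ m] : Matrix (Fin 3) (Fin 3) E) 0 0 := rfl
    rw [h1, h0]
    refine sum_mem fun c _ => ?_
    rw [Matrix.mul_apply, Finset.sum_mul]
    refine sum_mem fun b _ => ?_
    have hd : (!![(π ^ n)⁻¹, 0, 0; 0, 1, 0; 0, 0, π ^ n] : Matrix (Fin 3) (Fin 3) E) b b ∈
        primePow E (-(n : ℤ)) := by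
      have e1 : ((π ^ n)⁻¹ : E) ∈ primePow E (-(n : ℤ)) := by
        rw [← zpow_natCast, ← zpow_neg]; exact (D.valuation_pi_zpow _).le
      have e2 : (π ^ n : E) ∈ primePow E (-(n : ℤ)) := by
        rw [← zpow_natCast]; exact primePow_anti (by omega) (D.valuation_pi_zpow n).le
      have e3 : (1 : E) ∈ primePow E (-(n : ℤ)) :=
        primePow_anti (m := -(n : ℤ)) (n := 0) (by omega)
          (mem_primePow_zero_of_valuation_eq_one (map_one _))
      fin_cases b <;> simp [e1, e2, e3]
    by_cases hbc : b = c
    · subst hbc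
      have hle : 0 ≤ expK i 0 b + expK i b 0 := by fin_cases i <;> fin_cases b <;> decide
      exact primePow_mul (m := expK i 0 b - n) (n := expK i b 0) (by omega)
        (primePow_mul (by omega) (apply_mem_of_mem_maxK κ.2 0 b) hd)
        (apply_mem_of_mem_maxK κ'.2 b 0)
    · have hz : (!![(π ^ n)⁻¹, 0, 0; 0, 1, 0; 0, 0, π ^ n] : Matrix (Fin 3) (Fin 3) E) b c = 0 := by
        revert hbc
        fin_cases b <;> fin_cases c <;> simp
      rw [hz, mul_zero, zero_mul]
      exact zero_mem _
  have hv : valuation E ((π ^ m)⁻¹ : E) = uniformizer E ^ (-(m : ℤ)) := by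
    rw [← zpow_natCast, ← zpow_neg, D.valuation_pi_zpow]
  rw [mem_primePow_iff_of_valuation_eq hv] at hmem
  omega

lemma mem_cell_comm {m n : ℕ} (h : α ^ m ∈ cell conj ϖ i n) : α ^ n ∈ cell conj ϖ i m := by
  obtain ⟨κ, κ', h⟩ := h
  refine ⟨κ⁻¹, κ'⁻¹, ?_⟩
  rw [h]
  simp only [Subgroup.coe_inv]
  group

/-- The double cosets `K αⁿ K` are distinct. -/
lemma IsUnramifiedDatum.eq_of_mem_cell (D : IsUnramifiedDatum p conj ϖ) {m n : ℕ}
    (h : α ^ m ∈ cell conj ϖ i n) : m = n :=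
  le_antisymm (D.le_of_mem_cell h) (D.le_of_mem_cell (mem_cell_comm h))

lemma alpha_pow_mem_cell (n : ℕ) : α ^ n ∈ cell conj ϖ i n := ⟨1, 1, by simp⟩

lemma mem_cell_zero {g : U21 conj} : g ∈ cell conj ϖ i 0 ↔ g ∈ maxK conj i := by
  constructor
  · rintro ⟨κ, κ', rfl⟩
    rw [pow_zero, mul_one]
    exact mul_mem κ.2 κ'.2
  · intro h
    exact ⟨⟨g, h⟩, 1, by simp⟩

section AlphaConj

variable (D : IsUnramifiedDatum p conj ϖ) {n : ℕ} {x y : E} {g : U21 conj}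
include D

lemma IsUnramifiedDatum.alpha_conj_lower_mem (hg : IsLower g x y) (h : g ∈ iwa' conj i)
    (hn : n ≠ 0) : α ^ n * g * (α ^ n)⁻¹ ∈ radK conj i := by
  have h1 := hg.conj_alpha (ϖ := ϖ) n
  rw [zpow_neg, zpow_natCast] at h1
  rw [D.isLower_mem_radK h1]
  rw [D.isLower_mem_iwa' hg] at h
  exact primePow_mul (by omega) (D.valuation_pi_zpow _).le h

lemma IsUnramifiedDatum.alpha_conj_upper_mem (hg : IsUpper g x y) (h : g ∈ iwa conj i)
    (hn : n ≠ 0) : (α ^ n)⁻¹ * g * α ^ n ∈ radK conj i := by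
  have h1 := hg.conj_alpha (ϖ := ϖ) n
  rw [zpow_neg, zpow_natCast] at h1
  rw [D.isUpper_mem_radK h1]
  rw [D.isUpper_mem_iwa hg] at h
  exact primePow_mul (by omega) (D.valuation_pi_zpow _).le h

/-- If `κ` and `κ' = α⁻ⁿ κ αⁿ` lie in `K` and `n > 0`, then `κ ∈ K¹ T I_{1,K}` and
`κ' ∈ I'_{1,K} T K¹` with the same torus part: both come from the big cell decomposition of `κ`. -/
lemma IsUnramifiedDatum.exists_decomp_of_alpha_conj {κ κ' : U21 conj} (hκ : κ ∈ maxK conj i)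
    (hκ' : κ' ∈ maxK conj i) (h : κ * α ^ n = α ^ n * κ') (hn : n ≠ 0) :
    ∃ l t u l' u' : U21 conj, κ = l * t * u ∧ κ' = l' * t * u' ∧ l ∈ radK conj i ∧
      t ∈ torus conj ∧ t ∈ maxK conj i ∧ u ∈ iwa conj i ∧ l' ∈ iwa' conj i ∧
      u' ∈ radK conj i := by
  have hπ : π ^ n ≠ 0 := pow_ne_zero _ (by simp)
  have e20 : κ.1.1 2 0 = π ^ (2 * (n : ℤ)) * κ'.1.1 2 0 := by
    have h0 := congrArg (fun g : U21 conj => g.1.1 2 0) h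
    simp only [val_mul_apply] at h0
    rw [alpha_pow_val, Matrix.mul_apply, Matrix.mul_apply, Fin.sum_univ_three,
      Fin.sum_univ_three] at h0
    simp at h0
    rw [two_mul, zpow_add₀ (by simp), zpow_natCast, mul_assoc, ← h0]
    field_simp
  have m20 : κ'.1.1 2 0 ∈ primePow E ((i : ℕ) : ℤ) := by
    have := apply_mem_of_mem_maxK hκ' 2 0
    clear e20
    revert this; fin_cases i <;> exact id
  have m20' : κ.1.1 2 0 ∈ primePow E (1 + ((i : ℕ) : ℤ)) := by
    rw [e20]
    exact primePow_mul (by omega) (D.valuation_pi_zpow _).le m20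
  have v00 : valuation E (κ.1.1 0 0) = 1 := by
    refine (D.corner_dichotomy hκ).resolve_right fun h2 => ?_
    rw [mem_primePow_iff_of_valuation_eq h2.2] at m20'
    omega
  obtain ⟨l, t, u, hκe, -, ht, htK, hu, hl, hu'⟩ := D.exists_bigCell_of_unit hκ v00
  refine ⟨l, t, u, (α ^ n)⁻¹ * l * α ^ n, (α ^ n)⁻¹ * u * α ^ n, hκe, ?_, ?_, ht, htK, hu, ?_,
    D.alpha_conj_upper_mem hu' hu hn⟩
  · have hc : α ^ n * t = t * α ^ n := by
      have := (isDiag_alpha_zpow (conj := conj) (ϖ := ϖ) n).commute (isDiag_of_mem_torus ht)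
      rwa [zpow_natCast] at this
    have : κ' = (α ^ n)⁻¹ * (κ * α ^ n) := by rw [h]; group
    rw [this, hκe]
    have h3 : (α ^ n)⁻¹ * l * α ^ n * t * ((α ^ n)⁻¹ * u * α ^ n) =
        (α ^ n)⁻¹ * l * (α ^ n * t) * (α ^ n)⁻¹ * u * α ^ n := by group
    rw [h3, hc]
    group
  · rw [D.isLower_mem_radK hl, div_mem_of_valuation_eq_one v00]
    exact m20'
  · have h1 := hl.conj_alpha (ϖ := ϖ) (-n)
    rw [neg_neg, zpow_neg, zpow_natCast] at h1
    rw [D.isLower_mem_iwa' h1, e20, show (2 : ℤ) * -n = -(2 * n) by ring, zpow_neg,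
      mul_div_assoc, inv_mul_cancel_left₀ (zpow_ne_zero _ (by simp)),
      div_mem_of_valuation_eq_one v00]
    exact m20

end AlphaConj

end Cartan

/-! ### The basis of the Hecke algebra -/

section Values

variable {F E : Type*} [Field F] [Field E] [Algebra F E]
  [ValuativeRel E] [TopologicalSpace E] [IsNonarchimedeanLocalField E]
  {p : ℕ} {conj : E ≃ₐ[F] E} {ϖ : Fˣ} {i : Fin 2}
  {k W : Type*} [Field k] [AddCommGroup W] [Module k W]
  {σ : Representation k (maxK conj i) W}

local notation "α" => alpha conj ϖ

/-- A Hecke function is determined by its values at the `αⁿ`, by the Cartan decomposition. -/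
lemma IsUnramifiedDatum.heckeFun_ext (D : IsUnramifiedDatum p conj ϖ) {φ ψ : heckeFun σ}
    (h : ∀ n, φ.1 (α ^ n) = ψ.1 (α ^ n)) : φ = ψ := by
  refine Subtype.ext (funext fun g => ?_)
  obtain ⟨n, κ, κ', rfl⟩ := D.exists_mem_cell (i := i) g
  rw [heckeFun_bi, heckeFun_bi, h]

lemma IsUnramifiedDatum.apply_alpha_pow_eq_zero (D : IsUnramifiedDatum p conj ϖ)
    {φ : heckeFun σ} {m n : ℕ} (hφ : IsPhi conj ϖ i σ n φ) (hmn : m ≠ n) :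
    φ.1 (α ^ m) = 0 := by
  by_contra h
  exact hmn (D.eq_of_mem_cell (hφ.1 h))

lemma IsUnramifiedDatum.isPhi_unique (D : IsUnramifiedDatum p conj ϖ)
    {φ ψ : heckeFun σ} {n : ℕ} (hφ : IsPhi conj ϖ i σ n φ) (hψ : IsPhi conj ϖ i σ n ψ) :
    ψ = φ := by
  refine D.heckeFun_ext fun m => ?_
  rcases eq_or_ne m n with rfl | hmn
  · rw [hφ.2, hψ.2]
  · rw [D.apply_alpha_pow_eq_zero hφ hmn, D.apply_alpha_pow_eq_zero hψ hmn]

/-- A Hecke function vanishes at almost all `αⁿ`, as its support is compact. -/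
lemma IsUnramifiedDatum.finite_setOf_apply_ne_zero (D : IsUnramifiedDatum p conj ϖ)
    (φ : heckeFun σ) : {n : ℕ | φ.1 (α ^ n) ≠ 0}.Finite := by
  refine Set.Finite.of_finite_image (f := fun n => ((α ^ n : U21 conj) : U21 conj ⧸ maxK conj i))
    ((heckeFun_finite (isOpen_maxK conj i) φ).subset ?_) ?_
  · rintro _ ⟨n, hn, rfl⟩ h0
    refine hn ?_
    obtain ⟨κ, hκ⟩ := QuotientGroup.mk_out_eq_mul (maxK conj i) (α ^ n)
    rw [hκ, heckeFun_right] at h0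
    have h1 := congrArg (fun f => f * σ κ⁻¹) h0
    simp only [zero_mul] at h1
    rwa [mul_assoc, ← map_mul, mul_inv_cancel, map_one, mul_one] at h1
  · intro m _ n _ h
    have h1 : (α ^ m)⁻¹ * α ^ n ∈ maxK conj i := QuotientGroup.eq.1 h
    exact (D.eq_of_mem_cell (i := i) (m := n) (n := m) ⟨1, ⟨_, h1⟩, by simp⟩).symm

lemma IsUnramifiedDatum.sum_smul_apply (D : IsUnramifiedDatum p conj ϖ)
    {φ : ℕ → heckeFun σ} (hφ : ∀ n, IsPhi conj ϖ i σ n (φ n)) (s : Finset ℕ) (c : ℕ → k) (m : ℕ) :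
    (∑ n ∈ s, c n • φ n).1 (α ^ m) =
      if m ∈ s then c m • (if m = 0 then 1 else jSigma conj i σ) else 0 := by
  rw [Submodule.coe_sum, Finset.sum_apply]
  have h : ∀ n ∈ s, (c n • φ n).1 (α ^ m) =
      if m = n then c m • (if m = 0 then 1 else jSigma conj i σ) else 0 := by
    intro n _
    change c n • (φ n).1 (α ^ m) = _
    split_ifs with h h0
    · rw [← h, (hφ m).2, if_pos h0]
    · rw [← h, (hφ m).2, if_neg h0]
    · rw [D.apply_alpha_pow_eq_zero (hφ n) h, smul_zero]
  rw [Finset.sum_congr rfl h, Finset.sum_ite_eq]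

end Values

section Basis

open ValuativeRel Topology

variable {F E : Type*} [Field F] [Field E] [Algebra F E]
  [ValuativeRel E] [TopologicalSpace E] [IsNonarchimedeanLocalField E]
  {p : ℕ} [Fact p.Prime] {conj : E ≃ₐ[F] E} {ϖ : Fˣ} {i : Fin 2}
  {k W : Type*} [Field k] [CharP k p] [IsAlgClosed k] [AddCommGroup W] [Module k W]
  {σ : Representation k (maxK conj i) W}

local notation "α" => alpha conj ϖ

section Sigma

variable (D : IsUnramifiedDatum p conj ϖ) (hirr : σ.IsIrreducible) (hσ : IsSmooth σ)
include D hirr hσ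

lemma IsUnramifiedDatum.finrank_and_bijective :
    Module.finrank k (Representation.invariants (σ.comp (proIwahori conj i).subtype)) = 1 ∧
      Function.Bijective (invToCoinv (proIwahori conj i) (proIwahori' conj i) σ) := by
  have := D.compactSpace_maxK (i := i)
  have := finiteDimensional_of_isSmooth hirr hσ
  exact D.isRankOneDatum.finrank_invariants_and_bijective
    (fun n hn => D.apply_eq_one_of_radK hirr hσ n hn) hirr

lemma IsUnramifiedDatum.jSigma_ne_zero : jSigma conj i σ ≠ 0 :=
  jMap_ne_zero (D.finrank_and_bijective hirr hσ).2 (D.finrank_and_bijective hirr hσ).1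

lemma IsUnramifiedDatum.apply_mul_jSigma (a : maxK conj i) (ha : a.1 ∈ iwa conj i) :
    σ a * jSigma conj i σ = jSigma conj i σ :=
  apply_mul_jMap (D.finrank_and_bijective hirr hσ).2 ha

lemma IsUnramifiedDatum.jSigma_mul_apply (b : maxK conj i) (hb : b.1 ∈ iwa' conj i) :
    jSigma conj i σ * σ b = jSigma conj i σ :=
  jMap_mul_apply (D.finrank_and_bijective hirr hσ).2 hb

lemma IsUnramifiedDatum.jSigma_mul_self :
    jSigma conj i σ * jSigma conj i σ = jSigma conj i σ :=
  jMap_mul_self (D.finrank_and_bijective hirr hσ).2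

lemma IsUnramifiedDatum.exists_eq_smul_jSigma {f : Module.End k W}
    (hA : ∀ a : maxK conj i, a.1 ∈ iwa conj i → σ a * f = f)
    (hB : ∀ b : maxK conj i, b.1 ∈ iwa' conj i → f * σ b = f) :
    ∃ c : k, f = c • jSigma conj i σ :=
  exists_eq_smul_jMap (D.finrank_and_bijective hirr hσ).2 (D.finrank_and_bijective hirr hσ).1 hA hB

lemma IsUnramifiedDatum.commute_jSigma (t : maxK conj i) (ht : t.1 ∈ torus conj) :
    σ t * jSigma conj i σ = jSigma conj i σ * σ t := by
  refine commute_jMap (D.finrank_and_bijective hirr hσ).2 (D.finrank_and_bijective hirr hσ).1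
    (fun a ha => ?_) (fun a ha => D.torus_conj_iwa ht t.2 ha)
    (fun b hb => D.torus_conj_iwa' ht t.2 hb)
  have := D.torus_conj_iwa (i := i) (inv_mem ht) (inv_mem t.2) (n := a.1) ha
  rwa [inv_inv] at this

lemma IsUnramifiedDatum.heckeFun_radK_left (φ : heckeFun σ) {n : U21 conj}
    (hn : n ∈ radK conj i) (g : U21 conj) : φ.1 (n * g) = φ.1 g := by
  have h := heckeFun_left φ ⟨n, radK_le_maxK hn⟩ g
  rwa [D.apply_eq_one_of_radK hirr hσ _ hn, one_mul] at h

lemma IsUnramifiedDatum.heckeFun_radK_right (φ : heckeFun σ) {n : U21 conj}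
    (hn : n ∈ radK conj i) (g : U21 conj) : φ.1 (g * n) = φ.1 g := by
  have h := heckeFun_right φ ⟨n, radK_le_maxK hn⟩ g
  rwa [D.apply_eq_one_of_radK hirr hσ _ hn, mul_one] at h

/-- Existence of the basic Hecke functions: the relations `κ αⁿ = αⁿ κ'` in `G` are compatible
with `j`, since `κ` lies in `K¹ T I_{1,K}` and `κ'` in `I'_{1,K} T K¹` with the same torus part. -/
lemma IsUnramifiedDatum.exists_isPhi (n : ℕ) : ∃ φ : heckeFun σ, IsPhi conj ϖ i σ n φ := by
  have := D.compactSpace_maxK (i := i)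
  have := finiteDimensional_of_isSmooth hirr hσ
  refine exists_heckeFun_supported (isOpen_maxK conj i) D.isCompact_maxK hσ (α ^ n)
    (if n = 0 then 1 else jSigma conj i σ) fun κ κ' h => ?_
  rcases eq_or_ne n 0 with rfl | hn
  · rw [pow_zero, mul_one, one_mul] at h
    rw [if_pos rfl, Subtype.ext h, one_mul, mul_one]
  rw [if_neg hn]
  obtain ⟨l, t, u, l', u', h1, h2, hl, ht, htK, hu, hl', hu'⟩ :=
    D.exists_decomp_of_alpha_conj κ.2 κ'.2 h hn
  obtain rfl : κ = ⟨l, radK_le_maxK hl⟩ * ⟨t, htK⟩ * ⟨u, iwa_le_maxK hu⟩ := Subtype.ext h1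
  obtain rfl : κ' = ⟨l', iwa'_le_maxK hl'⟩ * ⟨t, htK⟩ * ⟨u', radK_le_maxK hu'⟩ := Subtype.ext h2
  rw [map_mul, map_mul, map_mul, map_mul, D.apply_eq_one_of_radK hirr hσ ⟨l, _⟩ hl,
    D.apply_eq_one_of_radK hirr hσ ⟨u', _⟩ hu', one_mul, mul_one, mul_assoc,
    D.apply_mul_jSigma hirr hσ ⟨u, _⟩ hu, D.commute_jSigma hirr hσ ⟨t, _⟩ ht, ← mul_assoc,
    D.jSigma_mul_apply hirr hσ ⟨l', _⟩ hl']

/-- The value of a Hecke function at `αⁿ` is a multiple of `j`, or scalar if `n = 0`. -/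
lemma IsUnramifiedDatum.exists_apply_alpha_pow (φ : heckeFun σ) (n : ℕ) :
    ∃ c : k, φ.1 (α ^ n) = c • (if n = 0 then 1 else jSigma conj i σ) := by
  have := D.compactSpace_maxK (i := i)
  have := finiteDimensional_of_isSmooth hirr hσ
  rcases eq_or_ne n 0 with rfl | hn
  · rw [if_pos rfl, pow_zero]
    refine exists_eq_smul_one_of_commute hirr _ fun g => ?_
    rw [← heckeFun_left, ← heckeFun_right, one_mul, mul_one]
  rw [if_neg hn]
  refine D.exists_eq_smul_jSigma hirr hσ (fun a ha => ?_) (fun b hb => ?_)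
  · rw [← heckeFun_left]
    obtain ⟨m, u, h, hm, hu, x, y, hxy⟩ := D.iwa_decomp ha
    rw [h, mul_assoc, D.heckeFun_radK_left hirr hσ φ hm,
      show u * α ^ n = α ^ n * ((α ^ n)⁻¹ * u * α ^ n) by group,
      D.heckeFun_radK_right hirr hσ φ (D.alpha_conj_upper_mem hxy hu hn)]
  · rw [← heckeFun_right]
    obtain ⟨l, m, h, hm, hl, x, y, hxy⟩ := D.iwa'_decomp hb
    rw [h, ← mul_assoc, D.heckeFun_radK_right hirr hσ φ hm,
      show α ^ n * l = α ^ n * l * (α ^ n)⁻¹ * α ^ n by group,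
      D.heckeFun_radK_left hirr hσ φ (D.alpha_conj_lower_mem hxy hl hn)]

lemma IsUnramifiedDatum.ite_ne_zero (n : ℕ) :
    (if n = 0 then 1 else jSigma conj i σ : Module.End k W) ≠ 0 := by
  have := nontrivial_of_isIrreducible hirr
  split_ifs
  · exact one_ne_zero
  · exact D.jSigma_ne_zero hirr hσ

lemma IsUnramifiedDatum.support_eq_cell {n : ℕ} {φ : heckeFun σ}
    (hφ : IsPhi conj ϖ i σ n φ) : Function.support φ.1 = cell conj ϖ i n := by
  refine hφ.1.antisymm ?_
  rintro _ ⟨κ, κ', rfl⟩ h0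
  rw [heckeFun_bi, hφ.2] at h0
  refine D.ite_ne_zero hirr hσ n ?_
  have h1 : ∀ g : maxK conj i, σ g⁻¹ * σ g = 1 := fun g => by
    rw [← map_mul, inv_mul_cancel, map_one]
  have h2 : ∀ g : maxK conj i, σ g * σ g⁻¹ = 1 := fun g => by
    rw [← map_mul, mul_inv_cancel, map_one]
  have h3 := congrArg (fun f => σ κ⁻¹ * f * σ κ'⁻¹) h0
  simp only [mul_zero, zero_mul] at h3
  rwa [mul_assoc (σ κ⁻¹), mul_assoc _ (σ κ'), h2, mul_one, ← mul_assoc, h1, one_mul] at h3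

end Sigma

section Family

variable (D : IsUnramifiedDatum p conj ϖ) (hirr : σ.IsIrreducible) (hσ : IsSmooth σ)
  {φ : ℕ → heckeFun σ} (hφ : ∀ n, IsPhi conj ϖ i σ n (φ n))
include D hirr hσ hφ

lemma IsUnramifiedDatum.linearIndependent_phi : LinearIndependent k φ := by
  refine linearIndependent_iff'.2 fun s c h m hm => ?_
  have h1 := D.sum_smul_apply hφ s c m
  rw [h, if_pos hm] at h1
  exact (smul_eq_zero.1 h1.symm).resolve_right (D.ite_ne_zero hirr hσ m)

lemma IsUnramifiedDatum.span_phi : Submodule.span k (Set.range φ) = ⊤ := by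
  refine eq_top_iff.2 fun ψ _ => ?_
  choose c hc using D.exists_apply_alpha_pow hirr hσ ψ
  have hψ : ψ = ∑ n ∈ (D.finite_setOf_apply_ne_zero ψ).toFinset, c n • φ n := by
    refine D.heckeFun_ext fun m => ?_
    rw [D.sum_smul_apply hφ]
    split_ifs with h h0 <;> try rw [hc]
    · rw [if_pos h0]
    · rw [if_neg h0]
    · rw [Set.Finite.mem_toFinset, Set.mem_ofPred_eq, not_not] at h
      rw [← hc, h]
  rw [hψ]
  exact Submodule.sum_mem _ fun n _ =>
    Submodule.smul_mem _ _ (Submodule.subset_span ⟨n, rfl⟩)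

end Family

end Basis

/-! ### The convolution relations -/

section Cosets

open ValuativeRel Topology

variable {F E : Type*} [Field F] [Field E] [Algebra F E]
  [ValuativeRel E] [TopologicalSpace E] [IsNonarchimedeanLocalField E]
  {p : ℕ} {conj : E ≃ₐ[F] E} {ϖ : Fˣ} {i : Fin 2}

local notation "π" => algebraMap F E ϖ
local notation "α" => alpha conj ϖ
local notation "w" => weyl conj ϖ ((i : ℕ) : ℤ)

/-- The group `K¹ ∩ αˡ K¹ α⁻ˡ`. -/
def radAt (conj : E ≃ₐ[F] E) (ϖ : Fˣ) (i : Fin 2) (l : ℕ) : Subgroup (U21 conj) :=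
  radK conj i ⊓ (radK conj i).comap (MulAut.conj (alpha conj ϖ ^ l)⁻¹).toMonoidHom

lemma mem_radAt {l : ℕ} {v : U21 conj} :
    v ∈ radAt conj ϖ i l ↔ v ∈ radK conj i ∧ (α ^ l)⁻¹ * v * α ^ l ∈ radK conj i := by
  have : MulAut.conj (α ^ l)⁻¹ v = (α ^ l)⁻¹ * v * α ^ l := by rw [MulAut.conj_apply, inv_inv]
  rw [← this]
  exact Iff.rfl

lemma mem_radAt_zero {v : U21 conj} : v ∈ radAt conj ϖ i 0 ↔ v ∈ radK conj i := by
  simp [mem_radAt]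

variable (D : IsUnramifiedDatum p conj ϖ)
include D

lemma IsUnramifiedDatum.commute_alpha_torus {t : U21 conj} (ht : t ∈ torus conj) :
    t * α = α * t := by
  have h := (isDiag_alpha_zpow (conj := conj) (ϖ := ϖ) 1).commute (isDiag_of_mem_torus ht)
  rw [zpow_one] at h
  exact h.symm

/-- The cosets `xK` in `KαK` are those of the elements `n α` with `n ∈ K¹` and of the elements
`u w α` with `u` an upper unipotent element of `K`. -/
lemma IsUnramifiedDatum.coset_cases {g : U21 conj} (hg : g ∈ cell conj ϖ i 1) :
    (∃ n ∈ radK conj i, (g : U21 conj ⧸ maxK conj i) = ((n * α : U21 conj) : _ ⧸ _)) ∨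
      ∃ u x y, IsUpper u x y ∧
        (g : U21 conj ⧸ maxK conj i) = ((u * w * α : U21 conj) : _ ⧸ _) := by
  obtain ⟨κ, κ', rfl⟩ := hg
  have hκ := κ.2
  have hu0 : uniformizer E ≠ 0 := uniformizer_ne_zero
  rw [pow_one, QuotientGroup.mk_mul_of_mem _ κ'.2]
  have m20 : κ.1.1.1 2 0 ∈ primePow E ((i : ℕ) : ℤ) := by
    have := apply_mem_of_mem_maxK hκ 2 0
    clear hκ
    revert this; fin_cases i <;> exact id
  have hαu : ∀ t u : U21 conj, t ∈ torus conj → t ∈ maxK conj i → u ∈ iwa conj i →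
      (∃ x y, IsUpper u x y) → ∀ g : U21 conj,
      ((g * (t * u) * α : U21 conj) : U21 conj ⧸ maxK conj i) = ((g * α : U21 conj) : _ ⧸ _) := by
    rintro t u ht htK hu ⟨x, y, hxy⟩ g
    have h1 := D.alpha_conj_upper_mem (n := 1) hxy hu one_ne_zero
    rw [pow_one] at h1
    have h2 : g * (t * u) * α = g * α * (t * (α⁻¹ * u * α)) := by
      have := D.commute_alpha_torus ht
      calc g * (t * u) * α = g * (t * α) * (α⁻¹ * u * α) := by group
        _ = g * (α * t) * (α⁻¹ * u * α) := by rw [this]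
        _ = _ := by group
    rw [h2, QuotientGroup.mk_mul_of_mem _ (mul_mem htK (radK_le_maxK h1))]
  by_cases h : κ.1.1.1 2 0 ∈ primePow E (1 + ((i : ℕ) : ℤ))
  · have v00 : valuation E (κ.1.1.1 0 0) = 1 := by
      refine (D.corner_dichotomy hκ).resolve_right fun h2 => ?_
      rw [mem_primePow_iff_of_valuation_eq h2.2] at h
      omega
    obtain ⟨l, t, u, hlu, -, ht, htK, hu, hl, hu'⟩ := D.exists_bigCell_of_unit hκ v00
    refine Or.inl ⟨l, ?_, ?_⟩
    · rw [D.isLower_mem_radK hl, div_mem_of_valuation_eq_one v00]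
      exact h
    · rw [hlu, mul_assoc l, hαu t u ht htK hu ⟨_, _, hu'⟩]
  · have v20 : valuation E (κ.1.1.1 2 0) = uniformizer E ^ ((i : ℕ) : ℤ) :=
      valuation_eq_of_mem_of_notMem m20 (by rwa [add_comm])
    have v00 : valuation E ((w * κ.1).1.1 0 0) = 1 := by
      rw [weyl_mul_apply_zero, map_mul, map_inv₀, D.valuation_pi_zpow, v20,
        inv_mul_cancel₀ (zpow_ne_zero _ hu0)]
    obtain ⟨l, t, u, hlu, -, ht, htK, hu, hl, hu'⟩ :=
      D.exists_bigCell_of_unit (mul_mem D.weyl_mem_maxK hκ) v00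
    refine Or.inr ⟨w * l * w, _, _, hl.conj_weyl D.conj_conj _, ?_⟩
    have h1 : (κ : U21 conj) = w * l * w * w * (t * u) := by
      have h2 := weyl_mul_weyl (conj := conj) (ϖ := ϖ) ((i : ℕ) : ℤ)
      calc (κ : U21 conj) = w * w * κ := by rw [h2, one_mul]
        _ = w * (w * κ) := by group
        _ = w * (l * t * u) := by rw [hlu]
        _ = w * l * (w * w) * (t * u) := by rw [h2]; group
        _ = _ := by group
    rw [h1, hαu t u ht htK hu ⟨_, _, hu'⟩]

/-- `K¹ ∩ αˡ K¹ α⁻ˡ` moves every coset `u w α K`: a central upper unipotent element does. -/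
lemma IsUnramifiedDatum.exists_smul_upper_ne (l : ℕ) {u : U21 conj} {x y : E}
    (hu : IsUpper u x y) : ∃ v ∈ radAt conj ϖ i l,
      ((v * (u * w * α) : U21 conj) : U21 conj ⧸ maxK conj i) ≠
        ((u * w * α : U21 conj) : _ ⧸ _) := by
  obtain ⟨δ, hδ, hδ'⟩ := D.exists_unit
  have hu0 : uniformizer E ≠ 0 := uniformizer_ne_zero
  obtain ⟨v, hv⟩ := exists_isUpper (conj := conj) D.conj_conj (x := 0)
    (y := δ * π ^ (1 - ((i : ℕ) : ℤ))) (by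
      rw [map_mul, map_zpow₀, AlgEquiv.commutes]
      linear_combination π ^ (1 - ((i : ℕ) : ℤ)) * hδ')
  have hval : ∀ m : ℤ, valuation E (π ^ m * (δ * π ^ (1 - ((i : ℕ) : ℤ)))) =
      uniformizer E ^ (m + (1 - ((i : ℕ) : ℤ))) := by
    intro m
    rw [map_mul, map_mul, hδ, one_mul, D.valuation_pi_zpow, D.valuation_pi_zpow, zpow_add₀ hu0]
  refine ⟨v, mem_radAt.2 ⟨?_, ?_⟩, fun h => ?_⟩
  · rw [D.isUpper_mem_radK hv]
    have := hval 0
    rw [zpow_zero, one_mul] at this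
    rw [mem_primePow_iff_of_valuation_eq this]
    omega
  · have h1 := hv.conj_alpha (ϖ := ϖ) l
    rw [zpow_neg, zpow_natCast] at h1
    rw [D.isUpper_mem_radK h1, mem_primePow_iff_of_valuation_eq (hval _)]
    omega
  · have h1 := QuotientGroup.eq.1 h.symm
    have hw : (w)⁻¹ = w := inv_eq_of_mul_eq_one_left (weyl_mul_weyl _)
    have h2 : (u * w * α)⁻¹ * (v * (u * w * α)) = α⁻¹ * (w * v * w) * α := by
      calc (u * w * α)⁻¹ * (v * (u * w * α)) = α⁻¹ * (w)⁻¹ * u⁻¹ * (v * u) * w * α := by group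
        _ = α⁻¹ * (w)⁻¹ * u⁻¹ * (u * v) * w * α := by rw [hu.commute_of_zero hv]
        _ = α⁻¹ * ((w)⁻¹ * v * w) * α := by group
        _ = _ := by rw [hw]
    have h3 := (hv.conj_weyl D.conj_conj (ϖ := ϖ) ((i : ℕ) : ℤ)).conj_alpha (ϖ := ϖ) (-1)
    rw [neg_neg, zpow_one, zpow_neg_one] at h3
    rw [h2, D.isLower_mem_maxK h3, ← mul_assoc, ← zpow_add₀ (by simp),
      mem_primePow_iff_of_valuation_eq (hval _)] at h1
    omega

/-- `K¹` moves every coset `n α K` with `n ∈ K¹`. -/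
lemma IsUnramifiedDatum.exists_smul_radK_ne {n : U21 conj} (hn : n ∈ radK conj i) :
    ∃ v ∈ radK conj i, ((v * (n * α) : U21 conj) : U21 conj ⧸ maxK conj i) ≠
        ((n * α : U21 conj) : _ ⧸ _) := by
  obtain ⟨δ, hδ, hδ'⟩ := D.exists_unit
  have hu0 : uniformizer E ≠ 0 := uniformizer_ne_zero
  obtain ⟨v, hv⟩ := exists_isLower (conj := conj) D.conj_conj (x := 0)
    (y := δ * π ^ (1 + ((i : ℕ) : ℤ))) (by
      rw [map_mul, map_zpow₀, AlgEquiv.commutes]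
      linear_combination π ^ (1 + ((i : ℕ) : ℤ)) * hδ')
  have hval : ∀ m : ℤ, valuation E (π ^ m * (δ * π ^ (1 + ((i : ℕ) : ℤ)))) =
      uniformizer E ^ (m + (1 + ((i : ℕ) : ℤ))) := by
    intro m
    rw [map_mul, map_mul, hδ, one_mul, D.valuation_pi_zpow, D.valuation_pi_zpow, ← zpow_add₀ hu0]
  have hvr : v ∈ radK conj i := by
    rw [D.isLower_mem_radK hv]
    have := hval 0
    rw [zpow_zero, one_mul] at this
    rw [mem_primePow_iff_of_valuation_eq this]
    omega
  refine ⟨n * v * n⁻¹, D.radK_conj (radK_le_maxK hn) hvr, fun h => ?_⟩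
  have h1 := QuotientGroup.eq.1 h.symm
  have h2 : (n * α)⁻¹ * (n * v * n⁻¹ * (n * α)) = α⁻¹ * v * α := by group
  have h3 := hv.conj_alpha (ϖ := ϖ) (-1)
  rw [neg_neg, zpow_one, zpow_neg_one] at h3
  rw [h2, D.isLower_mem_maxK h3, mem_primePow_iff_of_valuation_eq (hval _)] at h1
  omega

/-- The cosets `n α K` with `n ∈ K¹`: apart from `αK` they are represented by elements `l α` with
`α⁻¹ l⁻¹ α ∈ K¹ w α T K¹`. -/
lemma IsUnramifiedDatum.coset_radK_cases {n : U21 conj} (hn : n ∈ radK conj i)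
    (hne : ((n * α : U21 conj) : U21 conj ⧸ maxK conj i) ≠ ((α : U21 conj) : _ ⧸ _)) :
    ∃ l ∈ radK conj i, ∃ m ∈ radK conj i, ∃ t ∈ torus conj, ∃ u, t ∈ maxK conj i ∧
      (∀ r : ℕ, (α ^ r)⁻¹ * u * α ^ r ∈ radK conj i) ∧
      ((n * α : U21 conj) : U21 conj ⧸ maxK conj i) = ((l * α : U21 conj) : _ ⧸ _) ∧
      α⁻¹ * l⁻¹ * α = m * w * α * t * u := by
  have hu0 : uniformizer E ≠ 0 := uniformizer_ne_zero
  have v00 := valuation_corner_of_iwa (i := i) (radK_le_iwa hn)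
  obtain ⟨l, t, u, hlu, -, ht, htK, hu, hl, hu'⟩ := D.exists_bigCell_of_unit (radK_le_maxK hn) v00
  have hlr : l ∈ radK conj i := by
    rw [D.isLower_mem_radK hl, div_mem_of_valuation_eq_one v00]
    have := hn.1 2 0
    change (n.1.1 - 1) 2 0 ∈ _ at this
    rw [Matrix.sub_apply, Matrix.one_apply_ne (by decide), sub_zero] at this
    clear hl hu' hlu v00 hne hn
    revert this; fin_cases i <;> exact id
  have hcos : ((n * α : U21 conj) : U21 conj ⧸ maxK conj i) = ((l * α : U21 conj) : _ ⧸ _) := by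
    have h1 := D.alpha_conj_upper_mem (n := 1) hu' hu one_ne_zero
    rw [pow_one] at h1
    have h2 : n * α = l * α * (t * (α⁻¹ * u * α)) := by
      calc n * α = l * (t * α) * (α⁻¹ * u * α) := by rw [hlu]; group
        _ = l * (α * t) * (α⁻¹ * u * α) := by rw [D.commute_alpha_torus ht]
        _ = _ := by group
    rw [h2, QuotientGroup.mk_mul_of_mem _ (mul_mem htK (radK_le_maxK h1))]
  -- as `l α K ≠ α K`, the parameter `y` of `l` generates `𝔭^(1 + i)`
  set x := n.1.1 1 0 / n.1.1 0 0
  set y := n.1.1 2 0 / n.1.1 0 0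
  have hy : valuation E y = uniformizer E ^ (1 + ((i : ℕ) : ℤ)) := by
    refine valuation_eq_of_mem_of_notMem ((D.isLower_mem_radK hl).1 hlr) fun h => hne ?_
    have h1 := hl.conj_alpha (ϖ := ϖ) (-1)
    rw [neg_neg, zpow_one, zpow_neg_one] at h1
    have h2 : α⁻¹ * l * α ∈ maxK conj i := by
      rw [D.isLower_mem_maxK h1]
      exact primePow_mul (by omega) (D.valuation_pi_zpow _).le h
    rw [hcos, show l * α = α * (α⁻¹ * l * α) by group, QuotientGroup.mk_mul_of_mem _ h2]
  -- `g = α⁻¹ l⁻¹ α` is lower unipotent with `y`-parameter of valuation `i - 1`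
  set g := α⁻¹ * l⁻¹ * α with hg
  have hgl := (hl.inv D.conj_conj).conj_alpha (ϖ := ϖ) (-1)
  rw [neg_neg, zpow_one, zpow_neg_one, ← hg] at hgl
  set y' := π ^ (2 * (-1) : ℤ) * conj y with hy'
  have hvy' : valuation E y' = uniformizer E ^ (((i : ℕ) : ℤ) - 1) := by
    rw [hy', map_mul, D.valuation_pi_zpow, D.valuation_conj, hy, ← zpow_add₀ hu0]
    congr 1; ring
  have hgv : g.1.1 = _ := hgl
  set W' := weyl conj ϖ (((i : ℕ) : ℤ) - 1) with hW'
  have hWv : W'.1.1 = _ := weyl_val (conj := conj) (ϖ := ϖ) (((i : ℕ) : ℤ) - 1)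
  have hval : ∀ m : ℤ, valuation E (π ^ m) = uniformizer E ^ m := D.valuation_pi_zpow
  have e00 : (W' * g).1.1 0 0 = (π ^ (((i : ℕ) : ℤ) - 1))⁻¹ * y' := by
    rw [hW', weyl_mul_apply_zero, hgv]; rfl
  have e20 : (W' * g).1.1 2 0 = π ^ (((i : ℕ) : ℤ) - 1) := by
    rw [val_mul_apply, hWv, hgv, Matrix.mul_apply, Fin.sum_univ_three]; simp
  have e02 : (W' * g).1.1 0 2 = π ^ (1 - ((i : ℕ) : ℤ)) := by
    rw [val_mul_apply, hWv, hgv, Matrix.mul_apply, Fin.sum_univ_three,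
      show (1 : ℤ) - (i : ℕ) = -((i : ℕ) - 1) by ring]
    simp only [Matrix.of_apply, Matrix.cons_val, zero_mul, mul_one, zero_add]
    rw [zpow_neg]
  have w00 : valuation E ((W' * g).1.1 0 0) = 1 := by
    rw [e00, map_mul, map_inv₀, hval, hvy', inv_mul_cancel₀ (zpow_ne_zero _ hu0)]
  have hne0 : (W' * g).1.1 0 0 ≠ 0 := fun h => by
    rw [h, map_zero] at w00
    exact zero_ne_one w00
  -- the big cell decomposition of `W' g` is moved back through `W'`, which makes `l₁` upper unipotent
  obtain ⟨l₁, t₁, u₁, hd, hl₁, ⟨b, ht₁⟩, hu₁⟩ := exists_bigCell D.conj_conj hne0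
  have hm := hl₁.conj_weyl D.conj_conj (ϖ := ϖ) (((i : ℕ) : ℤ) - 1)
  refine ⟨l, hlr, W' * l₁ * W', ?_, t₁, ht₁.mem_torus, u₁, D.isDiag_mem_maxK ht₁ w00,
    fun r => ?_, hcos, ?_⟩
  · rw [D.isUpper_mem_radK hm, e20, ← mul_div_assoc, ← zpow_add₀ (by simp),
      div_mem_of_valuation_eq_one w00, mem_primePow_iff_of_valuation_eq (hval _)]
    omega
  · have h1 := hu₁.conj_alpha (ϖ := ϖ) r
    rw [zpow_neg, zpow_natCast] at h1
    rw [D.isUpper_mem_radK h1, e02, ← mul_div_assoc, ← zpow_add₀ (by simp),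
      div_mem_of_valuation_eq_one w00, mem_primePow_iff_of_valuation_eq (hval _)]
    omega
  · -- `w α = α⁻¹ w` is the element `W'`
    have hwα : w * α = W' := by
      have h1 := weyl_alpha_weyl (conj := conj) (ϖ := ϖ) ((i : ℕ) : ℤ) 1
      have h2 := alpha_mul_weyl (conj := conj) (ϖ := ϖ) (-1) ((i : ℕ) : ℤ)
      have h3 := weyl_mul_weyl (conj := conj) (ϖ := ϖ) ((i : ℕ) : ℤ)
      rw [zpow_one] at h1
      rw [hW', show ((i : ℕ) : ℤ) - 1 = -1 + (i : ℕ) by ring, ← h2, ← h1, mul_assoc _ _ (w), h3,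
        mul_one]
    have h4 : W' * W' = 1 := weyl_mul_weyl _
    calc g = W' * (W' * g) := by rw [← mul_assoc, h4, one_mul]
      _ = W' * l₁ * (W' * W') * t₁ * u₁ := by rw [hd, h4]; group
      _ = W' * l₁ * W' * (w * α) * t₁ * u₁ := by rw [hwα]; group
      _ = _ := by group

end Cosets

section Convolution

open ValuativeRel Topology

variable {F E : Type*} [Field F] [Field E] [Algebra F E]
  [ValuativeRel E] [TopologicalSpace E] [IsNonarchimedeanLocalField E]
  {p : ℕ} [Fact p.Prime] {conj : E ≃ₐ[F] E} {ϖ : Fˣ} {i : Fin 2}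
  {k W : Type*} [Field k] [CharP k p] [IsAlgClosed k] [AddCommGroup W] [Module k W]
  {σ : Representation k (maxK conj i) W}

local notation "α" => alpha conj ϖ
local notation "w" => weyl conj ϖ ((i : ℕ) : ℤ)

/-- The summands of a convolution only depend on the coset. -/
lemma conv_summand_out {k W : Type*} [Field k] [AddCommGroup W] [Module k W]
    {G : Type*} [Group G] [TopologicalSpace G] {K : Subgroup G} {σ : Representation k K W}
    (φ ψ : heckeFun σ) (g x : G) :
    φ.1 (x : G ⧸ K).out * ψ.1 ((x : G ⧸ K).out⁻¹ * g) = φ.1 x * ψ.1 (x⁻¹ * g) := by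
  refine summand_out (F := fun y => φ.1 y * ψ.1 (y⁻¹ * g)) (fun κ x => ?_) x
  have h := heckeFun_left ψ κ⁻¹ (x⁻¹ * g)
  rw [Subgroup.coe_inv] at h
  rw [mul_inv_rev, mul_assoc, h, heckeFun_right, mul_assoc, ← mul_assoc (σ κ), ← map_mul,
    mul_inv_cancel, map_one, one_mul]

variable (D : IsUnramifiedDatum p conj ϖ) (hirr : σ.IsIrreducible) (hσ : IsSmooth σ)
include D hirr hσ

/-- A part of the convolution sum at `αˡ` vanishes if `K¹ ∩ αˡ K¹ α⁻ˡ` acts on it without fixed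
points: the summands are invariant and the orbits have `p`-power length. -/
lemma IsUnramifiedDatum.sum_conv_eq_zero (φ ψ : heckeFun σ) (l : ℕ)
    (s : Finset (U21 conj ⧸ maxK conj i))
    (hs : ∀ v ∈ radAt conj ϖ i l, ∀ x ∈ s, v • x ∈ s)
    (hfix : ∀ x ∈ s, ∃ v ∈ radAt conj ϖ i l, v • x ≠ x) :
    ∑ x ∈ s, φ.1 x.out * ψ.1 (x.out⁻¹ * α ^ l) = 0 := by
  refine finset_sum_eq_zero_of_smul_invariant (P := radAt conj ϖ i l) (p := p) (k := k) s
    (fun v x hx => hs v v.2 x hx) (fun v x hx => ?_) (fun x hx => ?_) (fun v x _ => ?_)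
  · induction x using QuotientGroup.induction_on with
    | H x =>
      have ho : IsOpen {g : U21 conj | x⁻¹ * (g * x) ∈ maxK conj i} :=
        (isOpen_maxK conj i).preimage (by fun_prop)
      obtain ⟨m, hm⟩ := D.exists_pow_mem (radK_le_iwa (mem_radAt.1 v.2).1) ho
        (by simp [one_mem])
      exact ⟨m, (QuotientGroup.eq.2 hm).symm⟩
  · obtain ⟨v, hv, h⟩ := hfix x hx
    exact ⟨⟨v, hv⟩, h⟩
  · induction x using QuotientGroup.induction_on with
    | H x =>
      have h : (v • (x : U21 conj ⧸ maxK conj i)) =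
        ((v.1 * x : U21 conj) : U21 conj ⧸ maxK conj i) := rfl
      have hv := mem_radAt.1 v.2
      rw [h, conv_summand_out, conv_summand_out, D.heckeFun_radK_left hirr hσ φ hv.1,
        show (v.1 * x)⁻¹ * α ^ l = x⁻¹ * α ^ l * ((α ^ l)⁻¹ * v.1 * α ^ l)⁻¹ by group,
        D.heckeFun_radK_right hirr hσ ψ (inv_mem hv.2)]

variable {φ : ℕ → heckeFun σ} (hφ : ∀ n, IsPhi conj ϖ i σ n (φ n))
include hφ

lemma IsUnramifiedDatum.mem_finite_iff {g : U21 conj} :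
    (g : U21 conj ⧸ maxK conj i) ∈ (heckeFun_finite (isOpen_maxK conj i) (φ 1)).toFinset ↔
      g ∈ cell conj ϖ i 1 := by
  rw [Set.Finite.mem_toFinset, Set.mem_ofPred_eq, ← Function.mem_support,
    D.support_eq_cell hirr hσ (hφ 1)]
  obtain ⟨κ, hκ⟩ := QuotientGroup.mk_out_eq_mul (maxK conj i) g
  rw [hκ]
  constructor
  · rintro ⟨μ, μ', h⟩
    refine ⟨μ, μ' * κ⁻¹, ?_⟩
    rw [Subgroup.coe_mul, ← mul_assoc, ← h]
    simp
  · rintro ⟨μ, μ', rfl⟩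
    exact ⟨μ, μ' * κ, by simp only [Subgroup.coe_mul, mul_assoc]⟩

/-- The summand of `(φ₁ * φₙ)(αˡ)` at a coset `a α K ≠ αK` with `a ∈ K¹`. As
`(a α)⁻¹ αˡ ∈ K¹ w αˡ T K¹` by `coset_radK_cases`, it is `j σ(w) φₙ(αˡ) σ(t)` with `t` in the torus,
and the constant `c` with `j σ(w) j σ(t) = c j` depends neither on `n` nor on `l`. -/
lemma IsUnramifiedDatum.exists_conv_summand_eq {x : U21 conj ⧸ maxK conj i}
    (hx : ∃ n ∈ radK conj i, x = ((n * α : U21 conj) : U21 conj ⧸ maxK conj i))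
    (hne : x ≠ ((α : U21 conj) : U21 conj ⧸ maxK conj i)) :
    ∃ c : k, ∀ n l : ℕ, n ≠ 0 → l ≠ 0 →
      (φ 1).1 x.out * (φ n).1 (x.out⁻¹ * α ^ l) =
        if l = n then c • jSigma conj i σ else 0 := by
  obtain ⟨n₀, hn₀, rfl⟩ := hx
  obtain ⟨a, ha, m, hm, t, ht, u, htK, hu, hcos, hdec⟩ := D.coset_radK_cases hn₀ hne
  rw [hcos]
  let τ : maxK conj i := ⟨t, htK⟩
  let ω : maxK conj i := ⟨w, D.weyl_mem_maxK⟩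
  have hφ1 : (φ 1).1 (a * α) = jSigma conj i σ := by
    rw [D.heckeFun_radK_left hirr hσ _ ha]
    simpa using (hφ 1).2
  obtain ⟨c, hc⟩ := D.exists_eq_smul_jSigma hirr hσ (f := jSigma conj i σ * σ ω * jSigma conj i σ * σ τ)
    (fun g hg => by
      rw [← mul_assoc, ← mul_assoc, ← mul_assoc, D.apply_mul_jSigma hirr hσ g hg])
    (fun b hb => by
      have h1 : τ * b = (τ * b * τ⁻¹) * τ := by group
      have h2 : (τ * b * τ⁻¹).1 ∈ iwa' conj i := D.torus_conj_iwa' ht htK hb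
      rw [mul_assoc _ (σ τ), ← map_mul, h1, map_mul, ← mul_assoc,
        mul_assoc _ (jSigma conj i σ), D.jSigma_mul_apply hirr hσ _ h2])
  refine ⟨c, fun n l hn hl => ?_⟩
  rw [conv_summand_out, hφ1]
  obtain ⟨r, rfl⟩ := Nat.exists_eq_succ_of_ne_zero hl
  have hct : ∀ r : ℕ, t * α ^ r = α ^ r * t := fun r =>
    Commute.pow_right (D.commute_alpha_torus ht) r
  have h1 : (a * α)⁻¹ * α ^ (r + 1) =
      m * (w * (α ^ (r + 1) * t) * ((α ^ r)⁻¹ * u * α ^ r)) := by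
    calc (a * α)⁻¹ * α ^ (r + 1) = α⁻¹ * a⁻¹ * α * α ^ r := by rw [pow_succ']; group
      _ = m * w * α * t * u * α ^ r := by rw [hdec]
      _ = m * w * α * (t * α ^ r) * ((α ^ r)⁻¹ * u * α ^ r) := by group
      _ = m * w * α * (α ^ r * t) * ((α ^ r)⁻¹ * u * α ^ r) := by rw [hct]
      _ = _ := by rw [pow_succ']; simp only [mul_assoc]
  have h2 := heckeFun_left (φ n) ω (α ^ (r + 1) * t)
  have h3 := heckeFun_right (φ n) τ (α ^ (r + 1))
  rw [h1, D.heckeFun_radK_left hirr hσ _ hm, D.heckeFun_radK_right hirr hσ _ (hu r)]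
  change jSigma conj i σ * (φ n).1 ((ω : U21 conj) * (α ^ (r + 1) * t)) = _
  rw [h2]
  change jSigma conj i σ * (σ ω * (φ n).1 (α ^ (r + 1) * (τ : U21 conj))) = _
  rw [h3]
  split_ifs with h
  · have h4 := (hφ n).2
    rw [if_neg hn, ← h] at h4
    rw [← h, h4, ← hc]
    simp only [mul_assoc]
  · rw [D.apply_alpha_pow_eq_zero (hφ n) h, zero_mul, mul_zero, mul_zero]

/-- The values of `φ₁ * φₙ`: the big cells `u w α K` contribute nothing, the coset `αK`
contributes `j` for `l = n + 1`, and the remaining cosets `a α K` with `a ∈ K¹` contribute for `l = n` only. -/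
theorem IsUnramifiedDatum.exists_conv_apply :
    ∃ c : k, ∀ n : ℕ, 1 ≤ n → ∀ l : ℕ,
      (conv (isOpen_maxK conj i) (φ 1) (φ n)).1 (α ^ l) =
        if l = n then c • jSigma conj i σ
        else if l = n + 1 then jSigma conj i σ else 0 := by
  classical
  set s := (heckeFun_finite (isOpen_maxK conj i) (φ 1)).toFinset with hs
  -- `P` singles out the cosets of the elements of `K¹ α`
  set P : U21 conj ⧸ maxK conj i → Prop := fun x =>
    ∃ n ∈ radK conj i, x = ((n * α : U21 conj) : U21 conj ⧸ maxK conj i) with hP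
  set x₀ : U21 conj ⧸ maxK conj i := ((α : U21 conj) : U21 conj ⧸ maxK conj i) with hx₀
  have hmem : ∀ g : U21 conj, (g : U21 conj ⧸ maxK conj i) ∈ s ↔ g ∈ cell conj ϖ i 1 :=
    fun g => D.mem_finite_iff hirr hσ hφ
  have hstab : ∀ v ∈ radK conj i, ∀ x ∈ s, v • x ∈ s := by
    intro v hv x hx
    induction x using QuotientGroup.induction_on with
    | H x =>
      obtain ⟨κ, κ', rfl⟩ := (hmem x).1 hx
      exact (hmem _).2 ⟨⟨v, radK_le_maxK hv⟩ * κ, κ', by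
        simp only [Subgroup.coe_mul, smul_eq_mul, mul_assoc]⟩
  have hPstab : ∀ v ∈ radK conj i, ∀ x, P (v • x) ↔ P x := by
    have h : ∀ v ∈ radK conj i, ∀ x, P x → P (v • x) := by
      rintro v hv _ ⟨n, hn, rfl⟩
      refine ⟨v * n, mul_mem hv hn, ?_⟩
      rw [mul_assoc]
      rfl
    refine fun v hv x => ⟨fun hx => ?_, h v hv x⟩
    have := h v⁻¹ (inv_mem hv) _ hx
    rwa [inv_smul_smul] at this
  have hbig : ∀ l : ℕ, ∀ x ∈ s, ¬ P x → ∃ v ∈ radAt conj ϖ i l, v • x ≠ x := by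
    intro l x hx hxP
    induction x using QuotientGroup.induction_on with
    | H x =>
      rcases D.coset_cases ((hmem x).1 hx) with h | ⟨u, y, z, hu, h⟩
      · exact absurd h hxP
      · obtain ⟨v, hv, hne⟩ := D.exists_smul_upper_ne (i := i) l hu
        exact ⟨v, hv, by rw [h]; exact hne⟩
  choose! c hc using fun x (hx : P x ∧ x ≠ x₀) =>
    D.exists_conv_summand_eq hirr hσ hφ hx.1 hx.2
  refine ⟨∑ x ∈ (s.filter P).erase x₀, c x, fun n hn l => ?_⟩
  have hn0 : n ≠ 0 := by omega
  change convFun (φ 1) (φ n) (α ^ l) = _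
  rw [convFun_eq_sum (isOpen_maxK conj i), ← hs]
  rcases eq_or_ne l 0 with rfl | hl
  · rw [if_neg hn0.symm, if_neg (by omega)]
    refine D.sum_conv_eq_zero hirr hσ (φ 1) (φ n) 0 s
      (fun v hv => hstab v (mem_radAt_zero.1 hv)) fun x hx => ?_
    by_cases hxP : P x
    · obtain ⟨m, hm, rfl⟩ := hxP
      obtain ⟨v, hv, hne⟩ := D.exists_smul_radK_ne hm
      exact ⟨v, mem_radAt_zero.2 hv, hne⟩
    · exact hbig 0 x hx hxP
  have hx₀s : x₀ ∈ s.filter P := by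
    refine Finset.mem_filter.2 ⟨(hmem α).2 ?_, 1, one_mem _, by rw [one_mul]⟩
    simpa using alpha_pow_mem_cell (conj := conj) (ϖ := ϖ) (i := i) 1
  have hzero := D.sum_conv_eq_zero hirr hσ (φ 1) (φ n) l (s.filter fun x => ¬ P x)
    (fun v hv x hx => by
      obtain ⟨h1, h2⟩ := Finset.mem_filter.1 hx
      have hv' := (mem_radAt.1 hv).1
      exact Finset.mem_filter.2 ⟨hstab v hv' x h1, fun h => h2 ((hPstab v hv' x).1 h)⟩)
    (fun x hx => hbig l x (Finset.mem_filter.1 hx).1 (Finset.mem_filter.1 hx).2)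
  rw [← Finset.sum_filter_add_sum_filter_not s P, hzero, add_zero,
    ← Finset.add_sum_erase _ _ hx₀s]
  have hrest : ∀ x ∈ (s.filter P).erase x₀,
      (φ 1).1 x.out * (φ n).1 (x.out⁻¹ * α ^ l) =
        if l = n then c x • jSigma conj i σ else 0 := by
    intro x hx
    obtain ⟨h1, h2⟩ := Finset.mem_erase.1 hx
    exact hc x ⟨(Finset.mem_filter.1 h2).2, h1⟩ n l hn0 hl
  rw [Finset.sum_congr rfl hrest, hx₀, conv_summand_out]
  obtain ⟨r, rfl⟩ := Nat.exists_eq_succ_of_ne_zero hl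
  have h1 : (φ 1).1 α = jSigma conj i σ := by simpa using (hφ 1).2
  have h2 : α⁻¹ * α ^ (r + 1) = α ^ r := by rw [pow_succ', inv_mul_cancel_left]
  rw [h1, Nat.succ_eq_add_one, h2]
  by_cases hrn : r = n
  · subst hrn
    rw [(hφ r).2, if_neg hn0, if_neg (by omega), if_pos rfl, D.jSigma_mul_self hirr hσ]
    simp
  · rw [D.apply_alpha_pow_eq_zero (hφ n) hrn, mul_zero, zero_add]
    by_cases hl' : r + 1 = n
    · simp only [if_pos hl', Finset.sum_smul]
    · simp [if_neg hl', hrn]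

end Convolution

/-! ### Algebras with a basis satisfying a two-term recursion -/

section PolynomialBasis

open Polynomial

/-- The polynomials `1` and `(X - c)ⁿ X` for `n ≥ 0`. -/
def recPoly {k : Type*} [Field k] (c : k) : ℕ → k[X]
  | 0 => 1
  | n + 1 => (X - C c) ^ n * X

lemma natDegree_recPoly {k : Type*} [Field k] (c : k) (n : ℕ) : (recPoly c n).natDegree = n := by
  cases n with
  | zero => simp [recPoly]
  | succ n =>
    rw [recPoly, natDegree_mul (pow_ne_zero _ (X_sub_C_ne_zero c)) X_ne_zero, natDegree_pow,
      natDegree_X_sub_C, natDegree_X, mul_one]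

lemma monic_recPoly {k : Type*} [Field k] (c : k) (n : ℕ) : (recPoly c n).Monic := by
  cases n with
  | zero => exact monic_one
  | succ n => exact ((monic_X_sub_C c).pow n).mul monic_X

/-- The polynomials `recPoly c n` as a sequence of polynomials of degree `n`. -/
def recSequence {k : Type*} [Field k] (c : k) : Polynomial.Sequence k where
  elems' := recPoly c
  degree_eq' n := by
    rw [degree_eq_natDegree (monic_recPoly c n).ne_zero, natDegree_recPoly]

/-- If an algebra has a basis `e₀ = 1, e₁, e₂, …` with `e₁ eₙ = c eₙ + eₙ₊₁` for `n ≥ 1`, then it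
is the polynomial algebra in `e₁`: the basis is the image of `1` and the `(X - c)ⁿ X`. -/
lemma bijective_aeval_of_recursion {k A : Type*} [Field k] [Semiring A] [Algebra k A] {e : ℕ → A}
    (hli : LinearIndependent k e) (hspan : Submodule.span k (Set.range e) = ⊤) (h0 : e 0 = 1)
    {c : k} (hrec : ∀ n, 1 ≤ n → e 1 * e n = c • e n + e (n + 1)) :
    Function.Bijective (aeval (R := k) (e 1)) := by
  let _ : Ring A := Algebra.semiringToRing k
  have key : ∀ n, aeval (e 1) (recPoly c n) = e n := by
    intro n
    cases n with
    | zero => simp [recPoly, h0]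
    | succ n =>
      induction n with
      | zero => simp [recPoly]
      | succ n ih =>
        have h1 : recPoly c (n + 1 + 1) = (X - C c) * recPoly c (n + 1) := by
          simp only [recPoly]; ring
        rw [h1, map_mul, ih, map_sub, aeval_X, aeval_C, sub_mul, hrec (n + 1) (by omega),
          ← Algebra.smul_def, add_sub_cancel_left]
  let S := recSequence c
  let b : Module.Basis ℕ k k[X] := S.basis fun n => by
    rw [show (S n).leadingCoeff = 1 from monic_recPoly c n]
    exact isUnit_one
  let b' : Module.Basis ℕ k A := Module.Basis.mk hli hspan.ge
  have hb : (aeval (R := k) (e 1)).toLinearMap = (b.equiv b' (Equiv.refl ℕ)).toLinearMap := by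
    refine b.ext fun n => ?_
    rw [LinearEquiv.coe_coe, Module.Basis.equiv_apply, Equiv.refl_apply, Module.Basis.mk_apply]
    have : b n = recPoly c n := Module.Basis.mk_apply _ _ n
    rw [this]
    exact key n
  have : ⇑(aeval (R := k) (e 1)) = ⇑(b.equiv b' (Equiv.refl ℕ)) :=
    congrArg (fun f : k[X] →ₗ[k] A => (f : k[X] → A)) hb
  rw [this]
  exact (b.equiv b' (Equiv.refl ℕ)).bijective

end PolynomialBasis

/-! ### The structure of the Hecke algebra -/

section Final

variable {F E : Type*} [Field F] [Field E] [Algebra F E]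
  [ValuativeRel E] [TopologicalSpace E] [IsNonarchimedeanLocalField E]
  {p : ℕ} {conj : E ≃ₐ[F] E} {ϖ : Fˣ} {i : Fin 2}
  {k W : Type*} [Field k] [AddCommGroup W] [Module k W]
  {σ : Representation k (maxK conj i) W}

local notation "α" => alpha conj ϖ

lemma IsUnramifiedDatum.conv_eq (D : IsUnramifiedDatum p conj ϖ)
    {φ : ℕ → heckeFun σ} (hφ : ∀ n, IsPhi conj ϖ i σ n (φ n)) {c : k} {n : ℕ} (hn : 1 ≤ n)
    (hc : ∀ l : ℕ, (conv (isOpen_maxK conj i) (φ 1) (φ n)).1 (α ^ l) =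
      if l = n then c • jSigma conj i σ else if l = n + 1 then jSigma conj i σ else 0) :
    conv (isOpen_maxK conj i) (φ 1) (φ n) = c • φ n + φ (n + 1) := by
  refine D.heckeFun_ext fun l => ?_
  rw [hc]
  change _ = c • (φ n).1 (α ^ l) + (φ (n + 1)).1 (α ^ l)
  split_ifs with h1 h2
  · rw [h1, (hφ n).2, if_neg (by omega), D.apply_alpha_pow_eq_zero (hφ (n + 1)) (by omega),
      add_zero]
  · rw [h2, (hφ (n + 1)).2, if_neg (by omega), D.apply_alpha_pow_eq_zero (hφ n) (by omega),
      smul_zero, zero_add]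
  · rw [D.apply_alpha_pow_eq_zero (hφ n) h1, D.apply_alpha_pow_eq_zero (hφ (n + 1)) h2,
      smul_zero, zero_add]

variable [Fact p.Prime] [CharP k p] [IsAlgClosed k]
  (D : IsUnramifiedDatum p conj ϖ) (hirr : σ.IsIrreducible) (hσ : IsSmooth σ)
  {φ : ℕ → heckeFun σ} (hφ : ∀ n, IsPhi conj ϖ i σ n (φ n))
include D hirr hσ hφ

lemma IsUnramifiedDatum.bijective_aeval {c : k} (hc : ∀ n, 1 ≤ n →
      conv (isOpen_maxK conj i) (φ 1) (φ n) = c • φ n + φ (n + 1)) :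
    Function.Bijective (Polynomial.aeval (R := k) (heckeOp (isOpen_maxK conj i) (φ 1))) := by
  have := D.compactSpace_maxK (i := i)
  have := finiteDimensional_of_isSmooth hirr hσ
  have hbij := heckeOp_bijective (isOpen_maxK conj i) D.isCompact_maxK hσ
  refine bijective_aeval_of_recursion (e := fun n => heckeOp (isOpen_maxK conj i) (φ n))
    ((D.linearIndependent_phi hirr hσ hφ).map_injOn _ hbij.1.injOn) ?_ ?_ (c := c) fun n hn => ?_
  · have h1 : Set.range (fun n => heckeOp (isOpen_maxK conj i) (φ n)) =
        heckeOp (isOpen_maxK conj i) '' Set.range φ := Set.range_comp _ _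
    rw [h1, Submodule.span_image, D.span_phi hirr hσ hφ, Submodule.map_top]
    exact LinearMap.range_eq_top.2 hbij.2
  · refine heckeOp_eq_one (isOpen_maxK conj i) D.isCompact_maxK hσ (φ 0) (fun g hg => ?_) ?_
    · by_contra h
      exact hg (mem_cell_zero.1 ((hφ 0).1 h))
    · simpa using (hφ 0).2
  · rw [← heckeOp_conv (isOpen_maxK conj i) D.isCompact_maxK hσ, hc n hn, map_add, map_smul]

end Final

end Hecke

end

theorem mainTheorem2 {F E : Type*} [Field F] [Field E] [Algebra F E]
    [ValuativeRel F] [TopologicalSpace F] [IsNonarchimedeanLocalField F]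
    [ValuativeRel E] [TopologicalSpace E] [IsNonarchimedeanLocalField E]
    [ValuativeExtension F E]
    (hquad : Module.finrank F E = 2) (hunr : Hecke.IsUnramified F E)
    (p : ℕ) [Fact p.Prime] (hp : p ≠ 2) [CharP 𝓀[F] p]
    (conj : E ≃ₐ[F] E) (hconj : conj ≠ AlgEquiv.refl)
    (ϖ : Fˣ) (hϖ : ValuativeRel.valuation E (algebraMap F E ϖ) = ValuativeRel.uniformizer E)
    (i : Fin 2) {W : Type*} [AddCommGroup W] [Module (AlgebraicClosure (ZMod p)) W]
    (σ : Representation (AlgebraicClosure (ZMod p)) (Hecke.maxK conj i) W)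
    (hirr : σ.IsIrreducible) (hsmooth : Hecke.IsSmooth σ) :
    -- the natural map from invariants to coinvariants is an isomorphism of lines
    (Module.finrank (AlgebraicClosure (ZMod p))
        (Representation.invariants (σ.comp (Hecke.proIwahori conj i).subtype)) = 1 ∧
      Function.Bijective
        (Hecke.invToCoinv (Hecke.proIwahori conj i) (Hecke.proIwahori' conj i) σ)) ∧
    -- the convolution algebra is identified with the algebra of `G`-endomorphisms
    (Function.Bijective (Hecke.heckeOp (σ := σ) (Hecke.isOpen_maxK conj i)) ∧
      ∀ φ ψ : Hecke.heckeFun σ,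
        Hecke.heckeOp (Hecke.isOpen_maxK conj i) (Hecke.conv (Hecke.isOpen_maxK conj i) φ ψ) =
          Hecke.heckeOp (Hecke.isOpen_maxK conj i) φ *
            Hecke.heckeOp (Hecke.isOpen_maxK conj i) ψ) ∧
    ∃ φ : ℕ → Hecke.heckeFun σ,
      -- `φ n` is the function with support `K αⁿ K` and the prescribed value at `αⁿ`
      (∀ n, Hecke.IsPhi conj ϖ i σ n (φ n) ∧
        (∀ ψ, Hecke.IsPhi conj ϖ i σ n ψ → ψ = φ n) ∧
        Function.support (φ n).1 = Hecke.cell conj ϖ i n) ∧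
      -- the `φ n` form a basis
      (LinearIndependent (AlgebraicClosure (ZMod p)) φ ∧
        Submodule.span (AlgebraicClosure (ZMod p)) (Set.range φ) = ⊤) ∧
      -- the convolution relations
      (∃ c : AlgebraicClosure (ZMod p), ∀ n : ℕ, 1 ≤ n →
        (∀ l : ℕ, (Hecke.conv (Hecke.isOpen_maxK conj i) (φ 1) (φ n)).1
            (Hecke.alpha conj ϖ ^ l) =
          if l = n then c • Hecke.jSigma conj i σ
          else if l = n + 1 then Hecke.jSigma conj i σ else 0) ∧
        Hecke.conv (Hecke.isOpen_maxK conj i) (φ 1) (φ n) = c • φ n + φ (n + 1)) ∧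
      -- `End_G(ind σ)` is the polynomial algebra in the operator `T` attached to `φ 1`
      Function.Bijective (Polynomial.aeval (R := AlgebraicClosure (ZMod p))
        (Hecke.heckeOp (Hecke.isOpen_maxK conj i) (φ 1))) := by
  have D := Hecke.isUnramifiedDatum hquad p hp conj hconj ϖ hϖ
  have := D.compactSpace_maxK (i := i)
  have := Hecke.finiteDimensional_of_isSmooth hirr hsmooth
  refine ⟨D.finrank_and_bijective hirr hsmooth,
    ⟨Hecke.heckeOp_bijective (Hecke.isOpen_maxK conj i) D.isCompact_maxK hsmooth,
      Hecke.heckeOp_conv (Hecke.isOpen_maxK conj i) D.isCompact_maxK hsmooth⟩, ?_⟩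
  choose φ hφ using D.exists_isPhi (ϖ := ϖ) hirr hsmooth
  obtain ⟨c, hc⟩ := D.exists_conv_apply hirr hsmooth hφ
  have hrec := fun n hn => D.conv_eq hφ (n := n) hn (hc n hn)
  exact ⟨φ, fun n => ⟨hφ n, fun ψ hψ => D.isPhi_unique (hφ n) hψ,
      D.support_eq_cell hirr hsmooth (hφ n)⟩,
    ⟨D.linearIndependent_phi hirr hsmooth hφ, D.span_phi hirr hsmooth hφ⟩,
    ⟨c, fun n hn => ⟨hc n hn, hrec n hn⟩⟩, D.bijective_aeval hirr hsmooth hφ hrec⟩
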